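/- Let $n\ge 1$ and let $V\subseteq\mathbb P^{n-1}$ be an irreducible (closed) complex projective variety of codimension $c$, not contained in the isotropic quadric $Q=\{\psi : \psi^T\psi=0\}$. Let $V_{\rm reg}$ be its set of nonsingular points. For a nonzero symmetric matrix $H\in{\rm Sym}^2(\mathbb C^n)$, a critical point for $H$ is a point $\psi\in V_{\rm reg}\setminus Q$ such that the gradient at $\psi$ of the Rayleigh quotient $\frac{\psi^TH\psi}{\psi^T\psi}$ is orthogonal, for the bilinear form $x^Ty$, to the (affine) tangent space $T_\psi V\subseteq\mathbb C^n$; this depends only on the class of $H$ in $\mathbb P({\rm Sym}^2(\mathbb C^n))$. Let the Rayleigh-Ritz correspondence $$\mathcal R_V=\overline{\{(\psi,H)\in V_{\rm reg}\times\mathbb P({\rm Sym}^2(\mathbb C^n)) : \psi\text{ is a critical point for }H\}}\subseteq \mathbb P^{n-1}\times\mathbb P({\rm Sym}^2(\mathbb C^n))$$ be the Zariski closure of the set of such pairs, with projections $\pi_1$ and $\pi_2$ to the two factors. Then: 1. $\mathcal R_V$ is an irreducible variety of dimension $\binom{n+1}{2}-1$. 2. $\pi_1$ maps $\mathcal R_V$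 into $V$, and over $V_{\rm reg}\setminus Q$ it is a projectivized vector bundle with fibres of projective dimension $\binom{n+1}{2}-n+c$: there is an algebraic vector subbundle $E$, of rank $\binom{n+1}{2}-n+c+1$, of the trivial bundle $(V_{\rm reg}\setminus Q)\times{\rm Sym}^2(\mathbb C^n)$ such that $\pi_1^{-1}(\psi)=\{\psi\}\times\mathbb P(E_\psi)$ for all $\psi\in V_{\rm reg}\setminus Q$. 3. There is a unique integer $d\ge 0$, called the Rayleigh-Ritz degree of $V$, such that for all $H$ in some nonempty Zariski-open subset of $\mathbb P({\rm Sym}^2(\mathbb C^n))$ there are exactly $d$ critical points for $H$. For all $H$ in some nonempty Zariski-open subset of $\mathbb P({\rm Sym}^2(\mathbb C^n))$, the fibre $\pi_2^{-1}(H)\subseteq\mathcal R_V$ is finite of cardinality $d$. -/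

import Mathlib

noncomputable section

open MvPolynomial

namespace RayleighRitz

/-- The complex projective space with homogeneous coordinates indexed by `ι`.
It is a type synonym, so that it can carry its Zariski topology. -/
def ProjSpace (ι : Type) : Type := Projectivization ℂ (ι → ℂ)

namespace ProjSpace

variable {ι : Type}

/-- The point of projective space spanned by a nonzero vector. -/
def mk (v : ι → ℂ) (hv : v ≠ 0) : ProjSpace ι := Projectivization.mk ℂ v hv

/-- A vector of homogeneous coordinates of a point. -/
def rep (p : ProjSpace ι) : ι → ℂ := Projectivization.rep p

/-- The Zariski topology on projective space: the closed sets are the common zero loci of sets of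
homogeneous polynomials. -/
instance : TopologicalSpace (ProjSpace ι) :=
  TopologicalSpace.ofClosed
    {Z | ∃ S : Set (MvPolynomial ι ℂ), (∀ f ∈ S, ∃ d : ℕ, f.IsHomogeneous d) ∧
      Z = {p : ProjSpace ι | ∀ f ∈ S, eval p.rep f = 0}}
    ⟨{1}, by rintro f rfl; exact ⟨0, isHomogeneous_one ι ℂ⟩, by ext p; simp⟩
    (by
      intro A hA
      refine ⟨{f | (∃ d : ℕ, f.IsHomogeneous d) ∧ ∃ Z ∈ A, ∀ p ∈ Z, eval p.rep f = 0},
        fun f hf => hf.1, ?_⟩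
      ext p
      constructor
      · rintro hp f ⟨-, Z, hZ, h⟩
        exact h p (hp Z hZ)
      · intro hp Z hZ
        obtain ⟨S, hS, rfl⟩ := hA hZ
        intro f hf
        exact hp f ⟨hS f hf, _, hZ, fun q hq => hq f hf⟩)
    (by
      rintro _ ⟨S, hS, rfl⟩ _ ⟨T, hT, rfl⟩
      refine ⟨{f | ∃ a ∈ S, ∃ b ∈ T, f = a * b}, ?_, ?_⟩
      · rintro _ ⟨a, ha, b, hb, rfl⟩
        obtain ⟨d, hd⟩ := hS a ha
        obtain ⟨e, he⟩ := hT b hb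
        exact ⟨d + e, hd.mul he⟩
      · ext p
        constructor
        · rintro (hp | hp) _ ⟨a, ha, b, hb, rfl⟩
          · simp [hp a ha]
          · simp [hp b hb]
        · intro hp
          by_contra hcon
          simp only [Set.mem_union, Set.mem_ofPred_eq, not_or, not_forall] at hcon
          obtain ⟨⟨a, ha, ha0⟩, b, hb, hb0⟩ := hcon
          have := hp _ ⟨a, ha, b, hb, rfl⟩
          rw [map_mul] at this
          exact (mul_ne_zero ha0 hb0) this)

end ProjSpace

/-- The product of two projective spaces. It is a structure of its own, since its Zariski topology
is not the product topology. -/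
structure BiProj (ι κ : Type) : Type where
  /-- the first projection -/
  fst : ProjSpace ι
  /-- the second projection -/
  snd : ProjSpace κ

/-- The two weights that record the degree of a polynomial in the first and in the second group of
variables. -/
def biWeight (ι κ : Type) : ι ⊕ κ → ℕ × ℕ := Sum.elim (fun _ => (1, 0)) (fun _ => (0, 1))

namespace BiProj

variable {ι κ : Type}

/-- Homogeneous coordinates of a point of the product. -/
def rep (x : BiProj ι κ) : ι ⊕ κ → ℂ := Sum.elim x.fst.rep x.snd.rep

/-- The Zariski topology on the product of two projective spaces: the closed sets are the common
zero loci of sets of bihomogeneous polynomials. -/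
instance : TopologicalSpace (BiProj ι κ) :=
  TopologicalSpace.ofClosed
    {Z | ∃ S : Set (MvPolynomial (ι ⊕ κ) ℂ),
      (∀ f ∈ S, ∃ d : ℕ × ℕ, f.IsWeightedHomogeneous (biWeight ι κ) d) ∧
      Z = {x : BiProj ι κ | ∀ f ∈ S, eval x.rep f = 0}}
    ⟨{1}, by rintro f rfl; exact ⟨0, isWeightedHomogeneous_one ℂ _⟩, by ext p; simp⟩
    (by
      intro A hA
      refine ⟨{f | (∃ d : ℕ × ℕ, f.IsWeightedHomogeneous (biWeight ι κ) d) ∧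
        ∃ Z ∈ A, ∀ p ∈ Z, eval p.rep f = 0}, fun f hf => hf.1, ?_⟩
      ext p
      constructor
      · rintro hp f ⟨-, Z, hZ, h⟩
        exact h p (hp Z hZ)
      · intro hp Z hZ
        obtain ⟨S, hS, rfl⟩ := hA hZ
        intro f hf
        exact hp f ⟨hS f hf, _, hZ, fun q hq => hq f hf⟩)
    (by
      rintro _ ⟨S, hS, rfl⟩ _ ⟨T, hT, rfl⟩
      refine ⟨{f | ∃ a ∈ S, ∃ b ∈ T, f = a * b}, ?_, ?_⟩
      · rintro _ ⟨a, ha, b, hb, rfl⟩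
        obtain ⟨d, hd⟩ := hS a ha
        obtain ⟨e, he⟩ := hT b hb
        exact ⟨d + e, hd.mul he⟩
      · ext p
        constructor
        · rintro (hp | hp) _ ⟨a, ha, b, hb, rfl⟩
          · simp [hp a ha]
          · simp [hp b hb]
        · intro hp
          by_contra hcon
          simp only [Set.mem_union, Set.mem_ofPred_eq, not_or, not_forall] at hcon
          obtain ⟨⟨a, ha, ha0⟩, b, hb, hb0⟩ := hcon
          have := hp _ ⟨a, ha, b, hb, rfl⟩
          rw [map_mul] at this
          exact (mul_ne_zero ha0 hb0) this)

end BiProj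

/-- An algebraic vector subbundle of rank `m` of the trivial bundle with fibre `ℂ^κ` over a subset
`B` of projective space: a family of linear subspaces `E q` of `ℂ^κ` that has, Zariski-locally on
`B`, a frame of `m` sections with regular coordinates. Regular functions on a neighbourhood of a
point are quotients of homogeneous polynomials of equal degrees with nonvanishing denominator;
finitely many of them may be given a common denominator `g`. -/
def IsAlgebraicSubbundle {ι κ : Type} (B : Set (ProjSpace ι))
    (E : ProjSpace ι → Submodule ℂ (κ → ℂ)) (m : ℕ) : Prop :=
  ∀ p ∈ B, ∃ U : Set (ProjSpace ι), IsOpen U ∧ p ∈ U ∧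
    ∃ (e : ℕ) (g : MvPolynomial ι ℂ) (s : Fin m → κ → MvPolynomial ι ℂ),
      g.IsHomogeneous e ∧ (∀ j k, (s j k).IsHomogeneous e) ∧
      ∀ q ∈ U ∩ B, eval q.rep g ≠ 0 ∧
        LinearIndependent ℂ (fun (j : Fin m) (k : κ) => eval q.rep (s j k) / eval q.rep g) ∧
        E q = Submodule.span ℂ
          (Set.range fun (j : Fin m) (k : κ) => eval q.rep (s j k) / eval q.rep g)

variable {n : ℕ}

/-- The affine cone (without the origin) over a subset of projective space. -/
def affineCone (V : Set (ProjSpace (Fin n))) : Set (Fin n → ℂ) :=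
  {v | ∃ hv : v ≠ 0, ProjSpace.mk v hv ∈ V}

/-- The affine tangent space of `V` at a vector `v` on its cone: the kernel at `v` of the Jacobian
matrix of the vanishing ideal of `V`. -/
def tangentSpace (V : Set (ProjSpace (Fin n))) (v : Fin n → ℂ) : Submodule ℂ (Fin n → ℂ) where
  carrier := {w | ∀ f ∈ vanishingIdeal ℂ (affineCone V), ∑ i, eval v (pderiv i f) * w i = 0}
  add_mem' := by
    intro a b ha hb f hf
    simp only [Pi.add_apply, mul_add, Finset.sum_add_distrib, ha f hf, hb f hf, add_zero]
  zero_mem' := by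
    intro f _
    simp
  smul_mem' := by
    intro c a ha f hf
    have h : ∑ i, eval v (pderiv i f) * (c • a) i = c * ∑ i, eval v (pderiv i f) * a i := by
      rw [Finset.mul_sum]
      exact Finset.sum_congr rfl fun i _ => by simp only [Pi.smul_apply, smul_eq_mul]; ring
    rw [h, ha f hf, mul_zero]

/-- The regular locus of an irreducible projective variety, by the Jacobian criterion: the affine
tangent space has dimension `dim V + 1`. -/
def regularLocus (V : Set (ProjSpace (Fin n))) : Set (ProjSpace (Fin n)) :=
  {p | p ∈ V ∧
    ((Module.finrank ℂ (tangentSpace V p.rep) : ℕ) : WithBot ℕ∞) = topologicalKrullDim V + 1}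

/-- The isotropic quadric, the zero locus of `ψᵀψ`. -/
def isotropicQuadric (n : ℕ) : Set (ProjSpace (Fin n)) := {p | p.rep ⬝ᵥ p.rep = 0}

/-- The symmetric matrix with entries `h_{ij} = h_{ji}`. In these coordinates the space of symmetric
`n × n` matrices is `Sym2 (Fin n) → ℂ`, and its projective space is `ProjSpace (Sym2 (Fin n))`. -/
def symMatrix (h : Sym2 (Fin n) → ℂ) : Matrix (Fin n) (Fin n) ℂ :=
  Matrix.of fun i j => h s(i, j)

/-- The Rayleigh quotient `ψᵀHψ / ψᵀψ`. -/
def rayleigh (H : Matrix (Fin n) (Fin n) ℂ) (v : Fin n → ℂ) : ℂ :=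
  (v ⬝ᵥ (H.mulVec v)) / (v ⬝ᵥ v)

/-- `p` is a critical point on `V` of the Rayleigh quotient of the symmetric matrix with class `h`:
a nonsingular nonisotropic point of `V` at which the gradient of the Rayleigh quotient is orthogonal
(for the bilinear form `xᵀy`) to the tangent space of `V`, that is, at which the differential of the
Rayleigh quotient vanishes on the tangent space. -/
def IsCriticalPoint (V : Set (ProjSpace (Fin n))) (h : ProjSpace (Sym2 (Fin n)))
    (p : ProjSpace (Fin n)) : Prop :=
  p ∈ regularLocus V ∧ p ∉ isotropicQuadric n ∧
    ∀ w ∈ tangentSpace V p.rep, fderiv ℂ (rayleigh (symMatrix h.rep)) p.rep w = 0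

/-- The Rayleigh-Ritz correspondence: the Zariski closure of the set of pairs of a critical point
and its matrix. -/
def rrCorrespondence (V : Set (ProjSpace (Fin n))) : Set (BiProj (Fin n) (Sym2 (Fin n))) :=
  closure {x | IsCriticalPoint V x.snd x.fst}

/-- `d` is the Rayleigh-Ritz degree of `V`: for general `H` (those in some nonempty Zariski-open
set) there are exactly `d` critical points. -/
def IsRRDegree (V : Set (ProjSpace (Fin n))) (d : ℕ) : Prop :=
  ∃ U : Set (ProjSpace (Sym2 (Fin n))), IsOpen U ∧ U.Nonempty ∧
    ∀ h ∈ U, {p | IsCriticalPoint V h p}.Finite ∧ {p | IsCriticalPoint V h p}.ncard = d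

end RayleighRitz

end

/-! The condition on a pair (ψ, H) is linear in H. At a nonisotropic ψ the gradient of the Rayleigh
quotient is a nonzero multiple of (ψᵀψ)Hψ − (ψᵀHψ)ψ (`fderiv_rayleigh`), so a regular ψ is critical
exactly when this vector lies in the span of the gradients a_1, …, a_c of c equations of V that are
independent at ψ. By Euler's identity the a_j are orthogonal to ψ, and the condition becomes that Hψ
lies in the span of ψ, a_1, …, a_c. Such matrices have an explicit frame, `rayleighFrame`: the
square of ψ, the symmetrized products of ψ with the a_j, and the symmetrized products of Koszul
vectors, which span the matrices that kill ψ. It has 1 + c + n(n−1)/2 members, polynomial in ψ,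
which gives the bundle (`HasCodim.isAlgebraicSubbundle`). The closure adds nothing over the regular
nonisotropic locus, because there the equations on (ψ, H) are locally polynomial
(`HasCodim.mem_rayleighSpace_of_mem_closure`).

Let ξ be a generic point of the cone over V. A combination of the frame at ξ with indeterminate
coefficients, paired with ξ, is a generic point of the correspondence
(`GenericFrame.aeval_incidencePoint_eq_zero_iff`). Hence the correspondence has a prime ideal and is
irreducible. The transcendence degree is dim V + 1 plus the rank of the frame
(`GenericFrame.trRank_incidencePoint`), that is (n+1 choose 2) + 1; the two rescalings of ψ and H
account for 2. Krull dimension and transcendence degree are compared in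
`TorusQuotient.exists_topologicalKrullDim_eq`, for projective space and for the product of two
projective spaces at once, both being quotients by a torus.

The correspondence thus has the dimension of the space of matrices. If the H-coordinates of its
generic point are algebraically dependent, the general fibre of the second projection is empty.
Otherwise the affine coordinates of the ψ-part are algebraic over them (`isAlgebraic_chart`) and
generate a finite separable extension, whose degree is the number of points of the general affine
fibre (`exists_generic_fiber_card`). A polynomial that is nonzero at the generic point is nonzero at
every point of a general fibre (`exists_forall_eval_ne_zero`). Applied to a coordinate times an
equation of the bad locus, this shows that all points of a general fibre lie in one chart and are
critical points. -/

noncomputable section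

open MvPolynomial

namespace RayleighRitz

/-! ### Transcendence degree as a matroid rank, and Krull dimension. -/

section TranscendenceRank

open AlgebraicIndependent

variable {k L L' σ τ : Type} [Field k] [Field L] [Algebra k L] [Field L'] [Algebra k L']

/-- The transcendence degree of the subextension generated by a family of elements. -/
def trRank (k : Type) [Field k] {L : Type} [Field L] [Algebra k L] (S : Set L) : ℕ∞ :=
  (matroid k L).eRk S

theorem mem_matroid_closure_iff {S : Set L} {a : L} :
    a ∈ (matroid k L).closure S ↔ IsAlgebraic (Algebra.adjoin k S) a := by
  rw [matroid_closure_eq]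
  rfl

theorem trRank_mono {S T : Set L} (h : S ⊆ T) : trRank k S ≤ trRank k T :=
  (matroid k L).eRk_mono h

theorem trRank_le_of_isAlgebraic {S T : Set L}
    (h : ∀ a ∈ S, IsAlgebraic (Algebra.adjoin k T) a) : trRank k S ≤ trRank k T := by
  refine ((matroid k L).eRk_mono fun a ha => mem_matroid_closure_iff.mpr (h a ha)).trans ?_
  rw [Matroid.eRk_closure_eq]
  rfl

theorem trRank_union_le (S T : Set L) : trRank k (S ∪ T) ≤ trRank k S + T.encard :=
  (matroid k L).eRk_union_le_eRk_add_encard S T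

theorem trRank_range_le [Finite σ] (x : σ → L) : trRank k (Set.range x) ≤ Nat.card σ := by
  refine ((matroid k L).eRk_le_encard _).trans ?_
  rw [← Set.image_univ]
  refine (Set.encard_image_le x Set.univ).trans ?_
  rw [Set.encard_univ]
  simp [ENat.card_eq_coe_natCard]

theorem trRank_range_of_algebraicIndependent [Finite σ] {x : σ → L}
    (hx : AlgebraicIndependent k x) : trRank k (Set.range x) = Nat.card σ := by
  have h : (matroid k L).Indep (Set.range x) := by
    rw [matroid_indep_iff]
    exact hx.coe_range
  rw [trRank, h.eRk_eq_encard, ← Set.image_univ, hx.injective.encard_image, Set.encard_univ]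
  simp [ENat.card_eq_coe_natCard]

/-- A transcendental element of T would raise the rank of the independent family above the bound. -/
theorem isAlgebraic_of_trRank_le [Finite σ] {x : σ → L} (hx : AlgebraicIndependent k x)
    {T : Set L} (hxT : Set.range x ⊆ T) (hT : trRank k T ≤ Nat.card σ) :
    ∀ a ∈ T, IsAlgebraic (Algebra.adjoin k (Set.range x)) a := by
  intro a ha
  by_contra hcon
  rw [← mem_matroid_closure_iff] at hcon
  have h := (matroid k L).eRk_insert_eq_add_one (e := a) (X := Set.range x) ⟨trivial, hcon⟩
  have h2 : trRank k (insert a (Set.range x)) ≤ trRank k T :=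
    trRank_mono (Set.insert_subset ha hxT)
  have h3 := trRank_range_of_algebraicIndependent hx
  rw [trRank] at h2 h3
  rw [h, h3] at h2
  have := h2.trans hT
  exact absurd this (by rw [not_le]; exact_mod_cast Nat.lt_succ_self _)

/-- A nonzero algebraic element satisfies a polynomial relation with nonzero constant term. -/
theorem exists_relation_of_isAlgebraic {η : τ → L} {a : L}
    (ha : IsAlgebraic (Algebra.adjoin k (Set.range η)) a) (ha0 : a ≠ 0) :
    ∃ P : Polynomial (MvPolynomial τ k), aeval η (P.coeff 0) ≠ 0 ∧
      P.eval₂ (aeval η : MvPolynomial τ k →ₐ[k] L).toRingHom a = 0 := by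
  obtain ⟨p, hp0, hp⟩ := ha.exists_nonzero_coeff_and_aeval_eq_zero
    (mem_nonZeroDivisors_of_ne_zero ha0)
  have hsurj : Function.Surjective
      ((aeval η : MvPolynomial τ k →ₐ[k] L).codRestrict (Algebra.adjoin k (Set.range η))
        (fun q => by rw [Algebra.adjoin_range_eq_range_aeval]; exact ⟨q, rfl⟩)) := by
    rintro ⟨b, hb⟩
    have hb' := hb
    rw [Algebra.adjoin_range_eq_range_aeval] at hb'
    obtain ⟨q, hq⟩ := hb'
    exact ⟨q, Subtype.ext hq⟩
  set φ := ((aeval η : MvPolynomial τ k →ₐ[k] L).codRestrict (Algebra.adjoin k (Set.range η))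
        (fun q => by rw [Algebra.adjoin_range_eq_range_aeval]; exact ⟨q, rfl⟩)) with hφ
  obtain ⟨P, hP⟩ := Polynomial.map_surjective φ.toRingHom hsurj p
  have hcoe : (aeval η : MvPolynomial τ k →ₐ[k] L).toRingHom =
      (algebraMap (Algebra.adjoin k (Set.range η)) L).comp φ.toRingHom := by
    ext <;> rfl
  refine ⟨P, ?_, ?_⟩
  · intro h
    apply hp0
    rw [← hP, Polynomial.coeff_map]
    exact Subtype.ext h
  · rw [hcoe, ← Polynomial.eval₂_map, hP]
    exact hp

/-- A matroid basis of the range, pulled back to the index set, so that relations can be written in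
a subset of the variables. -/
theorem exists_algebraicIndependent_subfamily (k : Type) [Field k] [Algebra k L] (ζ : σ → L) :
    ∃ T : Set σ, AlgebraicIndependent k (fun t : T => ζ t) ∧
      trRank k (Set.range ζ) = T.encard ∧
      ∀ i, IsAlgebraic (Algebra.adjoin k (Set.range fun t : T => ζ t)) (ζ i) := by
  obtain ⟨I, hI⟩ := (matroid k L).exists_isBasis (Set.range ζ)
  have hsub : I ⊆ Set.range ζ := hI.subset
  obtain ⟨T, hT⟩ : ∃ T : Set σ, Set.BijOn ζ T I := by
    obtain ⟨T, -, hT⟩ := Set.SurjOn.exists_bijOn_subset (f := ζ) (s := Set.univ) (t := I)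
      (by intro y hy; obtain ⟨x, rfl⟩ := hsub hy; exact ⟨x, trivial, rfl⟩)
    exact ⟨T, hT⟩
  have hrange : Set.range (fun t : T => ζ t) = I := by
    rw [← hT.image_eq, Set.image_eq_range]
  refine ⟨T, ?_, ?_, ?_⟩
  · have h1 : AlgebraicIndependent k (fun x : I => (x : L)) := matroid_indep_iff.mp hI.indep
    have h2 := h1.comp (fun t : T => (⟨ζ t, hT.mapsTo t.2⟩ : I)) (by
      intro a b hab
      exact Subtype.ext (hT.injOn a.2 b.2 (congrArg Subtype.val hab)))
    exact h2
  · rw [trRank, hI.eRk_eq_encard, ← hT.image_eq, hT.injOn.encard_image]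
  · intro i
    rw [hrange, ← mem_matroid_closure_iff, hI.closure_eq_closure]
    exact (matroid k L).mem_closure_of_mem' ⟨i, rfl⟩ trivial

/-- Relations specialize, so a subfamily that is independent after specialization was independent
before. -/
theorem trRank_le_of_specializes {ζ : σ → L} {ζ' : σ → L'}
    (h : ∀ f : MvPolynomial σ k, aeval ζ f = 0 → aeval ζ' f = 0) :
    trRank k (Set.range ζ') ≤ trRank k (Set.range ζ) := by
  obtain ⟨T, hT, hcard, -⟩ := exists_algebraicIndependent_subfamily k ζ'
  have hind : AlgebraicIndependent k (fun t : T => ζ t) := by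
    rw [algebraicIndependent_iff] at hT ⊢
    intro p hp
    refine hT p ?_
    have := h (rename (↑) p) (by rw [aeval_rename]; exact hp)
    rwa [aeval_rename] at this
  rw [hcard]
  have hi : (matroid k L).Indep (Set.range fun t : T => ζ t) := by
    rw [matroid_indep_iff]; exact hind.coe_range
  have h1 := hi.encard_le_eRk_of_subset (X := Set.range ζ)
    (by rintro _ ⟨t, rfl⟩; exact ⟨t, rfl⟩)
  rw [← Set.image_univ, hind.injective.encard_image, Set.encard_univ] at h1
  rw [trRank]
  simpa using h1

/-- Let T index a transcendence basis of ζ'; it is independent for ζ too. If f(ζ) were algebraic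
over ζ_T, it would satisfy a relation with nonzero constant term; specializing, f becomes 0 and the
constant term becomes a relation among the independent ζ'_T. So f(ζ) adds one to the rank. -/
theorem trRank_lt_of_specializes [Finite σ] {ζ : σ → L} {ζ' : σ → L'}
    (h : ∀ f : MvPolynomial σ k, aeval ζ f = 0 → aeval ζ' f = 0)
    {f : MvPolynomial σ k} (hf' : aeval ζ' f = 0) (hf : aeval ζ f ≠ 0) :
    trRank k (Set.range ζ') < trRank k (Set.range ζ) := by
  obtain ⟨T, hT, hcard, -⟩ := exists_algebraicIndependent_subfamily k ζ'
  have hind : AlgebraicIndependent k (fun t : T => ζ t) := by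
    rw [algebraicIndependent_iff] at hT ⊢
    intro p hp
    refine hT p ?_
    have := h (rename (↑) p) (by rw [aeval_rename]; exact hp)
    rwa [aeval_rename] at this
  have hrk := trRank_range_of_algebraicIndependent hind
  have hTcard : T.encard = (Nat.card T : ℕ∞) := by
    rw [← ENat.card_eq_coe_natCard, ENat.card_coe_set_eq]
  have htr : ¬ IsAlgebraic (Algebra.adjoin k (Set.range fun t : T => ζ t)) (aeval ζ f) := by
    intro halg
    obtain ⟨P, hP0, hP⟩ := exists_relation_of_isAlgebraic halg hf
    set F : MvPolynomial σ k :=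
      P.eval₂ (rename ((↑) : T → σ) : MvPolynomial T k →ₐ[k] MvPolynomial σ k).toRingHom f with hF
    have key : ∀ {M : Type} [Field M] [Algebra k M] (z : σ → M), aeval z F =
        P.eval₂ (aeval (fun t : T => z t) : MvPolynomial T k →ₐ[k] M).toRingHom (aeval z f) := by
      intro M _ _ z
      rw [hF]
      have := Polynomial.hom_eval₂ P
        (rename ((↑) : T → σ) : MvPolynomial T k →ₐ[k] MvPolynomial σ k).toRingHom
        (aeval z : MvPolynomial σ k →ₐ[k] M).toRingHom f
      refine this.trans ?_
      congr 1
      ext <;> simp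
    have h0 : aeval ζ F = 0 := by rw [key]; exact hP
    have h1 := h F h0
    rw [key, hf', Polynomial.eval₂_at_zero] at h1
    have h2 : P.coeff 0 = 0 := (algebraicIndependent_iff.mp hT) _ h1
    exact hP0 (by rw [h2, map_zero])
  rw [← mem_matroid_closure_iff] at htr
  have h1 := (matroid k L).eRk_insert_eq_add_one (e := aeval ζ f)
    (X := Set.range fun t : T => ζ t) ⟨trivial, htr⟩
  have h2 : trRank k (insert (aeval ζ f) (Set.range fun t : T => ζ t)) ≤
      trRank k (Set.range ζ) := by
    refine trRank_le_of_isAlgebraic ?_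
    intro a ha
    have hmem : a ∈ Algebra.adjoin k (Set.range ζ) := by
      rw [Algebra.adjoin_range_eq_range_aeval]
      rcases ha with rfl | ⟨t, rfl⟩
      · exact ⟨f, rfl⟩
      · exact ⟨X (t : σ), by simp⟩
    exact isAlgebraic_algebraMap (⟨a, hmem⟩ : Algebra.adjoin k (Set.range ζ))
  rw [hcard, hTcard]
  rw [trRank] at h2 hrk
  rw [h1, hrk] at h2
  refine lt_of_lt_of_le ?_ h2
  exact_mod_cast Nat.lt_succ_self _

/-- Lying over and going up lift every chain of primes of R to a chain of the same length in S. -/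
theorem le_ringKrullDim_of_isIntegral_injective {R S : Type} [CommRing R] [CommRing S]
    [Algebra R S] [Algebra.IsIntegral R S] (hinj : Function.Injective (algebraMap R S)) :
    ringKrullDim R ≤ ringKrullDim S := by
  rcases subsingleton_or_nontrivial R with h | h
  · rw [ringKrullDim_eq_bot_of_subsingleton]; exact bot_le
  refine iSup_le fun l => ?_
  have : FaithfulSMul R S := (faithfulSMul_iff_algebraMap_injective R S).mpr hinj
  obtain ⟨P, hP⟩ := Ideal.nonempty_primesOver (S := S) (RelSeries.head l).asIdeal
  have := hP.1
  have := hP.2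
  obtain ⟨M, hM, -⟩ := Ideal.exists_ltSeries_of_hasGoingUp l P
  rw [← hM]
  exact Order.LTSeries.length_le_krullDim M

/-- The Krull dimension of a finitely generated domain is at least its transcendence degree. -/
theorem trRank_le_ringKrullDim [Finite σ] (ζ : σ → L) :
    ((trRank k (Set.range ζ) : ℕ∞) : WithBot ℕ∞) ≤
      ringKrullDim (aeval ζ : MvPolynomial σ k →ₐ[k] L).range := by
  have hft : Algebra.FiniteType k (aeval ζ : MvPolynomial σ k →ₐ[k] L).range :=
    Algebra.FiniteType.of_surjective (aeval ζ : MvPolynomial σ k →ₐ[k] L).rangeRestrict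
      (AlgHom.rangeRestrict_surjective _)
  -- Noether normalization. The number s is at most the Krull dimension, by going up from a
  -- polynomial ring in s variables, and at least the transcendence degree, because every ζ_i is
  -- integral over the images of these variables.
  obtain ⟨s, g, hinj, hint⟩ :=
    exists_integral_inj_algHom_of_fg k (aeval ζ : MvPolynomial σ k →ₐ[k] L).range
  have h1 : (s : WithBot ℕ∞) ≤ ringKrullDim (aeval ζ : MvPolynomial σ k →ₐ[k] L).range := by
    algebraize [g.toRingHom]
    have := le_ringKrullDim_of_isIntegral_injective (R := MvPolynomial (Fin s) k)
      (S := (aeval ζ : MvPolynomial σ k →ₐ[k] L).range) hinj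
    rw [MvPolynomial.ringKrullDim_of_isNoetherianRing, ringKrullDim_eq_zero_of_field] at this
    simpa using this
  refine le_trans ?_ h1
  have h2 : trRank k (Set.range ζ) ≤
      trRank k (Set.range fun i : Fin s => ((g (X i) :
        (aeval ζ : MvPolynomial σ k →ₐ[k] L).range) : L)) := by
    refine trRank_le_of_isAlgebraic ?_
    rintro _ ⟨i, rfl⟩
    obtain ⟨p, hpm, hp⟩ := hint ((aeval ζ : MvPolynomial σ k →ₐ[k] L).rangeRestrict (X i))
    set A := Algebra.adjoin k (Set.range fun i : Fin s => ((g (X i) :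
        (aeval ζ : MvPolynomial σ k →ₐ[k] L).range) : L)) with hA
    let ψ : MvPolynomial (Fin s) k →ₐ[k] A :=
      aeval fun j => ⟨_, Algebra.subset_adjoin (Set.mem_range_self j)⟩
    have hψ : (algebraMap A L).comp ψ.toRingHom =
        ((aeval ζ : MvPolynomial σ k →ₐ[k] L).range.val.comp g).toRingHom := by
      apply MvPolynomial.ringHom_ext
      · intro c
        simp [ψ]
      · intro j
        simp [ψ]
    have halg : IsIntegral A (ζ i) := by
      refine ⟨p.map ψ.toRingHom, hpm.map _, ?_⟩
      rw [Polynomial.eval₂_map, hψ]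
      have := congrArg (aeval ζ : MvPolynomial σ k →ₐ[k] L).range.val hp
      rw [map_zero] at this
      have h4 := Polynomial.hom_eval₂ p g.toRingHom
        (aeval ζ : MvPolynomial σ k →ₐ[k] L).range.val.toRingHom
        ((aeval ζ : MvPolynomial σ k →ₐ[k] L).rangeRestrict (X i))
      have h5 := h4.symm.trans this
      convert h5 using 1
      congr 1
      simp
    exact halg.isAlgebraic
  have h3 := h2.trans (trRank_range_le _)
  rw [Nat.card_fin] at h3
  exact_mod_cast h3

end TranscendenceRank

/-! ### The Zariski topology of a torus quotient. -/

theorem eval_aeval {σ τ : Type} (v : τ → ℂ) (p : σ → MvPolynomial τ ℂ) (q : MvPolynomial σ ℂ) :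
    eval v (aeval p q) = eval (fun i => eval v (p i)) q := by
  have : (aeval v : MvPolynomial τ ℂ →ₐ[ℂ] ℂ).comp (aeval p) = aeval fun i => eval v (p i) := by
    ext i
    simp
  exact DFunLike.congr_fun this q

/-- The product of p with all the variables is still a nonzero polynomial over an infinite field. -/
theorem exists_eval_ne_zero_torus {G : Type} [Fintype G] {p : MvPolynomial G ℂ} (hp : p ≠ 0) :
    ∃ t : G → ℂ, (∀ g, t g ≠ 0) ∧ eval t p ≠ 0 := by
  have h : p * ∏ g, X g ≠ 0 := mul_ne_zero hp (Finset.prod_ne_zero_iff.mpr fun g _ => X_ne_zero g)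
  by_contra hcon
  push Not at hcon
  apply h
  apply MvPolynomial.funext
  intro t
  rw [map_zero, map_mul, map_prod]
  by_cases ht : ∀ g, t g ≠ 0
  · rw [hcon t ht, zero_mul]
  · push Not at ht
    obtain ⟨g, hg⟩ := ht
    rw [Finset.prod_eq_zero (Finset.mem_univ g) (by simpa using hg), mul_zero]

/-- A space that is a quotient of a Zariski-open subset of an affine space by a torus scaling
groups of coordinates, with the quotient of the Zariski topology. -/
structure TorusQuotient {σ G : Type} (γ : σ → G) (W : Type) [TopologicalSpace W] where
  /-- coordinates of a point -/
  rep : W → σ → ℂ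
  rep_ne : ∀ x g, ∃ i, γ i = g ∧ rep x i ≠ 0
  exists_rep : ∀ v : σ → ℂ, (∀ g, ∃ i, γ i = g ∧ v i ≠ 0) →
    ∃ x, ∃ t : G → ℂ, (∀ g, t g ≠ 0) ∧ v = fun i => t (γ i) * rep x i
  isClosed_iff : ∀ Z : Set W, IsClosed Z ↔ ∃ S : Set (MvPolynomial σ ℂ), ∀ x, ∀ t : G → ℂ,
    (∀ g, t g ≠ 0) → (x ∈ Z ↔ ∀ f ∈ S, eval (fun i => t (γ i) * rep x i) f = 0)

namespace TorusQuotient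

variable {σ G W : Type} {γ : σ → G} [TopologicalSpace W] (Q : TorusQuotient γ W)

/-- The vectors of coordinates of the points of a set. -/
def cone (Z : Set W) : Set (σ → ℂ) :=
  {v | ∃ x ∈ Z, ∃ t : G → ℂ, (∀ g, t g ≠ 0) ∧ v = fun i => t (γ i) * Q.rep x i}

variable {Q}

theorem rep_mem_cone {Z : Set W} {x : W} (hx : x ∈ Z) : Q.rep x ∈ Q.cone Z :=
  ⟨x, hx, 1, fun _ => one_ne_zero, by simp⟩

theorem cone_mono {Y Z : Set W} (h : Y ⊆ Z) : Q.cone Y ⊆ Q.cone Z := by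
  rintro v ⟨x, hx, t, ht, rfl⟩
  exact ⟨x, h hx, t, ht, rfl⟩

theorem smul_mem_cone {Z : Set W} {v : σ → ℂ} (hv : v ∈ Q.cone Z) {t : G → ℂ}
    (ht : ∀ g, t g ≠ 0) : (fun i => t (γ i) * v i) ∈ Q.cone Z := by
  obtain ⟨x, hx, s, hs, rfl⟩ := hv
  exact ⟨x, hx, t * s, fun g => mul_ne_zero (ht g) (hs g), by ext i; simp [mul_assoc]⟩

theorem smul_comp_mem_vanishingIdeal {Z : Set W} {f : MvPolynomial σ ℂ}
    (hf : f ∈ vanishingIdeal ℂ (Q.cone Z)) {x : W}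
    (hx : ∀ f ∈ vanishingIdeal ℂ (Q.cone Z), eval (Q.rep x) f = 0) {t : G → ℂ}
    (ht : ∀ g, t g ≠ 0) : eval (fun i => t (γ i) * Q.rep x i) f = 0 := by
  have hcomp : ∀ v : σ → ℂ, eval v (aeval (fun i => C (t (γ i)) * X i : σ → MvPolynomial σ ℂ) f)
      = eval (fun i => t (γ i) * v i) f := by
    intro v
    rw [eval_aeval]
    simp
  rw [← hcomp]
  apply hx
  intro v hv
  have := hf _ (smul_mem_cone hv ht)
  exact (hcomp v).trans this

theorem isClosed_zeroLocus (Y : Set W) :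
    IsClosed {x | ∀ f ∈ vanishingIdeal ℂ (Q.cone Y), eval (Q.rep x) f = 0} := by
  rw [Q.isClosed_iff]
  refine ⟨vanishingIdeal ℂ (Q.cone Y), fun x t ht => ⟨fun hx f hf =>
    smul_comp_mem_vanishingIdeal hf hx ht, fun hx f hf => ?_⟩⟩
  have h1 := hx (aeval (fun i => C ((t (γ i))⁻¹) * X i : σ → MvPolynomial σ ℂ) f) (by
    intro v hv
    have := hf _ (smul_mem_cone hv (t := fun g => (t g)⁻¹) fun g => inv_ne_zero (ht g))
    refine Eq.trans ?_ this
    refine (eval_aeval v _ f).trans ?_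
    simp)
  rw [eval_aeval] at h1
  refine Eq.trans ?_ h1
  congr 2
  ext i
  simp [← mul_assoc, inv_mul_cancel₀ (ht _)]

/-- Equations that cut out the closure belong to the vanishing ideal of the cone; conversely the
zero locus of that ideal is closed, since the ideal is stable under the torus. -/
theorem mem_closure_iff {Y : Set W} {x : W} :
    x ∈ closure Y ↔ ∀ f ∈ vanishingIdeal ℂ (Q.cone Y), eval (Q.rep x) f = 0 := by
  constructor
  · intro hx
    have := closure_minimal (t := {x | ∀ f ∈ vanishingIdeal ℂ (Q.cone Y), eval (Q.rep x) f = 0})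
      (fun y hy f hf => hf _ (rep_mem_cone hy)) (Q.isClosed_zeroLocus Y)
    exact this hx
  · intro hx
    obtain ⟨S, hS⟩ := (Q.isClosed_iff (closure Y)).mp isClosed_closure
    rw [hS x 1 fun _ => one_ne_zero]
    intro f hf
    have hfI : f ∈ vanishingIdeal ℂ (Q.cone Y) := by
      rintro _ ⟨y, hy, t, ht, rfl⟩
      exact (hS y t ht).mp (subset_closure hy) f hf
    simpa using hx f hfI

theorem eval_eq_zero_of_mem_cone_closure {Y : Set W} {v : σ → ℂ} (hv : v ∈ Q.cone (closure Y))
    {f : MvPolynomial σ ℂ} (hf : f ∈ vanishingIdeal ℂ (Q.cone Y)) : eval v f = 0 := by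
  obtain ⟨x, hx, t, ht, rfl⟩ := hv
  exact smul_comp_mem_vanishingIdeal hf (mem_closure_iff.mp hx) ht

theorem vanishingIdeal_cone_closure (Y : Set W) :
    vanishingIdeal ℂ (Q.cone (closure Y)) = vanishingIdeal ℂ (Q.cone Y) := by
  ext f
  exact ⟨fun h v hv => h v (cone_mono subset_closure hv),
    fun h v hv => eval_eq_zero_of_mem_cone_closure hv h⟩

theorem mem_cone_iff_of_isClosed {Z : Set W} (hZ : IsClosed Z) {v : σ → ℂ}
    (hv : ∀ g, ∃ i, γ i = g ∧ v i ≠ 0) :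
    v ∈ Q.cone Z ↔ ∀ f ∈ vanishingIdeal ℂ (Q.cone Z), eval v f = 0 := by
  refine ⟨fun h f hf => hf v h, fun h => ?_⟩
  obtain ⟨x, t, ht, rfl⟩ := Q.exists_rep v hv
  refine ⟨x, ?_, t, ht, rfl⟩
  obtain ⟨S, hS⟩ := (Q.isClosed_iff Z).mp hZ
  rw [hS x t ht]
  intro f hf
  apply h
  rintro _ ⟨y, hy, s, hs, rfl⟩
  exact (hS y s hs).mp hy f hf

theorem mem_of_mem_cone_of_isClosed {Z : Set W} (hZ : IsClosed Z) {x : W} {t : G → ℂ}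
    (ht : ∀ g, t g ≠ 0) (h : (fun i => t (γ i) * Q.rep x i) ∈ Q.cone Z) : x ∈ Z := by
  obtain ⟨S, hS⟩ := (Q.isClosed_iff Z).mp hZ
  rw [hS x t ht]
  intro f hf
  obtain ⟨y, hy, s, hs, h⟩ := h
  rw [h]
  exact (hS y s hs).mp hy f hf

theorem exists_ne_of_mem_cone {Z : Set W} {v : σ → ℂ} (hv : v ∈ Q.cone Z) (g : G) :
    ∃ i, γ i = g ∧ v i ≠ 0 := by
  obtain ⟨x, -, t, ht, rfl⟩ := hv
  obtain ⟨i, hi, h⟩ := Q.rep_ne x g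
  exact ⟨i, hi, mul_ne_zero (ht _) h⟩

theorem isIrreducible_of_isPrime {Y : Set W} (h : (vanishingIdeal ℂ (Q.cone Y)).IsPrime) :
    IsIrreducible Y := by
  constructor
  · by_contra hne
    rw [Set.not_nonempty_iff_eq_empty] at hne
    subst hne
    apply h.ne_top
    rw [Ideal.eq_top_iff_one]
    rintro v ⟨x, hx, -⟩
    exact absurd hx (Set.notMem_empty x)
  · rw [isPreirreducible_iff_isClosed_union_isClosed]
    intro Z₁ Z₂ hZ₁ hZ₂ hY
    by_contra! hcon
    obtain ⟨S₁, hS₁⟩ := (Q.isClosed_iff Z₁).mp hZ₁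
    obtain ⟨S₂, hS₂⟩ := (Q.isClosed_iff Z₂).mp hZ₂
    obtain ⟨⟨x₁, hx₁, hx₁'⟩, x₂, hx₂, hx₂'⟩ := And.intro (Set.not_subset.mp hcon.1)
      (Set.not_subset.mp hcon.2)
    rw [hS₁ x₁ 1 fun _ => one_ne_zero] at hx₁'
    rw [hS₂ x₂ 1 fun _ => one_ne_zero] at hx₂'
    push Not at hx₁' hx₂'
    obtain ⟨f, hf, hf0⟩ := hx₁'
    obtain ⟨g, hg, hg0⟩ := hx₂'
    have hfg : f * g ∈ vanishingIdeal ℂ (Q.cone Y) := by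
      rintro _ ⟨x, hx, t, ht, rfl⟩
      rw [map_mul, mul_eq_zero]
      rcases hY hx with h | h
      · exact Or.inl ((hS₁ x t ht).mp h f hf)
      · exact Or.inr ((hS₂ x t ht).mp h g hg)
    rcases h.mem_or_mem hfg with h | h
    · exact hf0 (h _ ⟨x₁, hx₁, 1, fun _ => one_ne_zero, rfl⟩)
    · exact hg0 (h _ ⟨x₂, hx₂, 1, fun _ => one_ne_zero, rfl⟩)

/-- The open set where a polynomial does not vanish identically on the torus orbit. -/
theorem isClosed_setOf_forall_eval_eq_zero (f : MvPolynomial σ ℂ) :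
    IsClosed {x | ∀ t : G → ℂ, (∀ g, t g ≠ 0) → eval (fun i => t (γ i) * Q.rep x i) f = 0} := by
  have : {x | ∀ t : G → ℂ, (∀ g, t g ≠ 0) → eval (fun i => t (γ i) * Q.rep x i) f = 0} =
      closure {x | ∀ t : G → ℂ, (∀ g, t g ≠ 0) → eval (fun i => t (γ i) * Q.rep x i) f = 0} := by
    refine Set.Subset.antisymm subset_closure fun x hx t ht => ?_
    refine eval_eq_zero_of_mem_cone_closure (Q := Q) ⟨x, hx, t, ht, rfl⟩ ?_
    rintro _ ⟨y, hy, s, hs, rfl⟩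
    exact hy s hs
  rw [this]
  exact isClosed_closure

/-- As f and g need not be homogeneous, the closed sets used are those of points where f,
respectively g, vanishes on the whole orbit. They cover Y: if both failed at x, the restrictions to
the orbit of x would be nonzero polynomials in the torus coordinates, and their product would be
nonzero at some point of the torus. -/
theorem isPrime_of_isIrreducible [Fintype G] {Y : Set W} (h : IsIrreducible Y) :
    (vanishingIdeal ℂ (Q.cone Y)).IsPrime := by
  refine ⟨?_, ?_⟩
  · obtain ⟨y, hy⟩ := h.nonempty
    rw [Ne, Ideal.eq_top_iff_one]
    intro h1
    have := h1 _ (rep_mem_cone hy)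
    simp at this
  · intro f g hfg
    have hcov := isPreirreducible_iff_isClosed_union_isClosed.mp h.isPreirreducible _ _
      (Q.isClosed_setOf_forall_eval_eq_zero f) (Q.isClosed_setOf_forall_eval_eq_zero g) ?_
    · rcases hcov with h | h
      · left
        rintro _ ⟨y, hy, s, hs, rfl⟩
        exact h hy s hs
      · right
        rintro _ ⟨y, hy, s, hs, rfl⟩
        exact h hy s hs
    · intro x hx
      by_contra hcon
      simp only [Set.mem_union, Set.mem_ofPred_eq, not_or] at hcon
      push Not at hcon
      obtain ⟨⟨t, ht, hft⟩, s, hs, hgs⟩ := hcon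
      have hev : ∀ (q : MvPolynomial σ ℂ) (u : G → ℂ),
          eval u (aeval (fun i => X (γ i) * C (Q.rep x i) : σ → MvPolynomial G ℂ) q) =
          eval (fun i => u (γ i) * Q.rep x i) q := by
        intro q u
        rw [eval_aeval]
        simp
      have h0 : aeval (fun i => X (γ i) * C (Q.rep x i) : σ → MvPolynomial G ℂ) f *
          aeval (fun i => X (γ i) * C (Q.rep x i) : σ → MvPolynomial G ℂ) g ≠ 0 := by
        refine mul_ne_zero (fun h => hft ?_) (fun h => hgs ?_)
        · rw [← hev, h, map_zero]
        · rw [← hev, h, map_zero]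
      obtain ⟨u, hu, hu0⟩ := exists_eval_ne_zero_torus h0
      rw [map_mul, hev, hev, ← map_mul] at hu0
      exact hu0 (hfg _ ⟨x, hx, u, hu, rfl⟩)

end TorusQuotient

/-! ### Dimension of irreducible closed sets by their generic points. -/

/-- Homogenization with respect to the coordinates `i g`: clearing denominators in `f (v / v_i)`. -/
theorem exists_homogenization {σ G : Type} [Fintype G] (γ : σ → G) (i : G → σ)
    (f : MvPolynomial σ ℂ) : ∃ (N : ℕ) (F : MvPolynomial σ ℂ),
      (∀ (K : Type) [Field K] [Algebra ℂ K] (v : σ → K), (∀ g, v (i g) ≠ 0) →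
        aeval v F = (∏ g, v (i g)) ^ N * aeval (fun j => v j / v (i (γ j))) f) ∧
      (∀ (K : Type) [Field K] [Algebra ℂ K] (v : σ → K), (∃ g, v (i g) = 0) → aeval v F = 0) := by
  classical
  -- All large exponents are allowed, so that the two summands of a sum can share one.
  suffices h : ∃ N₀ : ℕ, ∀ N ≥ N₀, ∃ F : MvPolynomial σ ℂ,
      ∀ (K : Type) [Field K] [Algebra ℂ K] (v : σ → K), (∀ g, v (i g) ≠ 0) →
        aeval v F = (∏ g, v (i g)) ^ N * aeval (fun j => v j / v (i (γ j))) f by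
    obtain ⟨N₀, h⟩ := h
    obtain ⟨F, hF⟩ := h N₀ le_rfl
    -- The extra product makes the homogenization vanish wherever a chart coordinate does.
    refine ⟨N₀ + 1, F * ∏ g, X (i g), ?_, ?_⟩
    · intro K _ _ v hv
      rw [map_mul, map_prod, hF K v hv]
      simp only [aeval_X]
      ring
    · rintro K _ _ v ⟨g, hg⟩
      rw [map_mul, map_prod, Finset.prod_eq_zero (Finset.mem_univ g) (by simpa using hg), mul_zero]
  induction f using MvPolynomial.induction_on with
  | C a =>
    refine ⟨0, fun N _ => ⟨C a * (∏ g, X (i g)) ^ N, fun K _ _ v hv => ?_⟩⟩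
    simp [mul_comm]
  | add p q hp hq =>
    obtain ⟨N₁, h₁⟩ := hp
    obtain ⟨N₂, h₂⟩ := hq
    refine ⟨max N₁ N₂, fun N hN => ?_⟩
    obtain ⟨F₁, hF₁⟩ := h₁ N (le_trans (le_max_left _ _) hN)
    obtain ⟨F₂, hF₂⟩ := h₂ N (le_trans (le_max_right _ _) hN)
    refine ⟨F₁ + F₂, fun K _ _ v hv => ?_⟩
    rw [map_add, map_add, hF₁ K v hv, hF₂ K v hv, mul_add]
  | mul_X p j hp =>
    obtain ⟨N₁, h₁⟩ := hp
    refine ⟨N₁ + 1, fun N hN => ?_⟩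
    obtain ⟨M, rfl⟩ : ∃ M, N = M + 1 := ⟨N - 1, by omega⟩
    obtain ⟨F₁, hF₁⟩ := h₁ M (by omega)
    refine ⟨F₁ * (X j * ∏ g ∈ Finset.univ.erase (γ j), X (i g)), fun K _ _ v hv => ?_⟩
    rw [map_mul, map_mul, map_mul, map_prod, hF₁ K v hv]
    simp only [aeval_X]
    rw [pow_succ, ← Finset.mul_prod_erase Finset.univ (fun g => v (i g)) (Finset.mem_univ (γ j))]
    have := hv (γ j)
    field_simp

theorem krullDim_le_of_strictMono_nat {α : Type} [Preorder α] {f : α → ℕ} (hf : StrictMono f)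
    {d : ℕ} (hd : ∀ a, f a ≤ d) : Order.krullDim α ≤ d := by
  refine iSup_le fun p => ?_
  have h := LTSeries.head_add_length_le_nat (p.map f hf)
  have h2 : (p.map f hf).last ≤ d := hd _
  have h3 : (p.map f hf).length = p.length := rfl
  have h4 : p.length ≤ d := by omega
  exact_mod_cast h4

namespace TorusQuotient

variable {σ G W : Type} {γ : σ → G} [TopologicalSpace W] (Q : TorusQuotient γ W)

variable {Q} in
-- At a point x of Z choose one nonzero coordinate in each group. On the orbit of x these take
-- arbitrary nonzero values independently, so the corresponding coordinates of ζ satisfy no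
-- relation.
theorem card_le_trRank [Fintype G] {Z : Set W} (hZ : Z.Nonempty)
    {L : Type} [Field L] [Algebra ℂ L] {ζ : σ → L}
    (hζ : ∀ f : MvPolynomial σ ℂ, aeval ζ f = 0 → f ∈ vanishingIdeal ℂ (Q.cone Z)) :
    (Fintype.card G : ℕ∞) ≤ trRank ℂ (Set.range ζ) := by
  obtain ⟨x, hx⟩ := hZ
  choose i hi hne using Q.rep_ne x
  have hind : AlgebraicIndependent ℂ fun g => ζ (i g) := by
    rw [algebraicIndependent_iff]
    intro p hp
    by_contra hp0
    have h := hζ (rename i p) (by rw [aeval_rename]; exact hp)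
    obtain ⟨t, ht, hpt⟩ := exists_eval_ne_zero_torus hp0
    apply hpt
    have h2 := h _ ⟨x, hx, fun g => t g / Q.rep x (i g), fun g => div_ne_zero (ht g) (hne g), rfl⟩
    rw [aeval_rename] at h2
    convert h2 using 1
    change _ = eval _ p
    congr 2
    ext g
    simp only [Function.comp_apply, hi]
    rw [div_mul_cancel₀ _ (hne g)]
  have h := trRank_range_of_algebraicIndependent hind
  rw [Nat.card_eq_fintype_card] at h
  rw [← h]
  exact trRank_mono (by rintro _ ⟨g, rfl⟩; exact ⟨_, rfl⟩)

/-- The coordinates of the generic point of a set with prime vanishing ideal. -/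
def genericPoint (Z : Set W) [(vanishingIdeal ℂ (Q.cone Z)).IsPrime] :
    σ → FractionRing (MvPolynomial σ ℂ ⧸ vanishingIdeal ℂ (Q.cone Z)) :=
  fun i => algebraMap (MvPolynomial σ ℂ ⧸ vanishingIdeal ℂ (Q.cone Z)) _ (Ideal.Quotient.mk _ (X i))

theorem aeval_genericPoint (Z : Set W) [(vanishingIdeal ℂ (Q.cone Z)).IsPrime]
    (f : MvPolynomial σ ℂ) : aeval (Q.genericPoint Z) f =
      algebraMap (MvPolynomial σ ℂ ⧸ vanishingIdeal ℂ (Q.cone Z)) _ (Ideal.Quotient.mk _ f) := by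
  have : aeval (Q.genericPoint Z) = (IsScalarTower.toAlgHom ℂ
      (MvPolynomial σ ℂ ⧸ vanishingIdeal ℂ (Q.cone Z)) (FractionRing _)).comp
      (Ideal.Quotient.mkₐ ℂ (vanishingIdeal ℂ (Q.cone Z))) := by
    ext i
    simp [genericPoint]
  rw [this]
  rfl

theorem aeval_genericPoint_eq_zero_iff (Z : Set W) [(vanishingIdeal ℂ (Q.cone Z)).IsPrime]
    (f : MvPolynomial σ ℂ) :
    aeval (Q.genericPoint Z) f = 0 ↔ f ∈ vanishingIdeal ℂ (Q.cone Z) := by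
  rw [aeval_genericPoint, FaithfulSMul.algebraMap_eq_zero_iff, Ideal.Quotient.eq_zero_iff_mem]

/-- The transcendence degree of the generic point is strictly monotone on irreducible closed
subsets, by `trRank_lt_of_specializes`, and lies between the dimension of the torus and d plus that
dimension. -/
theorem topologicalKrullDim_le [Fintype G] [Finite σ] {Z : Set W} (hZ : IsClosed Z)
    {L : Type} [Field L] [Algebra ℂ L] {ζ : σ → L}
    (hζ : ∀ f : MvPolynomial σ ℂ, aeval ζ f = 0 → f ∈ vanishingIdeal ℂ (Q.cone Z))
    {d : ℕ} (hd : trRank ℂ (Set.range ζ) ≤ (d + Fintype.card G : ℕ)) :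
    topologicalKrullDim Z ≤ d := by
  have hirr : ∀ A : TopologicalSpace.IrreducibleCloseds Z,
      IsIrreducible (Subtype.val '' (A : Set Z)) := fun A =>
    A.isIrreducible.image _ continuous_subtype_val.continuousOn
  have hcl : ∀ A : TopologicalSpace.IrreducibleCloseds Z,
      IsClosed (Subtype.val '' (A : Set Z)) := fun A =>
    hZ.isClosedEmbedding_subtypeVal.isClosedMap _ A.isClosed
  have hprime : ∀ A : TopologicalSpace.IrreducibleCloseds Z,
      (vanishingIdeal ℂ (Q.cone (Subtype.val '' (A : Set Z)))).IsPrime := fun A =>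
    isPrime_of_isIrreducible (hirr A)
  let r : TopologicalSpace.IrreducibleCloseds Z → ℕ∞ := fun A =>
    trRank ℂ (Set.range (Q.genericPoint (Subtype.val '' (A : Set Z))))
  have hr_le : ∀ A, r A ≤ (d + Fintype.card G : ℕ) := fun A => by
    refine le_trans (trRank_le_of_specializes fun f hf => ?_) hd
    rw [aeval_genericPoint_eq_zero_iff]
    exact fun v hv => hζ f hf v (cone_mono (by rintro _ ⟨a, -, rfl⟩; exact a.2) hv)
  have hr_ge : ∀ A, (Fintype.card G : ℕ∞) ≤ r A := fun A =>
    card_le_trRank (hirr A).nonempty fun f hf => by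
      rwa [aeval_genericPoint_eq_zero_iff] at hf
  have hr_mono : ∀ A B : TopologicalSpace.IrreducibleCloseds Z, A < B → r A < r B := by
    intro A B hAB
    have hsub : Subtype.val '' (A : Set Z) ⊆ Subtype.val '' (B : Set Z) :=
      Set.image_mono hAB.le
    have hne : ¬ (vanishingIdeal ℂ (Q.cone (Subtype.val '' (A : Set Z))) ≤
        vanishingIdeal ℂ (Q.cone (Subtype.val '' (B : Set Z)))) := by
      intro hle
      apply hAB.not_ge
      intro z hz
      have h1 : (z : W) ∈ closure (Subtype.val '' (A : Set Z)) :=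
        (mem_closure_iff (Q := Q)).mpr fun f hf => hle hf _ (rep_mem_cone ⟨z, hz, rfl⟩)
      rw [(hcl A).closure_eq] at h1
      obtain ⟨w, hw, hwz⟩ := h1
      rwa [← Subtype.ext hwz]
    obtain ⟨f, hfA, hfB⟩ := SetLike.not_le_iff_exists.mp hne
    refine trRank_lt_of_specializes (f := f) (fun f hf => ?_) ?_ ?_
    · rw [aeval_genericPoint_eq_zero_iff] at hf ⊢
      exact fun v hv => hf v (cone_mono hsub hv)
    · rwa [aeval_genericPoint_eq_zero_iff]
    · rwa [Ne, aeval_genericPoint_eq_zero_iff]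
  have hcast : ∀ A, ((r A).toNat : ℕ∞) = r A := fun A =>
    ENat.natCast_toNat (ne_top_of_le_ne_top (ENat.natCast_ne_top _) (hr_le A))
  refine krullDim_le_of_strictMono_nat (f := fun A => (r A).toNat - Fintype.card G) ?_ ?_
  · intro A B hAB
    have h1 := hr_mono A B hAB
    have h2 := hr_ge A
    rw [← hcast A, ← hcast B] at h1
    rw [← hcast A] at h2
    have h1' : (r A).toNat < (r B).toNat := by exact_mod_cast h1
    have h2' : Fintype.card G ≤ (r A).toNat := by exact_mod_cast h2
    change (r A).toNat - Fintype.card G < (r B).toNat - Fintype.card G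
    omega
  · intro A
    have h1 := hr_le A
    rw [← hcast A] at h1
    have h1' : (r A).toNat ≤ d + Fintype.card G := by exact_mod_cast h1
    omega

section Slice

variable {Q} {Z : Set W} {L : Type} [Field L] [Algebra ℂ L] {ζ : σ → L} {i : G → σ}

/-- The point of the slice obtained from a point of the cone. -/
def slicePoint (γ : σ → G) {K : Type} [Field K] (v : σ → K) (i : G → σ) : σ → K :=
  fun j => v j / v (i (γ j))

/-- The generic point cannot be rescaled inside the cone over ℂ. Instead the homogenization of f
lies in the ideal, and its vanishing at ζ is transported to the rescaled point. -/
theorem aeval_slicePoint_eq_zero [Fintype G]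
    (hζ : ∀ f : MvPolynomial σ ℂ, aeval ζ f = 0 ↔ f ∈ vanishingIdeal ℂ (Q.cone Z))
    (hne : ∀ g, ζ (i g) ≠ 0) {f : MvPolynomial σ ℂ} (hf : f ∈ vanishingIdeal ℂ (Q.cone Z)) :
    aeval (slicePoint γ ζ i) f = 0 := by
  obtain ⟨N, F, hF, hF0⟩ := exists_homogenization γ i f
  have hFI : F ∈ vanishingIdeal ℂ (Q.cone Z) := by
    intro v hv
    by_cases h : ∀ g, v (i g) ≠ 0
    · rw [hF ℂ v h]
      have := hf _ (smul_mem_cone hv (t := fun g => (v (i g))⁻¹) fun g => inv_ne_zero (h g))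
      simp only [div_eq_inv_mul]
      exact mul_eq_zero_of_right _ this
    · push Not at h
      exact hF0 ℂ v h
  have h1 := (hζ F).mpr hFI
  rw [hF L ζ hne] at h1
  refine (mul_eq_zero.mp h1).resolve_left (pow_ne_zero _ ?_)
  exact Finset.prod_ne_zero_iff.mpr fun g _ => hne g

/-- Primes of the coordinate ring of the slice where all chart coordinates equal 1 give, through
their zero loci, irreducible closed subsets of Z. Inclusions reverse strictly, so the Krull
dimension of that ring, which is at least the transcendence degree, bounds the one of Z from below.
-/
theorem le_topologicalKrullDim [Fintype G] [Finite σ] (hZ : IsClosed Z)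
    (hζ : ∀ f : MvPolynomial σ ℂ, aeval ζ f = 0 ↔ f ∈ vanishingIdeal ℂ (Q.cone Z))
    (hγ : ∀ g, γ (i g) = g) (hne : ∀ g, ζ (i g) ≠ 0) :
    ((trRank ℂ (Set.range (slicePoint γ ζ i)) : ℕ∞) : WithBot ℕ∞) ≤ topologicalKrullDim Z := by
  refine (trRank_le_ringKrullDim (slicePoint γ ζ i)).trans ?_
  set φ := (aeval (slicePoint γ ζ i) : MvPolynomial σ ℂ →ₐ[ℂ] L).rangeRestrict with hφ
  have hφs : Function.Surjective φ := AlgHom.rangeRestrict_surjective _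
  let zl : PrimeSpectrum (aeval (slicePoint γ ζ i) : MvPolynomial σ ℂ →ₐ[ℂ] L).range →
    Set (σ → ℂ) := fun q => zeroLocus ℂ (q.asIdeal.comap φ)
  have hprime : ∀ q : PrimeSpectrum (aeval (slicePoint γ ζ i) : MvPolynomial σ ℂ →ₐ[ℂ] L).range,
    (q.asIdeal.comap φ).IsPrime := fun q => Ideal.IsPrime.comap φ (hK := q.2)
  -- This is the Nullstellensatz: a prime is recovered from its zero locus.
  have hmem : ∀ q f, f ∈ q.asIdeal.comap φ ↔ ∀ v ∈ zl q, eval v f = 0 := by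
    intro q f
    have := hprime q
    conv_lhs => rw [← IsPrime.vanishingIdeal_zeroLocus (K := ℂ) (q.asIdeal.comap φ)]
    rfl
  have hker : ∀ (q : PrimeSpectrum (aeval (slicePoint γ ζ i) : MvPolynomial σ ℂ →ₐ[ℂ] L).range) f,
      aeval (slicePoint γ ζ i) f = 0 → f ∈ q.asIdeal.comap φ := by
    intro q f hf
    have : φ f = 0 := Subtype.ext hf
    rw [Ideal.mem_comap, this]
    exact zero_mem _
  have hone : ∀ q, ∀ v ∈ zl q, ∀ g, v (i g) = 1 := by
    intro q v hv g
    have h1 : (X (i g) - 1 : MvPolynomial σ ℂ) ∈ q.asIdeal.comap φ := by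
      apply hker
      simp [slicePoint, hγ, div_self (hne g)]
    have := (hmem q _).mp h1 v hv
    simpa [sub_eq_zero] using this
  let Y : PrimeSpectrum (aeval (slicePoint γ ζ i) : MvPolynomial σ ℂ →ₐ[ℂ] L).range → Set W :=
    fun q => {x | ∃ t : G → ℂ, (∀ g, t g ≠ 0) ∧ (fun j => t (γ j) * Q.rep x j) ∈ zl q}
  have hexY : ∀ q, ∀ v ∈ zl q, ∃ x ∈ Y q, ∃ t : G → ℂ, (∀ g, t g ≠ 0) ∧
      v = fun j => t (γ j) * Q.rep x j := by
    intro q v hv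
    obtain ⟨x, t, ht, hvx⟩ := Q.exists_rep v fun g => ⟨i g, hγ g, by rw [hone q v hv]; simp⟩
    exact ⟨x, ⟨t, ht, hvx ▸ hv⟩, t, ht, hvx⟩
  have hYZ : ∀ q, closure (Y q) ⊆ Z := by
    intro q
    refine closure_minimal ?_ hZ
    rintro x ⟨t, ht, hx⟩
    refine mem_of_mem_cone_of_isClosed (Q := Q) hZ ht ?_
    rw [mem_cone_iff_of_isClosed hZ
      (fun g => ⟨i g, hγ g, by rw [hone q _ hx]; simp⟩)]
    intro f hf
    exact (hmem q f).mp (hker q f (aeval_slicePoint_eq_zero hζ hne hf)) _ hx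
  have hYirr : ∀ q, IsIrreducible (Y q) := by
    intro q
    have hzne : (zl q).Nonempty := by
      by_contra h
      rw [Set.not_nonempty_iff_eq_empty] at h
      apply (hprime q).ne_top
      rw [Ideal.eq_top_iff_one, hmem, h]
      simp
    constructor
    · obtain ⟨v, hv⟩ := hzne
      obtain ⟨x, hx, -⟩ := hexY q v hv
      exact ⟨x, hx⟩
    · rw [isPreirreducible_iff_isClosed_union_isClosed]
      intro Z₁ Z₂ hZ₁ hZ₂ hcov
      by_contra! hcon
      obtain ⟨S₁, hS₁⟩ := (Q.isClosed_iff Z₁).mp hZ₁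
      obtain ⟨S₂, hS₂⟩ := (Q.isClosed_iff Z₂).mp hZ₂
      obtain ⟨⟨x₁, ⟨t₁, ht₁, hm₁⟩, hx₁⟩, x₂, ⟨t₂, ht₂, hm₂⟩, hx₂⟩ :=
        And.intro (Set.not_subset.mp hcon.1) (Set.not_subset.mp hcon.2)
      rw [hS₁ x₁ t₁ ht₁] at hx₁
      rw [hS₂ x₂ t₂ ht₂] at hx₂
      push Not at hx₁ hx₂
      obtain ⟨f, hf, hf0⟩ := hx₁
      obtain ⟨g, hg, hg0⟩ := hx₂
      have hfg : f * g ∈ q.asIdeal.comap φ := by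
        rw [hmem]
        intro v hv
        obtain ⟨x, hx, t, ht, rfl⟩ := hexY q v hv
        rw [map_mul, mul_eq_zero]
        rcases hcov hx with h | h
        · exact Or.inl ((hS₁ x t ht).mp h f hf)
        · exact Or.inr ((hS₂ x t ht).mp h g hg)
      rcases (hprime q).mem_or_mem hfg with h | h
      · exact hf0 ((hmem q f).mp h _ hm₁)
      · exact hg0 ((hmem q g).mp h _ hm₂)
  let Φ : (PrimeSpectrum (aeval (slicePoint γ ζ i) : MvPolynomial σ ℂ →ₐ[ℂ] L).range)ᵒᵈ →
      TopologicalSpace.IrreducibleCloseds Z := fun q =>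
    { carrier := Subtype.val ⁻¹' closure (Y (OrderDual.ofDual q))
      isIrreducible' := by
        have h := (hYirr (OrderDual.ofDual q)).closure
        refine ⟨?_, ?_⟩
        · obtain ⟨x, hx⟩ := h.nonempty
          exact ⟨⟨x, hYZ _ hx⟩, hx⟩
        · rintro u v ⟨u', hu', rfl⟩ ⟨v', hv', rfl⟩ ⟨x, hx, hxu⟩ ⟨y, hy, hyv⟩
          obtain ⟨z, hz, hzu, hzv⟩ := h.isPreirreducible u' v' hu' hv' ⟨x, hx, hxu⟩ ⟨y, hy, hyv⟩
          exact ⟨⟨z, hYZ _ hz⟩, hz, hzu, hzv⟩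
      isClosed' := isClosed_closure.preimage continuous_subtype_val }
  have hmono : StrictMono Φ := by
    intro q' q hq
    have hle : (OrderDual.ofDual q).asIdeal ≤ (OrderDual.ofDual q').asIdeal := hq.le
    refine lt_of_le_not_ge ?_ ?_
    · change (Subtype.val ⁻¹' closure (Y (OrderDual.ofDual q')) : Set Z) ⊆
        Subtype.val ⁻¹' closure (Y (OrderDual.ofDual q))
      refine Set.preimage_mono (closure_mono ?_)
      rintro x ⟨t, ht, hx⟩
      exact ⟨t, ht, fun f hf => hx f (hle hf)⟩
    · intro hge
      have hcl : closure (Y (OrderDual.ofDual q)) ⊆ closure (Y (OrderDual.ofDual q')) :=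
        fun x hx => hge (show (⟨x, hYZ _ hx⟩ : Z) ∈ _ from hx)
      refine hq.not_ge ?_
      change (OrderDual.ofDual q').asIdeal ≤ (OrderDual.ofDual q).asIdeal
      intro b hb
      obtain ⟨f, rfl⟩ := hφs b
      change f ∈ (OrderDual.ofDual q).asIdeal.comap φ
      rw [hmem]
      intro v hv
      -- The homogenization of f vanishes on the cone over the image of the smaller slice locus,
      -- hence over its closure. On the slice it agrees with f, so f vanishes on the larger locus.
      obtain ⟨N, F, hF, hF0⟩ := exists_homogenization γ i f
      have hFI : F ∈ vanishingIdeal ℂ (Q.cone (Y (OrderDual.ofDual q'))) := by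
        rintro _ ⟨x, ⟨t, ht, hx⟩, s, hs, rfl⟩
        have hxi : ∀ g, Q.rep x (i g) = (t g)⁻¹ := by
          intro g
          have := hone _ _ hx g
          simp only [hγ] at this
          exact eq_inv_of_mul_eq_one_right this
        have hvi : ∀ g, s (γ (i g)) * Q.rep x (i g) ≠ 0 := fun g => by
          rw [hxi]
          exact mul_ne_zero (hs _) (inv_ne_zero (ht _))
        rw [hF ℂ _ hvi]
        refine mul_eq_zero_of_right _ ?_
        have h1 := (hmem _ f).mp hb _ hx
        refine Eq.trans ?_ h1
        change eval _ f = _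
        congr 2
        ext j
        rw [hγ, hxi]
        have h2 := hs (γ j)
        have h3 := ht (γ j)
        field_simp
      obtain ⟨x, hx, t, ht, hvx⟩ := hexY _ v hv
      have h0 : eval v F = 0 :=
        eval_eq_zero_of_mem_cone_closure (Q := Q) ⟨x, hcl (subset_closure hx), t, ht, hvx⟩ hFI
      have h1 := hF ℂ v fun g => by rw [hone _ v hv]; exact one_ne_zero
      simp only [hone _ v hv, Finset.prod_const_one, one_pow, one_mul, div_one] at h1
      exact h1.symm.trans h0
  have := Order.krullDim_le_of_strictMono Φ hmono
  rwa [Order.krullDim_orderDual] at this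

/-- Each ζ_j is its slice coordinate times a chart coordinate, and there is one chart coordinate per
torus factor. -/
theorem trRank_le_add_card [Fintype G]
    (hne : ∀ g, ζ (i g) ≠ 0) : trRank ℂ (Set.range ζ) ≤
      trRank ℂ (Set.range (slicePoint γ ζ i)) + Fintype.card G := by
  have h1 : trRank ℂ (Set.range ζ) ≤
      trRank ℂ (Set.range (slicePoint γ ζ i) ∪ Set.range (fun g => ζ (i g))) := by
    refine trRank_le_of_isAlgebraic ?_
    rintro _ ⟨j, rfl⟩
    have hmem : ζ j ∈ Algebra.adjoin ℂ
        (Set.range (slicePoint γ ζ i) ∪ Set.range (fun g => ζ (i g))) := by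
      have : ζ j = slicePoint γ ζ i j * ζ (i (γ j)) := by
        rw [slicePoint, div_mul_cancel₀ _ (hne _)]
      rw [this]
      exact mul_mem (Algebra.subset_adjoin (Or.inl ⟨j, rfl⟩))
        (Algebra.subset_adjoin (Or.inr ⟨γ j, rfl⟩))
    exact isAlgebraic_algebraMap (⟨_, hmem⟩ : Algebra.adjoin ℂ
        (Set.range (slicePoint γ ζ i) ∪ Set.range (fun g => ζ (i g))))
  refine h1.trans ((trRank_union_le _ _).trans ?_)
  gcongr
  rw [← Set.image_univ]
  refine (Set.encard_image_le _ _).trans ?_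
  simp [Set.encard_univ]

/-- The dimension of a closed irreducible set is the transcendence degree of its generic point
minus the dimension of the torus. -/
theorem exists_topologicalKrullDim_eq [Fintype G] [Finite σ] (hZ : IsClosed Z) (hZirr : IsIrreducible Z)
    (hζ : ∀ f : MvPolynomial σ ℂ, aeval ζ f = 0 ↔ f ∈ vanishingIdeal ℂ (Q.cone Z)) :
    ∃ d : ℕ, topologicalKrullDim Z = d ∧
      trRank ℂ (Set.range ζ) = (d + Fintype.card G : ℕ) ∧
      ∀ i : G → σ, (∀ g, γ (i g) = g) → (∀ g, ζ (i g) ≠ 0) →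
        trRank ℂ (Set.range (slicePoint γ ζ i)) ≤ d := by
  have hge := card_le_trRank hZirr.nonempty (fun f hf => (hζ f).mp hf)
  have hfin := trRank_range_le (k := ℂ) ζ
  obtain ⟨m, hm⟩ := ENat.ne_top_iff_exists.mp
    (ne_top_of_le_ne_top (ENat.natCast_ne_top _) hfin)
  rw [← hm] at hge
  have hge' : Fintype.card G ≤ m := by exact_mod_cast hge
  obtain ⟨d, rfl⟩ : ∃ d, m = d + Fintype.card G := ⟨m - Fintype.card G, by omega⟩
  have hup := Q.topologicalKrullDim_le hZ (fun f hf => (hζ f).mp hf) hm.symm.le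
  have hlow := fun i => le_topologicalKrullDim (i := i) hZ hζ
  refine ⟨d, le_antisymm hup ?_, hm.symm, fun i hγ hne => ?_⟩
  · obtain ⟨x, hx⟩ := hZirr.nonempty
    choose i hi hne using Q.rep_ne x
    have hne' : ∀ g, ζ (i g) ≠ 0 := by
      intro g h0
      rw [← aeval_X (R := ℂ) ζ (i g), hζ] at h0
      have := h0 _ (rep_mem_cone hx)
      rw [aeval_X] at this
      exact hne g this
    refine le_trans ?_ (hlow i hi hne')
    have h1 := trRank_le_add_card (γ := γ) hne'
    rw [← hm] at h1
    have h2 : ((d : ℕ) : ℕ∞) + (Fintype.card G : ℕ∞) ≤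
      trRank ℂ (Set.range (slicePoint γ ζ i)) + Fintype.card G := by exact_mod_cast h1
    have h3 := (ENat.add_le_add_iff_right (ENat.natCast_ne_top _)).mp h2
    exact_mod_cast h3
  · have := (hlow i hγ hne).trans hup
    exact_mod_cast this

end Slice

end TorusQuotient

/-! ### Homogeneous components as coefficients along torus orbits. -/

section OrbitPolynomial

variable {σ G M : Type} [AddCommMonoid M]

/-- The restriction of a polynomial to a torus orbit. -/
def orbitPoly (γ : σ → G) (v : σ → ℂ) (f : MvPolynomial σ ℂ) : MvPolynomial G ℂ :=
  aeval (fun i => X (γ i) * C (v i) : σ → MvPolynomial G ℂ) f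

theorem eval_orbitPoly (γ : σ → G) (v : σ → ℂ) (f : MvPolynomial σ ℂ) (t : G → ℂ) :
    eval t (orbitPoly γ v f) = eval (fun i => t (γ i) * v i) f := by
  rw [orbitPoly, eval_aeval]
  simp

theorem orbitPoly_monomial {γ : σ → G} {w : σ → M} (e : M ≃+ (G →₀ ℕ))
    (he : ∀ i, e (w i) = Finsupp.single (γ i) 1) (v : σ → ℂ) (m : σ →₀ ℕ) (c : ℂ) :
    orbitPoly γ v (monomial m c) =
      monomial (e (Finsupp.weight w m)) (c * m.prod fun i k => v i ^ k) := by
  rw [orbitPoly, aeval_monomial, Finsupp.weight_apply, map_finsuppSum,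
    monomial_finsupp_sum_index, C_mul, Finsupp.prod, Finsupp.prod, Finsupp.prod, map_prod,
    mul_assoc, ← Finset.prod_mul_distrib]
  congr 1
  refine Finset.prod_congr rfl fun i _ => ?_
  rw [map_nsmul, he, mul_pow, C_pow, mul_comm, X_pow_eq_monomial]
  simp

/-- Along the orbit a monomial becomes a monomial whose exponent is its weight, so collecting terms
by exponent collects the weighted homogeneous components. -/
theorem coeff_orbitPoly {γ : σ → G} {w : σ → M} (e : M ≃+ (G →₀ ℕ))
    (he : ∀ i, e (w i) = Finsupp.single (γ i) 1) (v : σ → ℂ) (f : MvPolynomial σ ℂ) (d : M) :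
    coeff (e d) (orbitPoly γ v f) = eval v (weightedHomogeneousComponent w d f) := by
  classical
  induction f using MvPolynomial.induction_on' with
  | monomial m c =>
    rw [orbitPoly_monomial e he, coeff_monomial]
    have hm := isWeightedHomogeneous_monomial w m c (m := Finsupp.weight w m) rfl
    by_cases h : Finsupp.weight w m = d
    · subst h
      rw [if_pos rfl, hm.weightedHomogeneousComponent_same, eval_monomial]
    · rw [if_neg fun h' => h (e.injective h'), hm.weightedHomogeneousComponent_ne _ (Ne.symm h),
        map_zero]
  | add p q hp hq =>
    rw [map_add, map_add, ← hp, ← hq, orbitPoly, map_add, coeff_add]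
    rfl

theorem orbitPoly_eq_zero_iff {γ : σ → G} {w : σ → M} (e : M ≃+ (G →₀ ℕ))
    (he : ∀ i, e (w i) = Finsupp.single (γ i) 1) (v : σ → ℂ) (f : MvPolynomial σ ℂ) :
    orbitPoly γ v f = 0 ↔ ∀ d, eval v (weightedHomogeneousComponent w d f) = 0 := by
  constructor
  · intro h d
    rw [← coeff_orbitPoly e he, h, coeff_zero]
  · intro h
    ext a
    obtain ⟨d, rfl⟩ := e.surjective a
    rw [coeff_orbitPoly e he, h, coeff_zero]

theorem forall_torus_eval_eq_zero_iff [Fintype G] {γ : σ → G} {w : σ → M} (e : M ≃+ (G →₀ ℕ))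
    (he : ∀ i, e (w i) = Finsupp.single (γ i) 1) (v : σ → ℂ) (f : MvPolynomial σ ℂ) :
    (∀ t : G → ℂ, (∀ g, t g ≠ 0) → eval (fun i => t (γ i) * v i) f = 0) ↔
      ∀ d, eval v (weightedHomogeneousComponent w d f) = 0 := by
  rw [← orbitPoly_eq_zero_iff e he]
  constructor
  · intro h
    by_contra hne
    obtain ⟨t, ht, hne⟩ := exists_eval_ne_zero_torus hne
    rw [eval_orbitPoly] at hne
    exact hne (h t ht)
  · intro h t _
    rw [← eval_orbitPoly, h, map_zero]

theorem eval_torus_eq_zero_iff_of_isWeightedHomogeneous [Fintype G] {γ : σ → G} {w : σ → M}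
    (e : M ≃+ (G →₀ ℕ)) (he : ∀ i, e (w i) = Finsupp.single (γ i) 1) (v : σ → ℂ)
    {f : MvPolynomial σ ℂ} {d : M} (hf : f.IsWeightedHomogeneous w d) {t : G → ℂ}
    (ht : ∀ g, t g ≠ 0) : eval (fun i => t (γ i) * v i) f = 0 ↔ eval v f = 0 := by
  have h1 : ∀ v : σ → ℂ, eval v f = 0 → ∀ t : G → ℂ, (∀ g, t g ≠ 0) →
      eval (fun i => t (γ i) * v i) f = 0 := by
    intro v hv
    rw [forall_torus_eval_eq_zero_iff e he]
    intro d'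
    by_cases hd : d = d'
    · subst hd
      rw [hf.weightedHomogeneousComponent_same, hv]
    · rw [hf.weightedHomogeneousComponent_ne _ (Ne.symm hd), map_zero]
  refine ⟨fun h => ?_, fun h => h1 v h t ht⟩
  have := h1 _ h (fun g => (t g)⁻¹) fun g => inv_ne_zero (ht g)
  convert this using 3
  ext i
  rw [← mul_assoc, inv_mul_cancel₀ (ht _), one_mul]

/-- A polynomial vanishes on a whole orbit exactly when all its components vanish at one point of
it. Hence any equations that cut out a torus-stable set may be replaced by their components. -/
theorem exists_homogeneous_zeroLocus_iff [Fintype G] {γ : σ → G} {w : σ → M}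
    (e : M ≃+ (G →₀ ℕ)) (he : ∀ i, e (w i) = Finsupp.single (γ i) 1) {W : Type}
    (rep : W → σ → ℂ) (Z : Set W) :
    (∃ S : Set (MvPolynomial σ ℂ), (∀ f ∈ S, ∃ d, f.IsWeightedHomogeneous w d) ∧
      Z = {x | ∀ f ∈ S, eval (rep x) f = 0}) ↔
    ∃ S : Set (MvPolynomial σ ℂ), ∀ x, ∀ t : G → ℂ,
      (∀ g, t g ≠ 0) → (x ∈ Z ↔ ∀ f ∈ S, eval (fun i => t (γ i) * rep x i) f = 0) := by
  constructor
  · rintro ⟨S, hS, rfl⟩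
    refine ⟨S, fun x t ht => forall₂_congr fun f hf => ?_⟩
    obtain ⟨d, hd⟩ := hS f hf
    exact (eval_torus_eq_zero_iff_of_isWeightedHomogeneous e he _ hd ht).symm
  · rintro ⟨S, hS⟩
    refine ⟨{f | ∃ g ∈ S, ∃ d, f = weightedHomogeneousComponent w d g}, ?_, ?_⟩
    · rintro _ ⟨g, -, d, rfl⟩
      exact ⟨d, weightedHomogeneousComponent_isWeightedHomogeneous _ _⟩
    · ext x
      constructor
      · rintro hx _ ⟨g, hg, d, rfl⟩
        revert d
        rw [← forall_torus_eval_eq_zero_iff e he]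
        intro t ht
        exact (hS x t ht).mp hx g hg
      · intro hx
        rw [hS x 1 fun _ => one_ne_zero]
        intro f hf
        refine (forall_torus_eval_eq_zero_iff e he (rep x) f).mpr ?_ 1 fun _ => one_ne_zero
        exact fun d => hx _ ⟨f, hf, d, rfl⟩

end OrbitPolynomial

/-! ### Projective space and the product of two as torus quotients. -/

theorem ProjSpace.rep_ne_zero {ι : Type} (p : ProjSpace ι) : p.rep ≠ 0 :=
  Projectivization.rep_nonzero p

theorem ProjSpace.mk_rep {ι : Type} (p : ProjSpace ι) : ProjSpace.mk p.rep p.rep_ne_zero = p :=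
  Projectivization.mk_rep p

theorem ProjSpace.exists_rep_mk {ι : Type} (v : ι → ℂ) (hv : v ≠ 0) :
    ∃ t : ℂ, t ≠ 0 ∧ v = t • (ProjSpace.mk v hv).rep := by
  obtain ⟨a, ha⟩ := Projectivization.exists_smul_eq_mk_rep ℂ v hv
  refine ⟨(a⁻¹ : ℂˣ), Units.ne_zero _, ?_⟩
  change v = _ • Projectivization.rep (Projectivization.mk ℂ v hv)
  rw [← ha]
  change v = (a⁻¹ : ℂˣ) • a • v
  rw [inv_smul_smul]

theorem ProjSpace.mk_eq_iff {ι : Type} {v : ι → ℂ} (hv : v ≠ 0) (p : ProjSpace ι) :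
    ProjSpace.mk v hv = p ↔ ∃ t : ℂ, t ≠ 0 ∧ v = t • p.rep := by
  constructor
  · rintro rfl
    exact ProjSpace.exists_rep_mk v hv
  · rintro ⟨t, ht, h⟩
    rw [← p.mk_rep]
    exact (Projectivization.mk_eq_mk_iff' ℂ _ _ hv p.rep_ne_zero).mpr ⟨t, h.symm⟩

theorem ProjSpace.isClosed_iff_exists {ι : Type} (Z : Set (ProjSpace ι)) : IsClosed Z ↔
    ∃ S : Set (MvPolynomial ι ℂ), (∀ f ∈ S, ∃ d : ℕ, f.IsHomogeneous d) ∧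
      Z = {p : ProjSpace ι | ∀ f ∈ S, eval p.rep f = 0} := by
  rw [← isOpen_compl_iff]
  change Zᶜᶜ ∈ _ ↔ _
  rw [compl_compl]
  rfl

theorem BiProj.isClosed_iff_exists {ι κ : Type} (Z : Set (BiProj ι κ)) : IsClosed Z ↔
    ∃ S : Set (MvPolynomial (ι ⊕ κ) ℂ),
      (∀ f ∈ S, ∃ d : ℕ × ℕ, f.IsWeightedHomogeneous (biWeight ι κ) d) ∧
      Z = {x : BiProj ι κ | ∀ f ∈ S, eval x.rep f = 0} := by
  rw [← isOpen_compl_iff]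
  change Zᶜᶜ ∈ _ ↔ _
  rw [compl_compl]
  rfl

/-- Degrees as exponents of the one-dimensional torus. -/
def unitDegreeEquiv : ℕ ≃+ (Unit →₀ ℕ) := (Finsupp.uniqueAddEquiv (M := ℕ) ()).symm

theorem unitDegreeEquiv_one (u : Unit) : unitDegreeEquiv 1 = Finsupp.single u 1 := by
  ext
  simp [unitDegreeEquiv]

/-- Bidegrees as exponents of the two-dimensional torus. -/
def boolDegreeEquiv : ℕ × ℕ ≃+ (Bool →₀ ℕ) where
  toFun d := Finsupp.single false d.1 + Finsupp.single true d.2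
  invFun a := (a false, a true)
  left_inv d := by simp
  right_inv a := by
    ext b
    cases b <;> simp
  map_add' a b := by
    simp only [Prod.fst_add, Prod.snd_add, Finsupp.single_add]
    abel

/-- The group of coordinates to which a coordinate of the product belongs. -/
def biGroup (ι κ : Type) : ι ⊕ κ → Bool := Sum.elim (fun _ => false) fun _ => true

theorem boolDegreeEquiv_biWeight {ι κ : Type} (i : ι ⊕ κ) :
    boolDegreeEquiv (biWeight ι κ i) = Finsupp.single (biGroup ι κ i) 1 := by
  cases i <;> simp [boolDegreeEquiv, biWeight, biGroup]

/-- Projective space as a torus quotient. -/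
def projQuotient (ι : Type) : TorusQuotient (fun _ : ι => ()) (ProjSpace ι) where
  rep := ProjSpace.rep
  rep_ne p _ := by
    obtain ⟨i, hi⟩ := Function.ne_iff.mp p.rep_ne_zero
    exact ⟨i, rfl, hi⟩
  exists_rep v hv := by
    obtain ⟨i, -, hi⟩ := hv ()
    have hv0 : v ≠ 0 := fun h => hi (by rw [h]; rfl)
    obtain ⟨t, ht, h⟩ := ProjSpace.exists_rep_mk v hv0
    exact ⟨ProjSpace.mk v hv0, fun _ => t, fun _ => ht, h⟩
  isClosed_iff Z := by
    rw [ProjSpace.isClosed_iff_exists]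
    exact exists_homogeneous_zeroLocus_iff (w := (1 : ι → ℕ)) unitDegreeEquiv
      (fun _ => unitDegreeEquiv_one ()) ProjSpace.rep Z

/-- The product of two projective spaces as a torus quotient. -/
def biQuotient (ι κ : Type) : TorusQuotient (biGroup ι κ) (BiProj ι κ) where
  rep := BiProj.rep
  rep_ne x g := by
    cases g with
    | false =>
      obtain ⟨i, hi⟩ := Function.ne_iff.mp x.fst.rep_ne_zero
      exact ⟨Sum.inl i, rfl, hi⟩
    | true =>
      obtain ⟨i, hi⟩ := Function.ne_iff.mp x.snd.rep_ne_zero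
      exact ⟨Sum.inr i, rfl, hi⟩
  exists_rep v hv := by
    have h₁ : (fun i => v (Sum.inl i)) ≠ 0 := by
      obtain ⟨i | i, hi, hne⟩ := hv false
      · exact fun h => hne (congrFun h i)
      · simp [biGroup] at hi
    have h₂ : (fun i => v (Sum.inr i)) ≠ 0 := by
      obtain ⟨i | i, hi, hne⟩ := hv true
      · simp [biGroup] at hi
      · exact fun h => hne (congrFun h i)
    obtain ⟨t, ht, h⟩ := ProjSpace.exists_rep_mk _ h₁
    obtain ⟨s, hs, h'⟩ := ProjSpace.exists_rep_mk _ h₂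
    refine ⟨⟨ProjSpace.mk _ h₁, ProjSpace.mk _ h₂⟩, fun b => bif b then s else t, ?_, ?_⟩
    · rintro (_ | _)
      · exact ht
      · exact hs
    · ext (i | i)
      · exact congrFun h i
      · exact congrFun h' i
  isClosed_iff Z := by
    rw [BiProj.isClosed_iff_exists]
    exact exists_homogeneous_zeroLocus_iff boolDegreeEquiv boolDegreeEquiv_biWeight
      BiProj.rep Z

/-! ### The cardinality of a general fibre. -/

/-- Points of the fibre of a simple extension `S[θ] / S`, where `θ` is a root of a monic separable
polynomial, over a homomorphism to an algebraically closed field: there are as many as the degree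
of the polynomial. -/
theorem fiber_of_simple_extension {ι S L k : Type} [CommRing S] [Field L] [Algebra S L]
    [Field k] [IsAlgClosed k] (ε : S →+* k) (x : ι → L) (θ : L)
    (p u v : Polynomial S) (c : ι → Polynomial S) (Θ : MvPolynomial ι S)
    (hp : p.Monic) (hpθ : Polynomial.aeval θ p = 0)
    (hmin : ∀ q : Polynomial S, Polynomial.aeval θ q = 0 → p ∣ q)
    (hc : ∀ i, Polynomial.aeval θ (c i) = x i) (hΘ : aeval x Θ = θ)
    (huv : u * p + v * Polynomial.derivative p = 1) :
    {y : ι → k | ∀ P : MvPolynomial ι S, aeval x P = 0 → eval₂ ε y P = 0}.Finite ∧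
    {y : ι → k | ∀ P : MvPolynomial ι S, aeval x P = 0 → eval₂ ε y P = 0}.ncard =
      p.natDegree := by
  classical
  -- The fibre is in bijection with the roots of the reduction of p: a root t gives the point with
  -- coordinates c_i(t), and a point y gives the root Θ(y). The Bézout identity survives reduction,
  -- so the roots are simple.
  set A := {y : ι → k | ∀ P : MvPolynomial ι S, aeval x P = 0 → eval₂ ε y P = 0} with hA
  have hsub : ∀ (P : MvPolynomial ι S) (t : k),
      (aeval c P : Polynomial S).eval₂ ε t = eval₂ ε (fun i => (c i).eval₂ ε t) P := by
    intro P t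
    have : (Polynomial.eval₂RingHom ε t).comp
        (aeval c : MvPolynomial ι S →ₐ[S] Polynomial S).toRingHom =
        eval₂Hom ε (fun i => (c i).eval₂ ε t) := by
      apply MvPolynomial.ringHom_ext
      · intro r; simp
      · intro i; simp
    exact DFunLike.congr_fun this P
  have hsubθ : ∀ P : MvPolynomial ι S, Polynomial.aeval θ (aeval c P : Polynomial S) =
      aeval x P := by
    intro P
    have : (Polynomial.aeval θ : Polynomial S →ₐ[S] L).comp (aeval c) = aeval x := by
      ext i
      simp [hc]
    exact DFunLike.congr_fun this P
  have hroot : ∀ t, p.eval₂ ε t = 0 → (fun i => (c i).eval₂ ε t) ∈ A := by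
    intro t ht P hP
    rw [← hsub]
    obtain ⟨q, hq⟩ := hmin (aeval c P) (by rw [hsubθ, hP])
    rw [hq, Polynomial.eval₂_mul, ht, zero_mul]
  have hΘt : ∀ t, p.eval₂ ε t = 0 → eval₂ ε (fun i => (c i).eval₂ ε t) Θ = t := by
    intro t ht
    obtain ⟨q, hq⟩ := hmin (aeval c Θ - Polynomial.X) (by
      rw [map_sub, hsubθ, hΘ, Polynomial.aeval_X, sub_self])
    rw [← hsub, ← sub_eq_zero]
    have := congrArg (Polynomial.eval₂ ε t) hq
    rw [Polynomial.eval₂_sub, Polynomial.eval₂_X, Polynomial.eval₂_mul, ht, zero_mul] at this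
    exact this
  have hpoly : ∀ (q : Polynomial S) (y : ι → k), eval₂ ε y (Polynomial.aeval Θ q) =
      q.eval₂ ε (eval₂ ε y Θ) := by
    intro q y
    have := Polynomial.hom_eval₂ q (algebraMap S (MvPolynomial ι S)) (eval₂Hom ε y) Θ
    refine Eq.trans this ?_
    have h2 : (eval₂Hom ε y).comp (algebraMap S (MvPolynomial ι S)) = ε := by ext; simp
    rw [h2]
    rfl
  have hpolyθ : ∀ q : Polynomial S, aeval x (Polynomial.aeval Θ q) = Polynomial.aeval θ q := by
    intro q
    rw [← Polynomial.aeval_algHom_apply, hΘ]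
  have hsurj : ∀ y ∈ A, p.eval₂ ε (eval₂ ε y Θ) = 0 ∧
      (fun i => (c i).eval₂ ε (eval₂ ε y Θ)) = y := by
    intro y hy
    refine ⟨?_, ?_⟩
    · rw [← hpoly]
      exact hy _ (by rw [hpolyθ, hpθ])
    · ext i
      have := hy (Polynomial.aeval Θ (c i) - X i) (by
        rw [map_sub, hpolyθ, hc, aeval_X, sub_self])
      rw [eval₂_sub, eval₂_X, hpoly, sub_eq_zero] at this
      exact this
  have hpm : (p.map ε).Monic := hp.map ε
  have hsep : (p.map ε).Separable := by
    refine ⟨u.map ε, v.map ε, ?_⟩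
    rw [Polynomial.derivative_map, ← Polynomial.map_mul, ← Polynomial.map_mul,
      ← Polynomial.map_add, huv, Polynomial.map_one]
  have hmem : ∀ t, t ∈ (p.map ε).roots.toFinset ↔ p.eval₂ ε t = 0 := by
    intro t
    rw [Multiset.mem_toFinset, Polynomial.mem_roots hpm.ne_zero, Polynomial.IsRoot,
      Polynomial.eval_map]
  have hAimg : A = (fun t i => (c i).eval₂ ε t) '' ((p.map ε).roots.toFinset : Set k) := by
    ext y
    constructor
    · intro hy
      exact ⟨_, (hmem _).mpr (hsurj y hy).1, (hsurj y hy).2⟩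
    · rintro ⟨t, ht, rfl⟩
      exact hroot t ((hmem t).mp ht)
  have hinj : Set.InjOn (fun (t : k) (i : ι) => (c i).eval₂ ε t)
      ((p.map ε).roots.toFinset : Set k) := by
    intro t ht s hs hts
    rw [← hΘt t ((hmem t).mp ht), ← hΘt s ((hmem s).mp hs)]
    exact congrArg (fun y => eval₂ ε y Θ) hts
  rw [hAimg]
  refine ⟨(Finset.finite_toSet _).image _, ?_⟩
  rw [hinj.ncard_image, Set.ncard_coe_finset, Multiset.toFinset_card_of_nodup
    (Polynomial.nodup_roots hsep), IsAlgClosed.card_roots_eq_natDegree, hp.natDegree_map]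

/-- The generic fibre of a generically finite dominant map to an affine space has constant
cardinality. -/
theorem exists_generic_fiber_card {ι κ L : Type} [Finite ι] [Field L] [Algebra ℂ L]
    (x : ι → L) (η : κ → L) (hη : AlgebraicIndependent ℂ η)
    (hx : ∀ i, IsAlgebraic (Algebra.adjoin ℂ (Set.range η)) (x i)) :
    ∃ d : ℕ, ∃ b : MvPolynomial κ ℂ, b ≠ 0 ∧ ∀ h : κ → ℂ, eval h b ≠ 0 →
      {y : ι → ℂ | ∀ F : MvPolynomial (ι ⊕ κ) ℂ, aeval (Sum.elim x η) F = 0 →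
        eval (Sum.elim y h) F = 0}.Finite ∧
      {y : ι → ℂ | ∀ F : MvPolynomial (ι ⊕ κ) ℂ, aeval (Sum.elim x η) F = 0 →
        eval (Sum.elim y h) F = 0}.ncard = d := by
  classical
  cases nonempty_fintype ι
  let R := MvPolynomial κ ℂ
  let _ : Algebra R L := (aeval η : MvPolynomial κ ℂ →ₐ[ℂ] L).toRingHom.toAlgebra
  have hmap : ∀ r : R, algebraMap R L r = aeval η r := fun _ => rfl
  have : FaithfulSMul R L := (faithfulSMul_iff_algebraMap_injective R L).mpr hη
  let K := FractionRing R
  let _ : Algebra K L := FractionRing.liftAlgebra R L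
  have : IsScalarTower R K L := FractionRing.isScalarTower_liftAlgebra R L
  have : CharZero K := by
    have : CharZero R := inferInstance
    exact charZero_of_injective_algebraMap (IsFractionRing.injective R K)
  have hxK : ∀ i, IsAlgebraic K (x i) := by
    intro i
    by_cases h0 : x i = 0
    · rw [h0]; exact isAlgebraic_zero
    · obtain ⟨P, hP0, hP⟩ := exists_relation_of_isAlgebraic (hx i) h0
      refine ⟨P.map (algebraMap R K), ?_, ?_⟩
      · rw [Ne, Polynomial.map_eq_zero_iff (IsFractionRing.injective R K)]
        exact fun h => hP0 (by rw [h]; simp)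
      · rw [Polynomial.aeval_map_algebraMap]
        exact hP
  let M := IntermediateField.adjoin K (Set.range x)
  have : FiniteDimensional K M := IntermediateField.finiteDimensional_adjoin (by
    rintro _ ⟨i, rfl⟩
    exact (hxK i).isIntegral)
  -- The x_i and the primitive element are polynomials in each other over K, and its minimal
  -- polynomial is separable in characteristic zero. All this involves finitely many coefficients,
  -- so it holds over R localized at one b, and reduces at each h with b(h) ≠ 0.
  obtain ⟨α, hα⟩ := Field.exists_primitive_element K M
  let θ : L := (α : L)
  have hθint : IsIntegral K θ :=
    (Algebra.IsIntegral.isIntegral (R := K) α).map (IsScalarTower.toAlgHom K M L)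
  have hcK : ∀ i, ∃ q : Polynomial K, Polynomial.aeval θ q = x i := by
    intro i
    have hmem : (⟨x i, IntermediateField.subset_adjoin K _ ⟨i, rfl⟩⟩ : M) ∈
        IntermediateField.adjoin K {α} := by rw [hα]; trivial
    rw [← IntermediateField.mem_toSubalgebra,
      IntermediateField.adjoin_simple_toSubalgebra_of_isAlgebraic
        (Algebra.IsAlgebraic.isAlgebraic α), Algebra.adjoin_singleton_eq_range_aeval] at hmem
    obtain ⟨q, hq⟩ := hmem
    refine ⟨q, ?_⟩
    have h1 := congrArg (algebraMap M L) hq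
    have h2 : algebraMap M L (Polynomial.aeval α q) = Polynomial.aeval θ q :=
      (Polynomial.aeval_algebraMap_apply L α q).symm
    exact h2.symm.trans h1
  choose cK hcK using hcK
  obtain ⟨ΘK, hΘK⟩ : ∃ Θ : MvPolynomial ι K, aeval x Θ = θ := by
    have hmem : θ ∈ M := α.2
    rw [← IntermediateField.mem_toSubalgebra, IntermediateField.adjoin_toSubalgebra_of_isAlgebraic
      (by rintro _ ⟨i, rfl⟩; exact hxK i), Algebra.adjoin_range_eq_range_aeval] at hmem
    exact hmem
  let pK := minpoly K θ
  have hpKm : pK.Monic := minpoly.monic hθint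
  obtain ⟨uK, vK, huvK⟩ : pK.Separable := (minpoly.irreducible hθint).separable
  -- a common denominator
  let T : Finset K := pK.coeffs ∪ uK.coeffs ∪ vK.coeffs ∪ ΘK.coeffs ∪
    Finset.univ.biUnion fun i => (cK i).coeffs
  obtain ⟨⟨b, hb⟩, hbT⟩ := IsLocalization.exist_integer_multiples_of_finset (nonZeroDivisors R) T
  have hb0 : b ≠ 0 := nonZeroDivisors.ne_zero hb
  let S := Localization.Away b
  have hbK : IsUnit (algebraMap R K b) :=
    (map_ne_zero_iff _ (IsFractionRing.injective R K)).mpr hb0 |>.isUnit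
  let _ : Algebra S K := (IsLocalization.Away.lift b hbK : S →+* K).toAlgebra
  have : IsScalarTower R S K := IsScalarTower.of_algebraMap_eq fun r =>
    (IsLocalization.Away.lift_eq b hbK r).symm
  let _ : Algebra S L := ((algebraMap K L).comp (algebraMap S K)).toAlgebra
  have : IsScalarTower S K L := IsScalarTower.of_algebraMap_eq fun r => rfl
  have : IsScalarTower R S L := IsScalarTower.of_algebraMap_eq fun r => by
    rw [IsScalarTower.algebraMap_apply S K L, ← IsScalarTower.algebraMap_apply R S K,
      ← IsScalarTower.algebraMap_apply R K L]
  have hSK : Function.Injective (algebraMap S K) := by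
    refine (IsLocalization.lift_injective_iff _).mpr fun r s => ?_
    rw [(IsLocalization.injective S (powers_le_nonZeroDivisors_of_noZeroDivisors hb0)).eq_iff,
      (IsFractionRing.injective R K).eq_iff]
  have hTS : ∀ z ∈ T, z ∈ Set.range (algebraMap S K) := by
    intro z hz
    obtain ⟨r, hr⟩ := hbT z hz
    refine ⟨IsLocalization.mk' S r ⟨b, Submonoid.mem_powers b⟩, ?_⟩
    have h1 : algebraMap S K (algebraMap R S b * IsLocalization.mk' S r
        (⟨b, Submonoid.mem_powers b⟩ : Submonoid.powers b)) = algebraMap R K r := by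
      rw [mul_comm, IsLocalization.mk'_spec S r (⟨b, Submonoid.mem_powers b⟩ : Submonoid.powers b),
        ← IsScalarTower.algebraMap_apply]
    rw [hr, map_mul, ← IsScalarTower.algebraMap_apply, Algebra.smul_def] at h1
    exact mul_left_cancel₀ hbK.ne_zero h1
  have hlift : ∀ q : Polynomial K, (q.coeffs ⊆ T) → ∃ q' : Polynomial S,
      q'.map (algebraMap S K) = q := by
    intro q hq
    rw [← Polynomial.mem_lifts, Polynomial.lifts_iff_coeff_lifts]
    intro n
    by_cases h0 : q.coeff n = 0
    · rw [h0]; exact ⟨0, map_zero _⟩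
    · exact hTS _ (hq (Polynomial.coeff_mem_coeffs h0))
  have hsubT : ∀ z, (z ∈ pK.coeffs ∨ z ∈ uK.coeffs ∨ z ∈ vK.coeffs ∨ z ∈ ΘK.coeffs ∨
      ∃ i, z ∈ (cK i).coeffs) → z ∈ T := by
    intro z hz
    simp only [T, Finset.mem_union, Finset.mem_biUnion, Finset.mem_univ, true_and]
    tauto
  obtain ⟨p, hpmap, hpdeg, hpm⟩ := Polynomial.lifts_and_natDegree_eq_and_monic
    ((Polynomial.mem_lifts _).mpr (hlift pK fun z hz => hsubT z (Or.inl hz))) hpKm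
  obtain ⟨u, hu⟩ := hlift uK fun z hz => hsubT z (Or.inr (Or.inl hz))
  obtain ⟨v, hv⟩ := hlift vK fun z hz => hsubT z (Or.inr (Or.inr (Or.inl hz)))
  have hc' : ∀ i, ∃ q' : Polynomial S, q'.map (algebraMap S K) = cK i := fun i =>
    hlift (cK i) fun z hz => hsubT z (Or.inr (Or.inr (Or.inr (Or.inr ⟨i, hz⟩))))
  choose c hc using hc'
  obtain ⟨Θ, hΘ⟩ : ∃ Θ : MvPolynomial ι S, map (algebraMap S K) Θ = ΘK := by
    have : ΘK ∈ Set.range (map (algebraMap S K)) := by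
      rw [mem_range_map_iff_coeffs_subset]
      exact fun z hz => hTS z (hsubT z (Or.inr (Or.inr (Or.inr (Or.inl hz)))))
    exact this
  refine ⟨p.natDegree, b, hb0, fun h hbh => ?_⟩
  have hbh' : IsUnit ((eval h : R →+* ℂ) b) := hbh.isUnit
  let ε : S →+* ℂ := IsLocalization.Away.lift b hbh'
  have hε : ∀ r, ε (algebraMap R S r) = eval h r := IsLocalization.Away.lift_eq b hbh'
  have haeval : ∀ q : Polynomial S, Polynomial.aeval θ q =
      Polynomial.aeval θ (q.map (algebraMap S K)) := fun q =>
    (Polynomial.aeval_map_algebraMap K θ q).symm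
  have key := fiber_of_simple_extension ε x θ p u v c Θ hpm
    (by rw [haeval, hpmap]; exact minpoly.aeval K θ)
    (by
      intro q hq
      rw [haeval] at hq
      rw [← Polynomial.map_dvd_map _ hSK hpm, hpmap]
      exact minpoly.dvd K θ hq)
    (fun i => by rw [haeval, hc, hcK])
    (by
      rw [← hΘK, ← hΘ, aeval_map_algebraMap])
    (by
      apply Polynomial.map_injective _ hSK
      rw [Polynomial.map_add, Polynomial.map_mul, Polynomial.map_mul, Polynomial.map_one,
        ← Polynomial.derivative_map, hpmap, hu, hv, huvK])
  -- Coefficients in the localization give no new conditions: a power of b clears the denominators,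
  -- and b does not vanish at h.
  have hset : {y : ι → ℂ | ∀ F : MvPolynomial (ι ⊕ κ) ℂ, aeval (Sum.elim x η) F = 0 →
        eval (Sum.elim y h) F = 0} =
      {y : ι → ℂ | ∀ P : MvPolynomial ι S, aeval x P = 0 → eval₂ ε y P = 0} := by
    let Ψ := (sumAlgEquiv ℂ ι κ)
    have hΨx : ∀ F, aeval x (map (algebraMap R S) (Ψ F)) = aeval (Sum.elim x η) F := by
      intro F
      rw [aeval_map_algebraMap]
      have : (aeval x : MvPolynomial ι R →ₐ[R] L).toRingHom.comp (Ψ : _ →+* MvPolynomial ι R) =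
          (aeval (Sum.elim x η) : MvPolynomial (ι ⊕ κ) ℂ →ₐ[ℂ] L).toRingHom := by
        apply MvPolynomial.ringHom_ext
        · intro r
          simp [Ψ, hmap]
        · rintro (i | k)
          · simp [Ψ]
          · simp [Ψ, hmap]
      exact DFunLike.congr_fun this F
    have hΨy : ∀ (y : ι → ℂ) F, eval₂ ε y (map (algebraMap R S) (Ψ F)) =
        eval (Sum.elim y h) F := by
      intro y F
      rw [eval₂_map]
      have : (eval₂Hom (ε.comp (algebraMap R S)) y).comp (Ψ : _ →+* MvPolynomial ι R) =
          eval (Sum.elim y h) := by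
        apply MvPolynomial.ringHom_ext
        · intro r
          simp [Ψ, hε]
        · rintro (i | k)
          · simp [Ψ]
          · simp [Ψ, hε]
      exact DFunLike.congr_fun this F
    ext y
    constructor
    · intro hy P hP
      obtain ⟨N, P₀, hP₀⟩ : ∃ (N : ℕ) (P₀ : MvPolynomial ι R),
          map (algebraMap R S) P₀ = C (algebraMap R S (b ^ N)) * P := by
        let _ : Algebra (MvPolynomial ι R) (MvPolynomial ι S) := algebraMvPolynomial
        obtain ⟨⟨P₀, _, _, ⟨N, rfl⟩, rfl⟩, hs⟩ := IsLocalization.surj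
          (Submonoid.map (C : R →+* MvPolynomial ι R) (Submonoid.powers b)) P
        refine ⟨N, P₀, ?_⟩
        have hs' : P * map (algebraMap R S) (C (b ^ N)) = map (algebraMap R S) P₀ := hs
        rw [← hs', map_C, mul_comm]
      obtain ⟨F, rfl⟩ := Ψ.surjective P₀
      have h0 := hy F (by rw [← hΨx, hP₀, map_mul, hP, mul_zero])
      rw [← hΨy, hP₀, eval₂_mul, eval₂_C, hε, map_pow] at h0
      exact (mul_eq_zero.mp h0).resolve_left (pow_ne_zero _ hbh)
    · intro hy F hF
      rw [← hΨy]
      exact hy _ (by rw [hΨx, hF])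
  rw [hset]
  exact key

/-! ### The Jacobian criterion at the generic point. -/

section Jacobian

variable {k L σ : Type} [Field k] [Field L] [Algebra k L] [Fintype σ]

/-- The kernel of the Jacobian matrix of an ideal at a point. -/
def jacobianKernel (I : Ideal (MvPolynomial σ k)) (z : σ → L) : Submodule L (σ → L) where
  carrier := {w | ∀ f ∈ I, ∑ i, aeval z (pderiv i f) * w i = 0}
  add_mem' := by
    intro a b ha hb f hf
    simp only [Pi.add_apply, mul_add, Finset.sum_add_distrib, ha f hf, hb f hf, add_zero]
  zero_mem' := by
    intro f _
    simp
  smul_mem' := by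
    intro c a ha f hf
    have h : ∑ i, aeval z (pderiv i f) * (c • a) i = c * ∑ i, aeval z (pderiv i f) * a i := by
      rw [Finset.mul_sum]
      exact Finset.sum_congr rfl fun i _ => by simp only [Pi.smul_apply, smul_eq_mul]; ring
    rw [h, ha f hf, mul_zero]

theorem derivation_aeval (D : Derivation k L L) (z : σ → L) (f : MvPolynomial σ k) :
    D (aeval z f) = ∑ i, aeval z (pderiv i f) * D (z i) := by
  classical
  induction f using MvPolynomial.induction_on with
  | C a => simp
  | add p q hp hq => simp only [map_add, hp, hq, add_mul, Finset.sum_add_distrib]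
  | mul_X p j hp =>
    rw [map_mul, aeval_X, Derivation.leibniz, hp]
    simp only [Derivation.leibniz, pderiv_X, smul_eq_mul, map_add, map_mul, aeval_X, add_mul,
      Finset.sum_add_distrib, Finset.mul_sum]
    congr 1
    · rw [Finset.sum_eq_single j]
      · simp
      · intro b _ hb
        simp [hb.symm]
      · simp
    · exact Finset.sum_congr rfl fun i _ => by ring

/-- Over a field generated by the coordinates of `z`, prescribed values on a separating
transcendence basis extend to a derivation. -/
theorem exists_derivation_of_isTranscendenceBasis [CharZero k] {τ : Type} {z : τ → L}
    (hz : IsTranscendenceBasis k z) (w : τ → L) : ∃ D : Derivation k L L, ∀ t, D (z t) = w t := by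
  let R := MvPolynomial τ k
  let _ : Algebra R L := (aeval z : MvPolynomial τ k →ₐ[k] L).toRingHom.toAlgebra
  have hmap : ∀ r : R, algebraMap R L r = aeval z r := fun _ => rfl
  have : FaithfulSMul R L := (faithfulSMul_iff_algebraMap_injective R L).mpr hz.1
  have : IsScalarTower k R L := IsScalarTower.of_algebraMap_eq fun r => by
    rw [hmap, MvPolynomial.algebraMap_eq, aeval_C]
  let K := FractionRing R
  let _ : Algebra K L := FractionRing.liftAlgebra R L
  have : IsScalarTower R K L := FractionRing.isScalarTower_liftAlgebra R L
  have : CharZero K := charZero_of_injective_algebraMap (IsFractionRing.injective R K)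
  have halg : Algebra.IsAlgebraic K L := by
    refine ⟨fun a => ?_⟩
    by_cases h0 : a = 0
    · rw [h0]; exact isAlgebraic_zero
    · obtain ⟨P, hP0, hP⟩ := exists_relation_of_isAlgebraic (hz.isAlgebraic.isAlgebraic a) h0
      refine ⟨P.map (algebraMap R K), ?_, ?_⟩
      · rw [Ne, Polynomial.map_eq_zero_iff (IsFractionRing.injective R K)]
        exact fun h => hP0 (by rw [h]; simp)
      · rw [Polynomial.aeval_map_algebraMap]
        exact hP
  -- The polynomial ring R is formally étale below its fraction field, and that field below L, which
  -- is separable algebraic over it. Hence the differentials of L have the basis dz_t.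
  have : Algebra.FormallyEtale R K := Algebra.FormallyEtale.of_isLocalization (nonZeroDivisors R)
  have : Algebra.FormallyEtale K L := Algebra.FormallyEtale.of_isSeparable K L
  have : Algebra.FormallyEtale R L := Algebra.FormallyEtale.comp R K L
  let b := ((KaehlerDifferential.mvPolynomialBasis k τ).baseChange L).map
    (KaehlerDifferential.tensorKaehlerEquivOfFormallyEtale k R L)
  have hb : ∀ t, b t = KaehlerDifferential.D k L (z t) := by
    intro t
    rw [Module.Basis.map_apply, Module.Basis.baseChange_apply,
      KaehlerDifferential.mvPolynomialBasis_apply,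
      KaehlerDifferential.tensorKaehlerEquivOfFormallyEtale_apply]
    refine (KaehlerDifferential.mapBaseChange_tmul k R L 1
      (KaehlerDifferential.D k R (X t : MvPolynomial τ k))).trans ?_
    rw [one_smul]
    refine (KaehlerDifferential.map_D k k R L (X t : MvPolynomial τ k)).trans ?_
    exact congrArg _ ((hmap _).trans (aeval_X z t))
  refine ⟨(b.constr L w).compDer (KaehlerDifferential.D k L), fun t => ?_⟩
  change b.constr L w (KaehlerDifferential.D k L (z t)) = w t
  rw [← hb, Module.Basis.constr_basis]

/-- Take a relation F of z_i over the z_t of least degree in the variable i. Its i-th partial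
derivative is nonzero at z by minimality, and its partials outside T and i vanish. So the Jacobian
equation of F reduces to a nonzero multiple of w_i. -/
theorem eq_zero_of_mem_jacobianKernel [CharZero k] {z : σ → L} {I : Ideal (MvPolynomial σ k)}
    (hI : ∀ f, aeval z f = 0 → f ∈ I) {T : Set σ} (hT : AlgebraicIndependent k fun t : T => z t)
    {i : σ} (hi : IsAlgebraic (Algebra.adjoin k (Set.range fun t : T => z t)) (z i))
    {w : σ → L} (hw : w ∈ jacobianKernel I z) (hwT : ∀ t ∈ T, w t = 0) : w i = 0 := by
  classical
  by_cases hiT : i ∈ T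
  · exact hwT i hiT
  let R := MvPolynomial T k
  let φ : R →+* L := (aeval fun t : T => z t : MvPolynomial T k →ₐ[k] L).toRingHom
  have hφ : Function.Injective φ := hT
  obtain ⟨P, hP0, hP, hmin⟩ : ∃ P : Polynomial R, P ≠ 0 ∧ P.eval₂ φ (z i) = 0 ∧
      ∀ Q : Polynomial R, Q ≠ 0 → Q.eval₂ φ (z i) = 0 → P.natDegree ≤ Q.natDegree := by
    have hne : {P : Polynomial R | P ≠ 0 ∧ P.eval₂ φ (z i) = 0}.Nonempty := by
      by_cases h0 : z i = 0
      · exact ⟨Polynomial.X, Polynomial.X_ne_zero, by simp [h0]⟩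
      · obtain ⟨P, hP0, hP⟩ := exists_relation_of_isAlgebraic hi h0
        exact ⟨P, fun h => hP0 (by rw [h]; simp), hP⟩
    obtain ⟨P, ⟨hP0, hP⟩, hmin⟩ := exists_minimalFor_of_wellFoundedLT _ Polynomial.natDegree hne
    refine ⟨P, hP0, hP, fun Q hQ0 hQ => ?_⟩
    rcases le_total P.natDegree Q.natDegree with h | h
    · exact h
    · exact hmin ⟨hQ0, hQ⟩ h
  have hdeg : 0 < P.natDegree := by
    rw [Nat.pos_iff_ne_zero]
    intro h0
    rw [Polynomial.eq_C_of_natDegree_eq_zero h0, Polynomial.eval₂_C] at hP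
    apply hP0
    rw [Polynomial.eq_C_of_natDegree_eq_zero h0, (map_eq_zero_iff φ hφ).mp hP, Polynomial.C_0]
  have hder : (Polynomial.derivative P).eval₂ φ (z i) ≠ 0 := by
    intro h
    have h1 : Polynomial.derivative P ≠ 0 := by
      intro h2
      have := Polynomial.derivative_eq_zero.mp h2
      omega
    have h2 := hmin _ h1 h
    have h3 := Polynomial.natDegree_derivative_lt hdeg.ne'
    omega
  let ρ : R →ₐ[k] MvPolynomial σ k := rename ((↑) : T → σ)
  let F : MvPolynomial σ k := P.eval₂ ρ.toRingHom (X i)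
  have hρ : (aeval z : MvPolynomial σ k →ₐ[k] L).toRingHom.comp ρ.toRingHom = φ := by
    refine RingHom.ext fun r => ?_
    change aeval z (rename ((↑) : T → σ) (show MvPolynomial T k from r)) =
      aeval (fun t : T => z t) (show MvPolynomial T k from r)
    rw [aeval_rename]
    rfl
  have hFz : ∀ Q : Polynomial R, aeval z (Q.eval₂ ρ.toRingHom (X i)) = Q.eval₂ φ (z i) := by
    intro Q
    have := Polynomial.hom_eval₂ Q ρ.toRingHom
      (aeval z : MvPolynomial σ k →ₐ[k] L).toRingHom (X i)
    rw [hρ] at this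
    refine this.trans ?_
    congr 1
    simp
  have hFI : F ∈ I := hI F (by rw [hFz, hP])
  have hpd : pderiv i F = (Polynomial.derivative P).eval₂ ρ.toRingHom (X i) := by
    have : ∀ Q : Polynomial R, pderiv i (Q.eval₂ ρ.toRingHom (X i)) =
        (Polynomial.derivative Q).eval₂ ρ.toRingHom (X i) := by
      intro Q
      have hC : ∀ r : R, pderiv i (ρ r) = 0 := by
        intro r
        apply pderiv_eq_zero_of_notMem_vars
        intro hmem
        have := vars_rename _ _ hmem
        rw [Finset.mem_image] at this
        obtain ⟨t, -, ht⟩ := this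
        exact hiT (ht ▸ t.2)
      induction Q using Polynomial.induction_on' with
      | add p q hp hq =>
        simp only [Polynomial.eval₂_add, map_add, hp, hq]
      | monomial m a =>
        rw [Polynomial.derivative_monomial, Polynomial.eval₂_monomial, Polynomial.eval₂_monomial]
        have hC' := hC a
        simp only [Derivation.leibniz, Derivation.leibniz_pow, pderiv_X_self, smul_eq_mul,
          nsmul_eq_mul, map_mul, map_natCast]
        change ρ a * _ + X i ^ m * pderiv i (ρ a) = ρ a * _ * _
        rw [hC']
        ring
    exact this P
  have hother : ∀ j, j ∉ T → j ≠ i → pderiv j F = 0 := by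
    intro j hj hji
    have : ∀ Q : Polynomial R, pderiv j (Q.eval₂ ρ.toRingHom (X i)) = 0 := by
      intro Q
      induction Q using Polynomial.induction_on' with
      | add p q hp hq => simp only [Polynomial.eval₂_add, map_add, hp, hq, add_zero]
      | monomial m a =>
        rw [Polynomial.eval₂_monomial]
        have hC' : pderiv j (ρ a) = 0 := by
          apply pderiv_eq_zero_of_notMem_vars
          intro hmem
          have := vars_rename _ _ hmem
          rw [Finset.mem_image] at this
          obtain ⟨t, -, ht⟩ := this
          exact hj (ht ▸ t.2)
        simp only [Derivation.leibniz, Derivation.leibniz_pow, pderiv_X_of_ne hji.symm,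
          smul_eq_mul]
        change ρ a * _ + X i ^ m * pderiv j (ρ a) = 0
        rw [hC']
        simp
    exact this P
  have hsum := hw F hFI
  rw [Finset.sum_eq_single i] at hsum
  · rw [hpd, hFz] at hsum
    exact (mul_eq_zero.mp hsum).resolve_left hder
  · intro j _ hji
    by_cases hj : j ∈ T
    · rw [hwT j hj, mul_zero]
    · rw [hother j hj hji, map_zero, zero_mul]
  · simp

/-- The Jacobian criterion at the generic point: the kernel of the Jacobian matrix has dimension
the transcendence degree. -/
theorem finrank_jacobianKernel_generic [CharZero k] {z : σ → L} {I : Ideal (MvPolynomial σ k)}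
    (hI : ∀ f, aeval z f = 0 ↔ f ∈ I) [Algebra.IsAlgebraic (Algebra.adjoin k (Set.range z)) L] :
    (Module.finrank L (jacobianKernel I z) : ℕ∞) = trRank k (Set.range z) := by
  classical
  obtain ⟨T, hT, hcard, halg⟩ := exists_algebraicIndependent_subfamily k z
  have hbasis : IsTranscendenceBasis k fun t : T => z t := by
    rw [isTranscendenceBasis_iff_algebraicIndependent_isAlgebraic]
    refine ⟨hT, ⟨fun a => ?_⟩⟩
    refine IsAlgebraic.adjoin_of_forall_isAlgebraic (s := Set.range z) ?_
      (Algebra.IsAlgebraic.isAlgebraic a)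
    rintro _ ⟨⟨i, rfl⟩, -⟩
    exact halg i
  -- Restriction to the coordinates in a transcendence basis is injective by
  -- `eq_zero_of_mem_jacobianKernel`. It is surjective because the values of a derivation at the z_i
  -- form a vector of the kernel, and derivations exist with any prescribed values on the basis.
  let ρ : jacobianKernel I z →ₗ[L] (T → L) :=
    (LinearMap.funLeft L L ((↑) : T → σ)).comp (jacobianKernel I z).subtype
  have hρ : Function.Bijective ρ := by
    constructor
    · rw [← LinearMap.ker_eq_bot, LinearMap.ker_eq_bot']
      intro w hw
      ext i
      exact eq_zero_of_mem_jacobianKernel (fun f hf => (hI f).mp hf) hT (halg i) w.2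
        fun t ht => congrFun hw ⟨t, ht⟩
    · intro w
      obtain ⟨D, hD⟩ := exists_derivation_of_isTranscendenceBasis hbasis w
      refine ⟨⟨fun i => D (z i), fun f hf => ?_⟩, ?_⟩
      · rw [← derivation_aeval, (hI f).mpr hf, map_zero]
      · ext t
        exact hD t
  rw [(LinearEquiv.ofBijective ρ hρ).finrank_eq, Module.finrank_pi, hcard,
    ← ENat.card_coe_set_eq, ENat.card_eq_coe_fintype_card]

end Jacobian

/-! ### Minors, kernels and spans. -/

section LinearAlgebra

variable {F σ : Type} [Field F]

theorem exists_fin_linearIndependent_subset {E : Type} [AddCommGroup E] [Module F E]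
    [FiniteDimensional F E] {S : Set E} {m : ℕ} (hm : Module.finrank F (Submodule.span F S) = m) :
    ∃ a : Fin m → E, (∀ j, a j ∈ S) ∧ LinearIndependent F a ∧
        Submodule.span F (Set.range a) = Submodule.span F S := by
  obtain ⟨b, hbS, hspan, hb⟩ := exists_linearIndependent F S
  have hfin : Finite b := hb.finite
  have := Fintype.ofFinite b
  have hcard : Fintype.card b = m := by
    rw [← hm, ← hspan, ← finrank_span_eq_card hb, Subtype.range_coe]
  let e := (Fintype.equivFinOfCardEq hcard).symm
  refine ⟨fun j => e j, fun j => hbS (e j).2, hb.comp e e.injective, ?_⟩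
  rw [← hspan]
  congr 1
  ext x
  constructor
  · rintro ⟨j, rfl⟩
    exact (e j).2
  · intro hx
    exact ⟨e.symm ⟨x, hx⟩, by simp⟩

theorem linearIndependent_of_minor_ne_zero {r : ℕ} {a : Fin r → σ → F} {e : Fin r → σ}
    (h : (Matrix.of fun j k => a j (e k)).det ≠ 0) : LinearIndependent F a := by
  have := Matrix.linearIndependent_rows_of_det_ne_zero h
  exact LinearIndependent.of_comp (LinearMap.funLeft F F e) this

variable [Fintype σ]

theorem card_add_finrank_ker_mulVecLin {r : ℕ} {a : Fin r → σ → F} (ha : LinearIndependent F a) :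
    r + Module.finrank F (LinearMap.ker (Matrix.mulVecLin (Matrix.of a))) = Fintype.card σ := by
  have h1 := LinearMap.finrank_range_add_finrank_ker (Matrix.mulVecLin (Matrix.of a))
  have h2 : (Matrix.of a).rank = Fintype.card (Fin r) :=
    LinearIndependent.rank_matrix (M := Matrix.of a) ha
  rw [Matrix.rank, Fintype.card_fin] at h2
  rw [h2, Module.finrank_fintype_fun_eq_card] at h1
  exact h1

theorem exists_minor_ne_zero {r : ℕ} {a : Fin r → σ → F} (ha : LinearIndependent F a) :
    ∃ e : Fin r → σ, (Matrix.of fun j k => a j (e k)).det ≠ 0 := by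
  have h2 : (Matrix.of a).rank = Fintype.card (Fin r) :=
    LinearIndependent.rank_matrix (M := Matrix.of a) ha
  rw [Matrix.rank_eq_finrank_span_cols, Fintype.card_fin] at h2
  obtain ⟨b, hb, hind, -⟩ := exists_fin_linearIndependent_subset h2
  choose e he using hb
  refine ⟨e, fun h0 => ?_⟩
  rw [← Matrix.det_transpose] at h0
  have hb : b = (Matrix.of fun j k => a j (e k)).transpose.row := by
    ext k j
    rw [← he k]
    rfl
  rw [hb, Matrix.linearIndependent_rows_iff_isUnit, Matrix.isUnit_iff_isUnit_det, h0] at hind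
  exact not_isUnit_zero hind

/-- A functional that vanishes on the common kernel of finitely many functionals is a combination of
them. -/
theorem mem_span_range_of_forall_dotProduct {ι : Type} [Finite ι] {a : ι → σ → F} {x : σ → F}
    (h : ∀ w, (∀ j, a j ⬝ᵥ w = 0) → x ⬝ᵥ w = 0) : x ∈ Submodule.span F (Set.range a) := by
  classical
  let e := dotProductEquiv F σ
  have := mem_span_of_iInf_ker_le_ker (L := fun j => e (a j)) (K := e x) (by
    intro w hw
    simp only [Submodule.mem_iInf, LinearMap.mem_ker] at hw ⊢
    exact h w hw)
  have h2 : Set.range (fun j => e (a j)) = e '' Set.range a := by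
    rw [← Set.range_comp]; rfl
  rw [h2] at this
  have h3 : Submodule.span F (e '' Set.range a) = (Submodule.span F (Set.range a)).map
    (e : (σ → F) →ₗ[F] Module.Dual F (σ → F)) := Submodule.span_image _
  rw [h3, Submodule.mem_map] at this
  obtain ⟨y, hy, hyx⟩ := this
  rwa [← e.injective hyx]

end LinearAlgebra

/-! ### Gradients of equations and kernels of Jacobian matrices. -/

section Gradient

variable {k L σ : Type} [Field k] [Field L] [Algebra k L]

theorem aeval_smul_of_isHomogeneous {f : MvPolynomial σ k} {d : ℕ} (hd : f.IsHomogeneous d)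
    (t : L) (z : σ → L) : aeval (t • z) f = t ^ d * aeval z f := by
  rw [aeval_def, aeval_def, eval₂_eq, eval₂_eq, Finset.mul_sum]
  refine Finset.sum_congr rfl fun m hm => ?_
  have hdeg := hd (mem_support_iff.mp hm)
  rw [Finsupp.weight_apply] at hdeg
  simp only [Pi.smul_apply, smul_eq_mul, mul_pow, Finset.prod_mul_distrib,
    Finset.prod_pow_eq_pow_sum]
  have : ∑ i ∈ m.support, m i = d := by
    rw [← hdeg]
    simp [Finsupp.sum]
  rw [this]
  ring

/-- The gradient of a polynomial at a point. -/
def gradient (z : σ → L) : MvPolynomial σ k →ₗ[k] (σ → L) :=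
  LinearMap.pi fun i => (aeval z).toLinearMap ∘ₗ (pderiv i).toLinearMap

theorem gradient_apply (z : σ → L) (f : MvPolynomial σ k) (i : σ) :
    gradient z f i = aeval z (pderiv i f) := rfl

theorem gradient_smul {f : MvPolynomial σ k} {d : ℕ} (hd : f.IsHomogeneous d) (t : L)
    (z : σ → L) : gradient (t • z) f = t ^ (d - 1) • gradient z f := by
  ext i
  rw [gradient_apply, aeval_smul_of_isHomogeneous hd.pderiv]
  rfl

variable [Fintype σ] {I : Ideal (MvPolynomial σ k)} {z : σ → L}

theorem mem_jacobianKernel {w : σ → L} :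
    w ∈ jacobianKernel I z ↔ ∀ f ∈ I, gradient z f ⬝ᵥ w = 0 := Iff.rfl

/-- Euler's identity. -/
theorem gradient_dotProduct_self {f : MvPolynomial σ k} {d : ℕ} (hd : f.IsHomogeneous d)
    (hf : aeval z f = 0) : gradient z f ⬝ᵥ z = 0 := by
  have := congrArg (aeval z) hd.sum_X_mul_pderiv
  rw [map_nsmul, hf, smul_zero, map_sum] at this
  rw [← this]
  simp [dotProduct, gradient_apply, mul_comm]

theorem card_add_finrank_jacobianKernel_le {r : ℕ} {f : Fin r → MvPolynomial σ k}
    (hf : ∀ j, f j ∈ I) (hind : LinearIndependent L fun j => gradient z (f j)) :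
    jacobianKernel I z ≤
      LinearMap.ker (Matrix.mulVecLin (Matrix.of fun j => gradient z (f j))) ∧
    r + Module.finrank L (jacobianKernel I z) ≤ Fintype.card σ := by
  have hle : jacobianKernel I z ≤
      LinearMap.ker (Matrix.mulVecLin (Matrix.of fun j => gradient z (f j))) := by
    intro w hw
    ext j
    exact hw (f j) (hf j)
  refine ⟨hle, ?_⟩
  rw [← card_add_finrank_ker_mulVecLin hind]
  exact Nat.add_le_add_left (Submodule.finrank_mono hle) r

theorem mem_jacobianKernel_iff {r : ℕ} {f : Fin r → MvPolynomial σ k}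
    (hf : ∀ j, f j ∈ I) (hind : LinearIndependent L fun j => gradient z (f j))
    (hr : r + Module.finrank L (jacobianKernel I z) = Fintype.card σ) (w : σ → L) :
    w ∈ jacobianKernel I z ↔ ∀ j, gradient z (f j) ⬝ᵥ w = 0 := by
  have h : jacobianKernel I z =
      LinearMap.ker (Matrix.mulVecLin (Matrix.of fun j => gradient z (f j))) := by
    refine Submodule.eq_of_le_of_finrank_eq (card_add_finrank_jacobianKernel_le hf hind).1 ?_
    have := card_add_finrank_ker_mulVecLin hind
    omega
  rw [h, LinearMap.mem_ker, funext_iff]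
  rfl

/-- The Jacobian matrix of a homogeneous ideal has as many independent rows, coming from
homogeneous elements of the ideal, as the codimension of its kernel. -/
theorem exists_independent_gradients (hI : ∀ f ∈ I, ∀ d, homogeneousComponent d f ∈ I)
    (z : σ → L) : ∃ (r : ℕ) (f : Fin r → MvPolynomial σ k) (d : Fin r → ℕ), (∀ j, f j ∈ I) ∧
      (∀ j, (f j).IsHomogeneous (d j)) ∧ (LinearIndependent L fun j => gradient z (f j)) ∧
      r + Module.finrank L (jacobianKernel I z) = Fintype.card σ := by
  obtain ⟨a, haS, hind, hspan⟩ := exists_fin_linearIndependent_subset (F := L)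
    (S := {v | ∃ f ∈ I, ∃ d, f.IsHomogeneous d ∧ gradient z f = v}) rfl
  choose f hf d hd hfa using haS
  have hind' : LinearIndependent L fun j => gradient z (f j) := by
    simpa only [hfa] using hind
  refine ⟨_, f, d, hf, hd, hind', ?_⟩
  refine le_antisymm (card_add_finrank_jacobianKernel_le hf hind').2 ?_
  rw [← card_add_finrank_ker_mulVecLin hind']
  refine Nat.add_le_add_left (Submodule.finrank_mono fun w hw => ?_) _
  have hw' : ∀ v ∈ Submodule.span L (Set.range a), v ⬝ᵥ w = 0 := by
    intro v hv
    induction hv using Submodule.span_induction with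
    | mem x hx =>
      obtain ⟨j, rfl⟩ := hx
      rw [← hfa]
      exact congrFun hw j
    | zero => exact zero_dotProduct w
    | add x y _ _ hx hy => rw [add_dotProduct, hx, hy, add_zero]
    | smul c x _ hx => rw [smul_dotProduct, hx, smul_zero]
  rw [mem_jacobianKernel]
  intro g hg
  -- The chosen rows span the gradients of homogeneous elements only; as the ideal is homogeneous,
  -- every other gradient is a sum of such.
  rw [← sum_homogeneousComponent g, map_sum, sum_dotProduct]
  refine Finset.sum_eq_zero fun e _ => hw' _ ?_
  rw [hspan]
  exact Submodule.subset_span ⟨_, hI g hg e, e, homogeneousComponent_isHomogeneous e g, rfl⟩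

end Gradient

/-! ### The frame of the space of matrices for which a point is critical. -/

section SymProd

variable {R σ : Type} [CommRing R]

/-- The symmetrized product of two vectors, as a symmetric matrix. -/
def symProd (u v : σ → R) : Sym2 σ → R :=
  Sym2.lift ⟨fun a b => u a * v b + v a * u b, fun a b => by ring⟩

theorem symProd_mk (u v : σ → R) (a b : σ) : symProd u v s(a, b) = u a * v b + v a * u b := rfl

theorem symProd_comm (u v : σ → R) : symProd u v = symProd v u := by
  ext z
  induction z using Sym2.ind with
  | h a b => rw [symProd_mk, symProd_mk]; ring

theorem map_symProd {S : Type} [CommRing S] (φ : R →+* S) (u v : σ → R) (z : Sym2 σ) :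
    φ (symProd u v z) = symProd (fun a => φ (u a)) (fun a => φ (v a)) z := by
  induction z using Sym2.ind with
  | h a b => simp [symProd_mk]

section Frame

variable [DecidableEq σ]

/-- The Koszul vector `q_i e_j - q_j e_i`, which is orthogonal to `q`. -/
def koszulVector (q : σ → R) (i j : σ) : σ → R := fun k =>
  q i * (if k = j then 1 else 0) - q j * (if k = i then 1 else 0)

theorem map_koszulVector {S : Type} [CommRing S] (φ : R →+* S) (q : σ → R) (i j k : σ) :
    φ (koszulVector q i j k) = koszulVector (fun a => φ (q a)) i j k := by
  simp [koszulVector, apply_ite φ]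

/-- Sections that span the symmetric matrices `H` with `H q` in the span of `q` and of the
vectors `a j` orthogonal to it, where the coordinate `q i` does not vanish. -/
def rayleighFrame {r : ℕ} (q : σ → R) (a : Fin r → σ → R) (i : σ) :
    Option (Fin r) ⊕ Sym2 {j // j ≠ i} → Sym2 σ → R
  | Sum.inl none => symProd q q
  | Sum.inl (some j) => symProd q (a j)
  | Sum.inr z => Sym2.lift (α := {j // j ≠ i}) ⟨fun j k => symProd (koszulVector q i j) (koszulVector q i k),
      fun _ _ => symProd_comm _ _⟩ z

theorem map_rayleighFrame {S : Type} [CommRing S] (φ : R →+* S) {r : ℕ} (q : σ → R)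
    (a : Fin r → σ → R) (i : σ) (s : Option (Fin r) ⊕ Sym2 {j // j ≠ i}) (z : Sym2 σ) :
    φ (rayleighFrame q a i s z) =
      rayleighFrame (fun k => φ (q k)) (fun j k => φ (a j k)) i s z := by
  rcases s with (_ | j) | w
  · exact map_symProd φ _ _ z
  · exact map_symProd φ _ _ z
  · induction w using Sym2.ind with
    | h j k =>
      refine (map_symProd φ _ _ z).trans ?_
      simp only [map_koszulVector]
      rfl

/-- Off row and column i the Koszul products are nonzero multiples of the standard symmetric
matrices, when q i ≠ 0 and 2 ≠ 0 in a field. This is what makes them independent. -/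
theorem rayleighFrame_inr_apply {r : ℕ} {q : σ → R} {a : Fin r → σ → R} {i : σ} (j k : {j // j ≠ i}) (z : Sym2 {j // j ≠ i}) :
    rayleighFrame q a i (Sum.inr z) s(j.1, k.1) =
      if z = s(j, k) then q i ^ 2 * (if j = k then 2 else 1) else 0 := by
  induction z using Sym2.ind with
  | h l m =>
    change symProd (koszulVector q i l) (koszulVector q i m) s(j.1, k.1) = _
    rw [symProd_mk]
    simp only [koszulVector, if_neg j.2, if_neg k.2, mul_zero, sub_zero, ← Subtype.ext_iff]
    simp only [Sym2.eq_iff]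
    by_cases h1 : j = l <;> by_cases h2 : k = m <;> by_cases h3 : k = l <;> by_cases h4 : j = m <;>
      simp_all [eq_comm] <;> ring

end Frame

variable [Fintype σ]

/-- The product of a symmetric matrix with a vector. -/
def symMulVec (q : σ → R) : (Sym2 σ → R) →ₗ[R] (σ → R) where
  toFun H := fun a => ∑ b, H s(a, b) * q b
  map_add' H H' := by ext a; simp [add_mul, Finset.sum_add_distrib]
  map_smul' c H := by ext a; simp [Finset.mul_sum, mul_assoc]

theorem symMulVec_apply (q : σ → R) (H : Sym2 σ → R) (a : σ) :
    symMulVec q H a = ∑ b, H s(a, b) * q b := rfl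

theorem symMulVec_symProd (q u v : σ → R) :
    symMulVec q (symProd u v) = (v ⬝ᵥ q) • u + (u ⬝ᵥ q) • v := by
  ext a
  simp only [symMulVec_apply, symProd_mk, dotProduct, Pi.add_apply, Pi.smul_apply, smul_eq_mul,
    Finset.sum_mul, ← Finset.sum_add_distrib]
  exact Finset.sum_congr rfl fun b _ => by ring

theorem koszulVector_dotProduct [DecidableEq σ] (q : σ → R) (i j : σ) :
    koszulVector q i j ⬝ᵥ q = 0 := by
  simp [koszulVector, dotProduct, sub_mul, Finset.sum_sub_distrib]
  ring

/-- The equations on a symmetric matrix `H` that say that the gradient at `q` of the Rayleigh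
quotient of `H` is orthogonal to the subspace `N`. -/
def rayleighSpace (N : Submodule R (σ → R)) (q : σ → R) : Submodule R (Sym2 σ → R) where
  carrier := {H | ∀ w ∈ N,
    ((q ⬝ᵥ q) • symMulVec q H - (q ⬝ᵥ symMulVec q H) • q) ⬝ᵥ w = 0}
  add_mem' := by
    intro H H' h h' w hw
    have := congrArg₂ (· + ·) (h w hw) (h' w hw)
    simp only [sub_dotProduct, smul_dotProduct, smul_eq_mul, map_add, add_dotProduct,
      dotProduct_add] at this ⊢
    linear_combination this
  zero_mem' := by
    intro w _
    simp
  smul_mem' := by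
    intro c H h w hw
    have := h w hw
    simp only [sub_dotProduct, smul_dotProduct, smul_eq_mul, map_smul, dotProduct_smul] at this ⊢
    linear_combination c * this

theorem mem_rayleighSpace {N : Submodule R (σ → R)} {q : σ → R} {H : Sym2 σ → R} :
    H ∈ rayleighSpace N q ↔ ∀ w ∈ N,
      ((q ⬝ᵥ q) • symMulVec q H - (q ⬝ᵥ symMulVec q H) • q) ⬝ᵥ w = 0 := Iff.rfl

/-- For H q = c q + x with x orthogonal to q, the vector paired with w is just (q ⬝ᵥ q) x. -/
theorem mem_rayleighSpace_of_eq {N : Submodule R (σ → R)} {q x : σ → R} {c : R} {H : Sym2 σ → R}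
    (hH : symMulVec q H = c • q + x) (hxq : x ⬝ᵥ q = 0) (hx : ∀ w ∈ N, x ⬝ᵥ w = 0) :
    H ∈ rayleighSpace N q := by
  intro w hw
  rw [hH]
  simp only [sub_dotProduct, smul_dotProduct, add_dotProduct, dotProduct_add, dotProduct_smul,
    smul_eq_mul, hx w hw, dotProduct_comm q x, hxq]
  ring

variable [DecidableEq σ] {r : ℕ} {q : σ → R} {a : Fin r → σ → R} {i : σ}

theorem symMulVec_rayleighFrame_inr (z : Sym2 {j // j ≠ i}) :
    symMulVec q (rayleighFrame q a i (Sum.inr z)) = 0 := by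
  induction z using Sym2.ind with
  | h j k =>
    refine (symMulVec_symProd q (koszulVector q i j) (koszulVector q i k)).trans ?_
    simp [koszulVector_dotProduct]

theorem rayleighFrame_mem {N : Submodule R (σ → R)} (haq : ∀ j, a j ⬝ᵥ q = 0)
    (haN : ∀ j, ∀ w ∈ N, a j ⬝ᵥ w = 0) (s : Option (Fin r) ⊕ Sym2 {j // j ≠ i}) :
    rayleighFrame q a i s ∈ rayleighSpace N q := by
  rcases s with (_ | j) | z
  · refine mem_rayleighSpace_of_eq (x := 0) (c := 2 * (q ⬝ᵥ q)) ?_ (by simp) (by simp)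
    refine (symMulVec_symProd q q q).trans ?_
    rw [add_zero, ← add_smul, two_mul]
  · refine mem_rayleighSpace_of_eq (x := (q ⬝ᵥ q) • a j) (c := 0) ?_ ?_ ?_
    · refine (symMulVec_symProd q q (a j)).trans ?_
      rw [haq]
    · rw [smul_dotProduct, haq, smul_zero]
    · intro w hw
      rw [smul_dotProduct, haN j w hw, smul_zero]
  · refine mem_rayleighSpace_of_eq (x := 0) (c := 0) ?_ (by simp) (by simp)
    rw [symMulVec_rayleighFrame_inr]
    simp

end SymProd

section Field

variable {F σ : Type} [Field F] [CharZero F] [Fintype σ] [DecidableEq σ] {r : ℕ} {q : σ → F}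
  {a : Fin r → σ → F} {i : σ}

/-- Multiplication by q kills the Koszul products and sends the others to 2(q ⬝ᵥ q) q and (q ⬝ᵥ q)
a_j. Pairing with q isolates the first coefficient, independence of a gives the next ones, and the
entries off row and column i give the rest. -/
theorem linearIndependent_rayleighFrame (hi : q i ≠ 0) (hq : q ⬝ᵥ q ≠ 0)
    (haq : ∀ j, a j ⬝ᵥ q = 0) (ha : LinearIndependent F a) :
    LinearIndependent F (rayleighFrame q a i) := by
  rw [Fintype.linearIndependent_iff]
  intro c hc
  rw [Fintype.sum_sum_type, Fintype.sum_option] at hc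
  have h1 := congrArg (symMulVec q) hc
  simp only [map_add, map_sum, map_smul, symMulVec_rayleighFrame_inr, smul_zero,
    Finset.sum_const_zero, add_zero, map_zero] at h1
  have h2 : ∀ j, symMulVec q (rayleighFrame q a i (Sum.inl (some j))) = (q ⬝ᵥ q) • a j := by
    intro j
    refine (symMulVec_symProd q q (a j)).trans ?_
    rw [haq, zero_smul, zero_add]
  have h3 : symMulVec q (rayleighFrame q a i (Sum.inl none)) = (2 * (q ⬝ᵥ q)) • q := by
    refine (symMulVec_symProd q q q).trans ?_
    rw [← add_smul, two_mul]
  simp only [h2, h3] at h1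
  have hnone : c (Sum.inl none) = 0 := by
    have h4 := congrArg (· ⬝ᵥ q) h1
    simp only [add_dotProduct, sum_dotProduct, smul_dotProduct, haq,
      zero_dotProduct, smul_eq_mul] at h4
    simpa [hq] using h4
  have hsome : ∀ j, c (Sum.inl (some j)) = 0 := by
    rw [hnone, zero_smul, zero_add] at h1
    simp only [smul_smul] at h1
    intro j
    simpa [hq] using Fintype.linearIndependent_iff.mp ha _ h1 j
  have hinr : ∀ z, c (Sum.inr z) = 0 := by
    intro z
    induction z using Sym2.ind with
    | h j k =>
      simp only [hnone, hsome, zero_smul, Finset.sum_const_zero, zero_add] at hc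
      have h5 := congrFun hc s(j.1, k.1)
      simp only [Finset.sum_apply, Pi.smul_apply, rayleighFrame_inr_apply, smul_eq_mul, mul_ite,
        mul_zero, Finset.sum_ite_eq', Finset.mem_univ, if_true, Pi.zero_apply] at h5
      by_cases hjk : j = k <;> simpa [hjk, hi] using h5
  rintro ((_ | j) | z)
  · exact hnone
  · exact hsome j
  · exact hinr z

/-- The rank of `rayleighFrame` is the dimension of the space it spans. -/
theorem span_rayleighFrame {N : Submodule F (σ → F)} (hi : q i ≠ 0) (hq : q ⬝ᵥ q ≠ 0)
    (haq : ∀ j, a j ⬝ᵥ q = 0) (ha : LinearIndependent F a)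
    (hN : ∀ w, w ∈ N ↔ ∀ j, a j ⬝ᵥ w = 0) :
    rayleighSpace N q = Submodule.span F (Set.range (rayleighFrame q a i)) := by
  symm
  refine Submodule.eq_of_le_of_finrank_le ?_ ?_
  · rw [Submodule.span_le]
    rintro _ ⟨s, rfl⟩
    exact rayleighFrame_mem haq (fun j w hw => (hN w).mp hw j) s
  have hspan : ∀ H ∈ rayleighSpace N q,
      symMulVec q H ∈ Submodule.span F (Set.range fun o : Option (Fin r) => o.elim q a) := by
    intro H hH
    have h1 : (q ⬝ᵥ q) • symMulVec q H - (q ⬝ᵥ symMulVec q H) • q ∈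
        Submodule.span F (Set.range a) :=
      mem_span_range_of_forall_dotProduct fun w hw => hH w ((hN w).mpr hw)
    have h2 : Submodule.span F (Set.range a) ≤
        Submodule.span F (Set.range fun o : Option (Fin r) => o.elim q a) := by
      refine Submodule.span_mono ?_
      rintro _ ⟨j, rfl⟩
      exact ⟨some j, rfl⟩
    have h3 : q ∈ Submodule.span F (Set.range fun o : Option (Fin r) => o.elim q a) :=
      Submodule.subset_span ⟨none, rfl⟩
    have h4 := Submodule.add_mem _ (h2 h1) (Submodule.smul_mem _ (q ⬝ᵥ symMulVec q H) h3)
    rw [sub_add_cancel] at h4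
    exact (Submodule.smul_mem_iff _ hq).mp h4
  -- A symmetric matrix is determined by H q and its entries off row and column i, because q i ≠ 0.
  -- The target has dimension at most r + 1 plus the number of these entries, which is the size of
  -- the frame.
  let Ψ : rayleighSpace N q →ₗ[F]
      Submodule.span F (Set.range fun o : Option (Fin r) => o.elim q a) ×
        (Sym2 {j // j ≠ i} → F) :=
    LinearMap.prod (LinearMap.codRestrict _ ((symMulVec q).comp (rayleighSpace N q).subtype)
        fun H => hspan H H.2)
      ((LinearMap.funLeft F F (Sym2.map Subtype.val)).comp (rayleighSpace N q).subtype)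
  have hΨ : Function.Injective Ψ := by
    rw [← LinearMap.ker_eq_bot, LinearMap.ker_eq_bot']
    rintro ⟨H, hH⟩ h
    have h1 : symMulVec q H = 0 := congrArg (fun x => (x.1 : σ → F)) h
    have h2 : ∀ j k, j ≠ i → k ≠ i → H s(j, k) = 0 := fun j k hj hk =>
      congrFun (congrArg Prod.snd h) s(⟨j, hj⟩, ⟨k, hk⟩)
    have h3 : ∀ j, (∀ k, k ≠ i → H s(j, k) = 0) → H s(j, i) = 0 := by
      intro j hj
      have h4 := congrFun h1 j
      rw [symMulVec_apply, Finset.sum_eq_single i] at h4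
      · simpa [hi] using h4
      · intro k _ hk
        rw [hj k hk, zero_mul]
      · simp
    have h5 : ∀ j, j ≠ i → H s(j, i) = 0 := fun j hj => h3 j fun k hk => h2 j k hj hk
    have h6 : H s(i, i) = 0 := h3 i fun k hk => by rw [Sym2.eq_swap]; exact h5 k hk
    ext z
    induction z using Sym2.ind with
    | h j k =>
      change H s(j, k) = 0
      by_cases hj : j = i <;> by_cases hk : k = i
      · rw [hj, hk, h6]
      · rw [hj, Sym2.eq_swap, h5 k hk]
      · rw [hk, h5 j hj]
      · exact h2 j k hj hk
  refine (LinearMap.finrank_le_finrank_of_injective hΨ).trans ?_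
  rw [finrank_span_eq_card (linearIndependent_rayleighFrame hi hq haq ha), Module.finrank_prod,
    Fintype.card_sum, Module.finrank_fintype_fun_eq_card]
  exact Nat.add_le_add_right (finrank_range_le_card _) _

end Field

/-! ### Critical points as linear equations on the matrix. -/

section Critical

variable {n : ℕ}

/-- The count is 1 + c + n(n−1)/2. The truncated subtraction is exact, since the existence of i
gives n ≥ 1. -/
theorem card_rayleighFrame (c : ℕ) (i : Fin n) :
    Fintype.card (Option (Fin c) ⊕ Sym2 {j // j ≠ i}) = (n + 1).choose 2 - n + c + 1 := by
  have hn : 1 ≤ n := i.pos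
  rw [Fintype.card_sum, Fintype.card_option, Fintype.card_fin, Sym2.card,
    Fintype.card_subtype_compl, Fintype.card_fin, Fintype.card_subtype_eq, Nat.sub_add_cancel hn,
    Nat.choose_succ_succ' n 1, Nat.choose_one_right]
  change _ = n + n.choose 2 - n + c + 1
  omega

theorem symMatrix_mulVec (h : Sym2 (Fin n) → ℂ) (v : Fin n → ℂ) :
    (symMatrix h).mulVec v = symMulVec v h := rfl

theorem dotProduct_symMulVec_comm (h : Sym2 (Fin n) → ℂ) (v w : Fin n → ℂ) :
    v ⬝ᵥ symMulVec w h = symMulVec v h ⬝ᵥ w := by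
  rw [← symMatrix_mulVec, ← symMatrix_mulVec, Matrix.dotProduct_mulVec, ← Matrix.mulVec_transpose]
  congr 2
  ext j k
  exact congrArg h Sym2.eq_swap

theorem fderiv_rayleigh (h : Sym2 (Fin n) → ℂ) {v : Fin n → ℂ} (hv : v ⬝ᵥ v ≠ 0)
    (w : Fin n → ℂ) : fderiv ℂ (rayleigh (symMatrix h)) v w =
      2 * (((v ⬝ᵥ v) • symMulVec v h - (v ⬝ᵥ symMulVec v h) • v) ⬝ᵥ w) / (v ⬝ᵥ v) ^ 2 := by
  have hdiff : DifferentiableAt ℂ (rayleigh (symMatrix h)) v := by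
    have h1 : DifferentiableAt ℂ (fun v : Fin n → ℂ => v ⬝ᵥ ((symMatrix h).mulVec v)) v := by
      simp only [dotProduct, Matrix.mulVec]
      fun_prop
    have h2 : DifferentiableAt ℂ (fun v : Fin n → ℂ => v ⬝ᵥ v) v := by
      simp only [dotProduct]
      fun_prop
    have h3 := h1.fun_mul (h2.fun_inv hv)
    simp only [← div_eq_mul_inv] at h3
    exact h3
  -- Along the line v + t w numerator and denominator are quadratic in t, and only their constant
  -- and linear coefficients enter the derivative at 0.
  rw [← hdiff.lineDeriv_eq_fderiv, lineDeriv]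
  have hN : ∀ t : ℂ, (v + t • w) ⬝ᵥ ((symMatrix h).mulVec (v + t • w)) =
      v ⬝ᵥ symMulVec v h + t * (2 * (symMulVec v h ⬝ᵥ w)) + t ^ 2 * (w ⬝ᵥ symMulVec w h) := by
    intro t
    rw [Matrix.mulVec_add, Matrix.mulVec_smul, symMatrix_mulVec, symMatrix_mulVec]
    simp only [add_dotProduct, dotProduct_add, smul_dotProduct, dotProduct_smul, smul_eq_mul]
    rw [dotProduct_symMulVec_comm h v w, dotProduct_comm w (symMulVec v h)]
    ring
  have hD : ∀ t : ℂ, (v + t • w) ⬝ᵥ (v + t • w) =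
      v ⬝ᵥ v + t * (2 * (v ⬝ᵥ w)) + t ^ 2 * (w ⬝ᵥ w) := by
    intro t
    simp only [add_dotProduct, dotProduct_add, smul_dotProduct, dotProduct_smul, smul_eq_mul]
    rw [dotProduct_comm w v]
    ring
  have hquad : ∀ a b e : ℂ, HasDerivAt (fun t : ℂ => a + t * b + t ^ 2 * e) b 0 := by
    intro a b e
    have := (((hasDerivAt_id (0 : ℂ)).mul_const b).const_add a).fun_add
      (((hasDerivAt_id (0 : ℂ)).fun_pow 2).mul_const e)
    simpa using this
  have hfun : (fun t : ℂ => rayleigh (symMatrix h) (v + t • w)) = fun t =>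
      (v ⬝ᵥ symMulVec v h + t * (2 * (symMulVec v h ⬝ᵥ w)) + t ^ 2 * (w ⬝ᵥ symMulVec w h)) /
      (v ⬝ᵥ v + t * (2 * (v ⬝ᵥ w)) + t ^ 2 * (w ⬝ᵥ w)) := by
    ext t
    rw [rayleigh, hN, hD]
  rw [hfun]
  have := (hquad (v ⬝ᵥ symMulVec v h) (2 * (symMulVec v h ⬝ᵥ w)) (w ⬝ᵥ symMulVec w h)).fun_div
    (hquad (v ⬝ᵥ v) (2 * (v ⬝ᵥ w)) (w ⬝ᵥ w)) (by simpa using hv)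
  rw [this.deriv]
  simp only [sub_dotProduct, smul_dotProduct, smul_eq_mul]
  congr 1
  · ring
  · ring

/-- Critical points of the Rayleigh quotient in terms of linear equations on the matrix. -/
theorem isCriticalPoint_iff {V : Set (ProjSpace (Fin n))} {h : ProjSpace (Sym2 (Fin n))}
    {p : ProjSpace (Fin n)} : IsCriticalPoint V h p ↔
      p ∈ regularLocus V \ isotropicQuadric n ∧
        h.rep ∈ rayleighSpace (tangentSpace V p.rep) p.rep := by
  rw [IsCriticalPoint, ← and_assoc, Set.mem_sdiff]
  refine and_congr_right fun hp => forall₂_congr fun w _ => ?_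
  have hv : p.rep ⬝ᵥ p.rep ≠ 0 := hp.2
  rw [fderiv_rayleigh _ hv]
  simp [hv]

end Critical

/-! ### Tangent spaces along the cone over V. -/

section

section Minor

variable {k L σ : Type} [Field k] [Field L] [Algebra k L]

/-- The minor, with columns `e`, of the Jacobian matrix of a family of polynomials. -/
def jacobianMinor {r : ℕ} (f : Fin r → MvPolynomial σ k) (e : Fin r → σ) : MvPolynomial σ k :=
  (Matrix.of fun j l => pderiv (e l) (f j)).det

theorem aeval_jacobianMinor {r : ℕ} (f : Fin r → MvPolynomial σ k) (e : Fin r → σ) (z : σ → L) :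
    aeval z (jacobianMinor f e) = (Matrix.of fun j l => gradient z (f j) (e l)).det := by
  rw [jacobianMinor, AlgHom.map_det]
  rfl

end Minor

variable {n : ℕ} {V : Set (ProjSpace (Fin n))}

theorem affineCone_eq : affineCone V = (projQuotient (Fin n)).cone V := by
  ext v
  constructor
  · rintro ⟨hv, h⟩
    obtain ⟨t, ht, hvt⟩ := ProjSpace.exists_rep_mk v hv
    exact ⟨_, h, fun _ => t, fun _ => ht, hvt⟩
  · rintro ⟨p, hp, t, ht, rfl⟩
    have hne : (fun i => t () * (projQuotient (Fin n)).rep p i) ≠ 0 :=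
      smul_ne_zero (ht ()) p.rep_ne_zero
    refine ⟨hne, ?_⟩
    rwa [(ProjSpace.mk_eq_iff hne p).mpr ⟨t (), ht (), rfl⟩]

theorem rep_mem_affineCone {p : ProjSpace (Fin n)} (hp : p ∈ V) : p.rep ∈ affineCone V :=
  ⟨p.rep_ne_zero, by rwa [p.mk_rep]⟩

theorem smul_mem_affineCone {v : Fin n → ℂ} (hv : v ∈ affineCone V) {t : ℂ} (ht : t ≠ 0) :
    t • v ∈ affineCone V := by
  rw [affineCone_eq] at hv ⊢
  exact TorusQuotient.smul_mem_cone hv (t := fun _ => t) fun _ => ht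

/-- The cone is stable under scaling, so f vanishes on the orbit of each of its points. -/
theorem homogeneousComponent_mem_vanishingIdeal {f : MvPolynomial (Fin n) ℂ}
    (hf : f ∈ vanishingIdeal ℂ (affineCone V)) (d : ℕ) :
    homogeneousComponent d f ∈ vanishingIdeal ℂ (affineCone V) := by
  intro v hv
  refine (forall_torus_eval_eq_zero_iff (γ := fun _ : Fin n => ()) unitDegreeEquiv
    (fun _ => unitDegreeEquiv_one ()) v f).mp (fun t ht => ?_) d
  exact hf _ (smul_mem_affineCone hv (ht ()))

theorem tangentSpace_eq (V : Set (ProjSpace (Fin n))) (v : Fin n → ℂ) :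
    tangentSpace V v = jacobianKernel (vanishingIdeal ℂ (affineCone V)) v := rfl

theorem mem_tangentSpace_iff_forall_isHomogeneous {v w : Fin n → ℂ} : w ∈ tangentSpace V v ↔
    ∀ f ∈ vanishingIdeal ℂ (affineCone V), ∀ d, f.IsHomogeneous d → gradient v f ⬝ᵥ w = 0 := by
  refine ⟨fun h f hf d _ => h f hf, fun h f hf => ?_⟩
  change gradient v f ⬝ᵥ w = 0
  rw [← sum_homogeneousComponent f, map_sum, sum_dotProduct]
  exact Finset.sum_eq_zero fun d _ => h _ (homogeneousComponent_mem_vanishingIdeal hf d) d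
    (homogeneousComponent_isHomogeneous d f)

/-- Gradients of homogeneous equations only change by a nonzero scalar. -/
theorem tangentSpace_smul {t : ℂ} (ht : t ≠ 0) (v : Fin n → ℂ) :
    tangentSpace V (t • v) = tangentSpace V v := by
  ext w
  simp only [mem_tangentSpace_iff_forall_isHomogeneous]
  refine forall₄_congr fun f _ d hd => ?_
  rw [gradient_smul hd, smul_dotProduct, smul_eq_mul, mul_eq_zero]
  simp [ht]

section Generic

variable {K : Type} [Field K] [Algebra ℂ K] {ξ : Fin n → K}
  [Algebra.IsAlgebraic (Algebra.adjoin ℂ (Set.range ξ)) K] {D c : ℕ}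

/-- There are as many homogeneous equations with generically independent gradients as the
codimension. -/
theorem exists_generic_gradients
    (hξ : ∀ f, aeval ξ f = 0 ↔ f ∈ vanishingIdeal ℂ (affineCone V))
    (hD : trRank ℂ (Set.range ξ) = D) (hc : c + D = n) :
    ∃ (f : Fin c → MvPolynomial (Fin n) ℂ) (d : Fin c → ℕ) (g : MvPolynomial (Fin n) ℂ),
      (∀ j, f j ∈ vanishingIdeal ℂ (affineCone V)) ∧ (∀ j, (f j).IsHomogeneous (d j)) ∧
      (LinearIndependent K fun j => gradient ξ (f j)) ∧
      g ∉ vanishingIdeal ℂ (affineCone V) ∧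
      ∀ x : Fin n → ℂ, eval x g ≠ 0 → LinearIndependent ℂ fun j => gradient x (f j) := by
  obtain ⟨r, f, d, hf, hd, hind, hr⟩ := exists_independent_gradients
    (fun f hf d => homogeneousComponent_mem_vanishingIdeal (V := V) hf d) ξ
  have h1 := finrank_jacobianKernel_generic hξ
  rw [hD, Nat.cast_inj] at h1
  rw [h1, Fintype.card_fin] at hr
  obtain rfl : r = c := by omega
  obtain ⟨e, he⟩ := exists_minor_ne_zero hind
  refine ⟨f, d, jacobianMinor f e, hf, hd, hind, fun h => he ?_, fun x hx => ?_⟩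
  · rw [← aeval_jacobianMinor]
    exact (hξ _).mpr h
  · refine linearIndependent_of_minor_ne_zero (e := e) ?_
    rw [← aeval_jacobianMinor]
    exact hx

/-- The tangent spaces have at least the expected dimension. -/
theorem le_card_add_finrank_tangentSpace
    (hξ : ∀ f, aeval ξ f = 0 ↔ f ∈ vanishingIdeal ℂ (affineCone V))
    (hD : trRank ℂ (Set.range ξ) = D) (hc : c + D = n) {x : Fin n → ℂ} (hx : x ∈ affineCone V) :
    n ≤ c + Module.finrank ℂ (tangentSpace V x) := by
  obtain ⟨r, f, d, hf, hd, hind, hr⟩ := exists_independent_gradients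
    (fun f hf d => homogeneousComponent_mem_vanishingIdeal (V := V) hf d) x
  obtain ⟨e, he⟩ := exists_minor_ne_zero hind
  rw [← aeval_jacobianMinor] at he
  -- A minor that is nonzero at one point of the cone is nonzero at the generic point, so the rank
  -- of the Jacobian at x is at most its generic value c.
  have h1 : aeval ξ (jacobianMinor f e) ≠ 0 := fun h => he ((hξ _).mp h x hx)
  rw [aeval_jacobianMinor] at h1
  have h2 := (card_add_finrank_jacobianKernel_le hf (linearIndependent_of_minor_ne_zero h1)).2
  have h3 := finrank_jacobianKernel_generic hξ
  rw [hD, Nat.cast_inj] at h3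
  rw [h3] at h2
  rw [Fintype.card_fin] at h2 hr
  rw [tangentSpace_eq]
  omega

end Generic

end

/-! ### Critical pairs in coordinates, and the incidence parametrization. -/

section

theorem rayleighSpace_smul {F σ : Type} [Field F] [Fintype σ] (N : Submodule F (σ → F)) {t : F}
    (ht : t ≠ 0) (q : σ → F) : rayleighSpace N (t • q) = rayleighSpace N q := by
  ext H
  have hmul : symMulVec (t • q) H = t • symMulVec q H := by
    ext a
    simp only [symMulVec_apply, Pi.smul_apply, smul_eq_mul, Finset.mul_sum]
    exact Finset.sum_congr rfl fun b _ => by ring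
  have h : ∀ w, (((t • q) ⬝ᵥ (t • q)) • symMulVec (t • q) H -
      ((t • q) ⬝ᵥ symMulVec (t • q) H) • t • q) ⬝ᵥ w =
      t ^ 3 * (((q ⬝ᵥ q) • symMulVec q H - (q ⬝ᵥ symMulVec q H) • q) ⬝ᵥ w) := by
    intro w
    rw [hmul]
    simp only [sub_dotProduct, smul_dotProduct, dotProduct_smul, smul_eq_mul]
    ring
  simp only [mem_rayleighSpace, h, mul_eq_zero, pow_eq_zero_iff, ht, false_or, ne_eq,
    OfNat.ofNat_ne_zero, not_false_eq_true]

variable {n c : ℕ} {V : Set (ProjSpace (Fin n))}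

theorem rayleighFrame_gradient_mem {f : Fin c → MvPolynomial (Fin n) ℂ} {d : Fin c → ℕ}
    (hf : ∀ j, f j ∈ vanishingIdeal ℂ (affineCone V)) (hd : ∀ j, (f j).IsHomogeneous (d j))
    {x : Fin n → ℂ} (hx : x ∈ affineCone V) (i : Fin n) (s : Option (Fin c) ⊕ Sym2 {j // j ≠ i}) :
    rayleighFrame x (fun j => gradient x (f j)) i s ∈ rayleighSpace (tangentSpace V x) x :=
  rayleighFrame_mem (fun j => gradient_dotProduct_self (hd j) (hf j x hx))
    (fun j w (hw : w ∈ tangentSpace V x) => hw (f j) (hf j)) s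

theorem rayleighSpace_tangentSpace_eq_span {f : Fin c → MvPolynomial (Fin n) ℂ} {d : Fin c → ℕ}
    (hf : ∀ j, f j ∈ vanishingIdeal ℂ (affineCone V)) (hd : ∀ j, (f j).IsHomogeneous (d j))
    {x : Fin n → ℂ} (hx : x ∈ affineCone V) (hind : LinearIndependent ℂ fun j => gradient x (f j))
    (hdim : c + Module.finrank ℂ (tangentSpace V x) = n) (hxx : x ⬝ᵥ x ≠ 0) {i : Fin n}
    (hi : x i ≠ 0) : rayleighSpace (tangentSpace V x) x = Submodule.span ℂ
      (Set.range (rayleighFrame x (fun j => gradient x (f j)) i)) :=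
  span_rayleighFrame hi hxx (fun j => gradient_dotProduct_self (hd j) (hf j x hx)) hind
    (mem_jacobianKernel_iff hf hind (by rw [Fintype.card_fin]; exact hdim))

theorem mem_biCone_iff {ι κ : Type} {Z : Set (BiProj ι κ)} {x : ι → ℂ} {h : κ → ℂ} (hx : x ≠ 0)
    (hh : h ≠ 0) : Sum.elim x h ∈ (biQuotient ι κ).cone Z ↔
      (⟨ProjSpace.mk x hx, ProjSpace.mk h hh⟩ : BiProj ι κ) ∈ Z := by
  constructor
  · rintro ⟨⟨p, q⟩, hpq, t, ht, heq⟩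
    have h1 : x = t false • p.rep := funext fun i => congrFun heq (Sum.inl i)
    have h2 : h = t true • q.rep := funext fun i => congrFun heq (Sum.inr i)
    rwa [(ProjSpace.mk_eq_iff hx p).mpr ⟨_, ht _, h1⟩, (ProjSpace.mk_eq_iff hh q).mpr ⟨_, ht _, h2⟩]
  · intro hZ
    obtain ⟨s, hs, hxs⟩ := ProjSpace.exists_rep_mk x hx
    obtain ⟨t, ht, hht⟩ := ProjSpace.exists_rep_mk h hh
    refine ⟨_, hZ, fun b => if b then t else s, fun b => by cases b <;> simpa, ?_⟩
    ext (i | i)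
    · exact congrFun hxs i
    · exact congrFun hht i

theorem ne_zero_of_mem_biCone {ι κ : Type} {Z : Set (BiProj ι κ)} {x : ι → ℂ} {h : κ → ℂ}
    (hZ : Sum.elim x h ∈ (biQuotient ι κ).cone Z) : x ≠ 0 ∧ h ≠ 0 := by
  obtain ⟨i, hi, hne⟩ := TorusQuotient.exists_ne_of_mem_cone hZ false
  obtain ⟨j, hj, hne'⟩ := TorusQuotient.exists_ne_of_mem_cone hZ true
  constructor
  · rcases i with i | i
    · exact fun h0 => hne (congrFun h0 i)
    · cases hi
  · rcases j with j | j
    · cases hj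
    · exact fun h0 => hne' (congrFun h0 j)

/-- The pairs of a critical point and its matrix. -/
def criticalPairs (V : Set (ProjSpace (Fin n))) : Set (BiProj (Fin n) (Sym2 (Fin n))) :=
  {x | IsCriticalPoint V x.snd x.fst}

/-- The codimension condition on `V`, with its dimension named. -/
structure HasCodim (V : Set (ProjSpace (Fin n))) (c D : ℕ) : Prop where
  dim_eq : topologicalKrullDim V = D
  add_eq : c + (D + 1) = n

theorem HasCodim.mem_regularLocus_iff {D : ℕ} (hV : HasCodim V c D) {p : ProjSpace (Fin n)} :
    p ∈ regularLocus V ↔ p ∈ V ∧ c + Module.finrank ℂ (tangentSpace V p.rep) = n := by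
  rw [regularLocus, Set.mem_ofPred_eq, hV.dim_eq]
  refine and_congr_right fun _ => ?_
  have : ((Module.finrank ℂ (tangentSpace V p.rep) : ℕ) : WithBot ℕ∞) = (D : WithBot ℕ∞) + 1 ↔
    Module.finrank ℂ (tangentSpace V p.rep) = D + 1 := by norm_cast
  rw [this]
  have := hV.add_eq
  omega

theorem HasCodim.mk_mem_regular_iff {D : ℕ} (hV : HasCodim V c D) {x : Fin n → ℂ} (hx : x ≠ 0) :
    ProjSpace.mk x hx ∈ regularLocus V \ isotropicQuadric n ↔
      x ∈ affineCone V ∧ c + Module.finrank ℂ (tangentSpace V x) = n ∧ x ⬝ᵥ x ≠ 0 := by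
  obtain ⟨t, ht, hxt⟩ := ProjSpace.exists_rep_mk x hx
  have h1 : x ∈ affineCone V ↔ ProjSpace.mk x hx ∈ V := ⟨fun h => h.2, fun h => ⟨hx, h⟩⟩
  rw [h1, Set.mem_sdiff, hV.mem_regularLocus_iff, and_assoc]
  refine and_congr_right fun _ => ?_
  conv_rhs => rw [hxt, tangentSpace_smul ht]
  refine and_congr_right fun _ => ?_
  rw [smul_dotProduct, dotProduct_smul]
  simp [isotropicQuadric, ht]

theorem HasCodim.mem_cone_criticalPairs_iff {D : ℕ} (hV : HasCodim V c D) {x : Fin n → ℂ}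
    {h : Sym2 (Fin n) → ℂ} : Sum.elim x h ∈ (biQuotient _ _).cone (criticalPairs V) ↔
      h ≠ 0 ∧ x ∈ affineCone V ∧ c + Module.finrank ℂ (tangentSpace V x) = n ∧ x ⬝ᵥ x ≠ 0 ∧
        h ∈ rayleighSpace (tangentSpace V x) x := by
  by_cases hx : x = 0
  · subst hx
    exact ⟨fun h => absurd rfl (ne_zero_of_mem_biCone h).1, fun h => by simp at h⟩
  by_cases hh : h = 0
  · subst hh
    exact ⟨fun h => absurd rfl (ne_zero_of_mem_biCone h).2, fun h => by simp at h⟩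
  rw [mem_biCone_iff hx hh]
  change IsCriticalPoint V _ _ ↔ _
  rw [isCriticalPoint_iff, hV.mk_mem_regular_iff hx]
  obtain ⟨t, ht, hxt⟩ := ProjSpace.exists_rep_mk x hx
  obtain ⟨s, hs, hhs⟩ := ProjSpace.exists_rep_mk h hh
  have : h ∈ rayleighSpace (tangentSpace V x) x ↔ (ProjSpace.mk h hh).rep ∈
      rayleighSpace (tangentSpace V (ProjSpace.mk x hx).rep) (ProjSpace.mk x hx).rep := by
    conv_lhs => rw [hxt, hhs, tangentSpace_smul ht, rayleighSpace_smul _ ht]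
    exact Submodule.smul_mem_iff _ hs
  rw [this]
  simp only [ne_eq, hh, not_false_eq_true, true_and, and_assoc]

section Incidence

variable {K L : Type} [Field K] [Algebra ℂ K] [Field L] [Algebra K L]

/-- The pair of a point `ξ` and the combination with coefficients `t` of its frame. -/
def incidencePoint (f : Fin c → MvPolynomial (Fin n) ℂ) (i : Fin n) (ξ : Fin n → K)
    (t : Option (Fin c) ⊕ Sym2 {j // j ≠ i} → L) : Fin n ⊕ Sym2 (Fin n) → L :=
  Sum.elim (fun k => algebraMap K L (ξ k)) fun z =>
    ∑ s, t s * algebraMap K L (rayleighFrame ξ (fun j => gradient ξ (f j)) i s z)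

/-- The polynomial whose value at a point and coefficients is the value of `F` at the
corresponding pair. -/
def incidencePullback (f : Fin c → MvPolynomial (Fin n) ℂ) (i : Fin n)
    (F : MvPolynomial (Fin n ⊕ Sym2 (Fin n)) ℂ) :
    MvPolynomial ((Option (Fin c) ⊕ Sym2 {j // j ≠ i}) ⊕ Fin n) ℂ :=
  aeval (Sum.elim (fun k => X (Sum.inr k)) fun z => ∑ s, X (Sum.inl s) * rename Sum.inr
    (rayleighFrame (R := MvPolynomial (Fin n) ℂ) X (fun j k => pderiv k (f j)) i s z)) F

theorem aeval_incidencePullback [Algebra ℂ L] [IsScalarTower ℂ K L]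
    (f : Fin c → MvPolynomial (Fin n) ℂ) (i : Fin n) (F : MvPolynomial (Fin n ⊕ Sym2 (Fin n)) ℂ)
    (ξ : Fin n → K) (t : Option (Fin c) ⊕ Sym2 {j // j ≠ i} → L) :
    aeval (Sum.elim t fun k => algebraMap K L (ξ k)) (incidencePullback f i F) =
      aeval (incidencePoint f i ξ t) F := by
  rw [incidencePullback, ← AlgHom.comp_apply]
  congr 1
  ext (k | z)
  · simp [incidencePoint]
  · have h : ∀ p : MvPolynomial (Fin n) ℂ,
        aeval (fun k => algebraMap K L (ξ k)) p = algebraMap K L (aeval ξ p) := fun p =>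
      (aeval_algebraMap_apply L ξ p)
    simp only [AlgHom.comp_apply, aeval_X, Sum.elim_inr, map_sum, map_mul, Sum.elim_inl,
      aeval_rename, incidencePoint]
    refine Finset.sum_congr rfl fun s _ => ?_
    rw [show (Sum.elim t fun k => algebraMap K L (ξ k)) ∘ Sum.inr =
      fun k => algebraMap K L (ξ k) from rfl, h]
    congr 2
    refine (map_rayleighFrame (aeval ξ : MvPolynomial (Fin n) ℂ →ₐ[ℂ] K).toRingHom _ _ i s z).trans ?_
    congr 1
    ext k
    exact aeval_X ξ k

theorem aeval_sumAlgEquiv {σ τ : Type} [Algebra ℂ L] [IsScalarTower ℂ K L] (ξ : σ → K) (t : τ → L)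
    (G : MvPolynomial (τ ⊕ σ) ℂ) :
    aeval t (map (aeval ξ : MvPolynomial σ ℂ →ₐ[ℂ] K).toRingHom (sumAlgEquiv ℂ τ σ G)) =
      aeval (Sum.elim t fun k => algebraMap K L (ξ k)) G := by
  induction G using MvPolynomial.induction_on with
  | C a =>
    rw [sumAlgEquiv_C_inl, map_C, aeval_C, aeval_C, IsScalarTower.algebraMap_apply ℂ K L]
    exact congrArg _ (aeval_C ξ a)
  | add p q hp hq => simp only [map_add, hp, hq]
  | mul_X p j hp =>
    rw [map_mul, map_mul, map_mul, hp, map_mul, aeval_X]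
    congr 1
    rcases j with j | j
    · rw [sumAlgEquiv_X_inl, map_X, aeval_X, Sum.elim_inl]
    · rw [sumAlgEquiv_X_inr, map_C, aeval_C, Sum.elim_inr]
      exact congrArg _ (aeval_X ξ j)

/-- Generic coefficients over a generic point of `S` form a generic point of the product of `S`
with affine space. -/
theorem aeval_sumElim_eq_zero_iff {σ τ : Type} [Algebra ℂ L] [IsScalarTower ℂ K L]
    {S : Set (σ → ℂ)} {ξ : σ → K} (hξ : ∀ f, aeval ξ f = 0 ↔ f ∈ vanishingIdeal ℂ S)
    {t : τ → L} (ht : AlgebraicIndependent K t) (G : MvPolynomial (τ ⊕ σ) ℂ) :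
    aeval (Sum.elim t fun k => algebraMap K L (ξ k)) G = 0 ↔
      ∀ x ∈ S, ∀ y : τ → ℂ, eval (Sum.elim y x) G = 0 := by
  -- As a polynomial in the independent t over K, G vanishes only if its coefficients vanish at ξ,
  -- that is, on all of S.
  rw [← aeval_sumAlgEquiv, (injective_iff_map_eq_zero' _).mp ht]
  have h2 : ∀ x : σ → ℂ, (∀ y : τ → ℂ, eval (Sum.elim y x) G = 0) ↔
      map (aeval x : MvPolynomial σ ℂ →ₐ[ℂ] ℂ).toRingHom (sumAlgEquiv ℂ τ σ G) = 0 := by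
    intro x
    have : ∀ y : τ → ℂ, eval (Sum.elim y x) G =
        eval y (map (aeval x : MvPolynomial σ ℂ →ₐ[ℂ] ℂ).toRingHom (sumAlgEquiv ℂ τ σ G)) :=
      fun y => (aeval_sumAlgEquiv (K := ℂ) (L := ℂ) x y G).symm
    simp only [this]
    exact ⟨fun h => MvPolynomial.funext fun y => by rw [h, map_zero], fun h y => by rw [h, map_zero]⟩
  simp only [h2]
  simp only [MvPolynomial.ext_iff, coeff_map, coeff_zero]
  constructor
  · intro h x hx m
    exact (hξ _).mp (h m) x hx
  · intro h m
    exact (hξ _).mpr fun x hx => h x hx m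

end Incidence

end

/-! ### The generic point of the correspondence and its transcendence degree. -/

section

variable {n c D : ℕ} {V : Set (ProjSpace (Fin n))} {K L : Type} [Field K] [Algebra ℂ K]
  {ξ : Fin n → K}

/-- Homogeneous equations `f` of `V` whose gradients are independent at the generic point `ξ`, and
a polynomial `g` outside the ideal of `V` where they are independent at regular nonisotropic
points. -/
structure GenericFrame (V : Set (ProjSpace (Fin n))) (ξ : Fin n → K)
    (f : Fin c → MvPolynomial (Fin n) ℂ) (d : Fin c → ℕ) (g : MvPolynomial (Fin n) ℂ) : Prop where
  mem : ∀ j, f j ∈ vanishingIdeal ℂ (affineCone V)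
  homogeneous : ∀ j, (f j).IsHomogeneous (d j)
  independent : LinearIndependent K fun j => gradient ξ (f j)
  notMem : g ∉ vanishingIdeal ℂ (affineCone V)
  regular : ∀ x ∈ affineCone V, eval x g ≠ 0 →
    (LinearIndependent ℂ fun j => gradient x (f j)) ∧
      c + Module.finrank ℂ (tangentSpace V x) = n ∧ x ⬝ᵥ x ≠ 0

theorem dotProduct_self_ne_zero_of_generic
    (hξ : ∀ f, aeval ξ f = 0 ↔ f ∈ vanishingIdeal ℂ (affineCone V))
    (hVQ : ¬ V ⊆ isotropicQuadric n) : ξ ⬝ᵥ ξ ≠ 0 := by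
  obtain ⟨p, hp, hpQ⟩ := Set.not_subset.mp hVQ
  intro h
  apply hpQ
  have h1 := (hξ (∑ k, X k * X k)).mp (by simpa [dotProduct] using h) _ (rep_mem_affineCone hp)
  simpa [isotropicQuadric, dotProduct] using h1

theorem exists_genericFrame [Algebra.IsAlgebraic (Algebra.adjoin ℂ (Set.range ξ)) K]
    (hV : HasCodim V c D) (hξ : ∀ f, aeval ξ f = 0 ↔ f ∈ vanishingIdeal ℂ (affineCone V))
    (hD : trRank ℂ (Set.range ξ) = (D + 1 : ℕ)) (hVQ : ¬ V ⊆ isotropicQuadric n) :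
    ∃ (f : Fin c → MvPolynomial (Fin n) ℂ) (d : Fin c → ℕ) (g : MvPolynomial (Fin n) ℂ),
      GenericFrame V ξ f d g := by
  obtain ⟨f, d, g, hf, hd, hind, hg, hgx⟩ := exists_generic_gradients hξ hD hV.add_eq
  -- The new factor excludes the isotropic points; it is nonzero at ξ because V is not contained in
  -- the quadric.
  refine ⟨f, d, g * ∑ k, X k * X k, hf, hd, hind, fun h => ?_, fun x hx hne => ?_⟩
  · rw [← hξ, map_mul, mul_eq_zero, hξ] at h
    refine h.elim hg fun h => dotProduct_self_ne_zero_of_generic hξ hVQ ?_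
    simpa [dotProduct] using h
  · rw [map_mul] at hne
    have h1 := hgx x (left_ne_zero_of_mul hne)
    refine ⟨h1, ?_, ?_⟩
    · have h2 := le_card_add_finrank_tangentSpace hξ hD hV.add_eq hx
      have h3 := (card_add_finrank_jacobianKernel_le hf h1).2
      rw [Fintype.card_fin] at h3
      exact le_antisymm h3 h2
    · simpa [dotProduct] using right_ne_zero_of_mul hne

namespace GenericFrame

variable {f : Fin c → MvPolynomial (Fin n) ℂ} {d : Fin c → ℕ} {g : MvPolynomial (Fin n) ℂ}

/-- The regular nonisotropic locus contains the nonvanishing locus of a homogeneous polynomial. -/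
theorem exists_homogeneous (hG : GenericFrame V ξ f d g) :
    ∃ (e : ℕ) (g' : MvPolynomial (Fin n) ℂ), g'.IsHomogeneous e ∧
      g' ∉ vanishingIdeal ℂ (affineCone V) ∧ ∀ x ∈ affineCone V, eval x g' ≠ 0 →
        c + Module.finrank ℂ (tangentSpace V x) = n ∧ x ⬝ᵥ x ≠ 0 := by
  obtain ⟨e, he⟩ : ∃ e, homogeneousComponent e g ∉ vanishingIdeal ℂ (affineCone V) := by
    by_contra! h
    refine hG.notMem ?_
    rw [← sum_homogeneousComponent g]
    exact Ideal.sum_mem _ fun e _ => h e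
  refine ⟨e, _, homogeneousComponent_isHomogeneous e g, he, fun x hx hne => ?_⟩
  -- If a component of g is nonzero at x, then g itself is nonzero at some multiple of x.
  have := mt (forall_torus_eval_eq_zero_iff (γ := fun _ : Fin n => ()) unitDegreeEquiv
    (fun _ => unitDegreeEquiv_one ()) x g).mp (by push Not; exact ⟨e, hne⟩)
  push Not at this
  obtain ⟨t, ht, htx⟩ := this
  obtain ⟨-, h1, h2⟩ := hG.regular _ (smul_mem_affineCone hx (ht ())) htx
  rw [tangentSpace_smul (ht ())] at h1
  refine ⟨h1, fun h0 => h2 ?_⟩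
  rw [smul_dotProduct, dotProduct_smul, h0, smul_zero, smul_zero]

theorem linearIndependent (hG : GenericFrame V ξ f d g)
    (hξ : ∀ f, aeval ξ f = 0 ↔ f ∈ vanishingIdeal ℂ (affineCone V))
    (hVQ : ¬ V ⊆ isotropicQuadric n) {i : Fin n} (hi : ξ i ≠ 0) :
    LinearIndependent K (rayleighFrame ξ (fun j => gradient ξ (f j)) i) := by
  have : CharZero K := charZero_of_injective_algebraMap (algebraMap ℂ K).injective
  exact linearIndependent_rayleighFrame hi (dotProduct_self_ne_zero_of_generic hξ hVQ)
    (fun j => gradient_dotProduct_self (hG.homogeneous j) ((hξ _).mpr (hG.mem j))) hG.independent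

variable [Field L] [Algebra K L] [Algebra ℂ L] [IsScalarTower ℂ K L]

/-- A generic combination of the frame over the generic point of `V` is a generic point of the
cone over the critical pairs. -/
theorem aeval_incidencePoint_eq_zero_iff (hG : GenericFrame V ξ f d g) (hV : HasCodim V c D)
    (hξ : ∀ f, aeval ξ f = 0 ↔ f ∈ vanishingIdeal ℂ (affineCone V))
    {i : Fin n} (hi : ξ i ≠ 0) {t : Option (Fin c) ⊕ Sym2 {j // j ≠ i} → L}
    (ht : AlgebraicIndependent K t) (F : MvPolynomial (Fin n ⊕ Sym2 (Fin n)) ℂ) :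
    aeval (incidencePoint f i ξ t) F = 0 ↔
      F ∈ vanishingIdeal ℂ ((biQuotient _ _).cone (criticalPairs V)) := by
  rw [← aeval_incidencePullback]
  have hev : ∀ {c' : ℕ} (f' : Fin c' → MvPolynomial (Fin n) ℂ) (i' : Fin n) x y,
      eval (Sum.elim y x) (incidencePullback f' i' F) = eval (incidencePoint f' i' x y) F :=
    fun f' i' x y => aeval_incidencePullback (K := ℂ) (L := ℂ) f' i' F x y
  have hgi : aeval ξ (g * X i) ≠ 0 := by
    rw [map_mul, aeval_X]
    exact mul_ne_zero (fun h => hG.notMem ((hξ g).mp h)) hi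
  constructor
  · intro hF v hv
    rw [aeval_sumElim_eq_zero_iff hξ ht] at hF
    obtain ⟨p, h, rfl⟩ : ∃ p h, v = Sum.elim p h := ⟨_, _, (Sum.elim_comp_inl_inr v).symm⟩
    obtain ⟨hh, hp, hpdim, hpp, hph⟩ := hV.mem_cone_criticalPairs_iff.mp hv
    obtain ⟨i', hi'⟩ := Function.ne_iff.mp hp.1
    -- The frame from f may degenerate at p, so h is written in a frame from equations f' adapted to
    -- p, with coefficients y that are kept fixed while the base point moves. Where g X_i ≠ 0 the
    -- moving matrix also lies in the span of the frame from f, so F vanishes there. Since g X_i is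
    -- nonzero at the generic point, F vanishes along the whole cone, in particular at p.
    obtain ⟨r, f', d', hf', hd', hind', hr⟩ := exists_independent_gradients
      (fun f hf d => homogeneousComponent_mem_vanishingIdeal (V := V) hf d) p
    rw [Fintype.card_fin, ← tangentSpace_eq] at hr
    obtain rfl : r = c := by omega
    rw [rayleighSpace_tangentSpace_eq_span hf' hd' hp hind' hpdim hpp hi',
      Submodule.mem_span_range_iff_exists_fun] at hph
    obtain ⟨y, hy⟩ := hph
    let G : MvPolynomial (Fin n) ℂ :=
      aeval (Sum.elim (fun s => C (y s)) X) (incidencePullback f' i' F)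
    have hGx : ∀ x, eval x G = eval (incidencePoint f' i' x y) F := by
      intro x
      rw [← hev, eval_aeval]
      congr 2
      ext (s | k) <;> simp
    have hmul : G * (g * X i) ∈ vanishingIdeal ℂ (affineCone V) := by
      intro x hx
      change eval x _ = 0
      rw [map_mul, mul_eq_zero, or_iff_not_imp_right, map_mul, eval_X]
      intro hne
      obtain ⟨h1, h2, h3⟩ := hG.regular x hx (left_ne_zero_of_mul hne)
      have h4 : ∑ s, y s • rayleighFrame x (fun j => gradient x (f' j)) i' s ∈
          rayleighSpace (tangentSpace V x) x := Submodule.sum_mem _ fun s _ =>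
        Submodule.smul_mem _ _ (rayleighFrame_gradient_mem hf' hd' hx i' s)
      rw [rayleighSpace_tangentSpace_eq_span hG.mem hG.homogeneous hx h1 h2 h3
        (right_ne_zero_of_mul hne), Submodule.mem_span_range_iff_exists_fun] at h4
      obtain ⟨y', hy'⟩ := h4
      rw [hGx, ← hF x hx y', hev]
      congr 2
      ext (k | z)
      · rfl
      · have := congrFun hy' z
        simp only [Finset.sum_apply, Pi.smul_apply, smul_eq_mul] at this
        exact this.symm
    rw [← hξ, map_mul, mul_eq_zero, or_iff_left hgi, hξ] at hmul
    have := hmul p hp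
    change eval p G = 0 at this
    rw [hGx] at this
    change eval _ F = 0
    rw [← this]
    congr 2
    ext (k | z)
    · rfl
    · rw [← hy]
      simp [incidencePoint]
  · intro hF
    -- The extra factors keep only honest critical pairs: g X_i ≠ 0 makes the frame independent, and
    -- then the nonzero first coefficient makes the matrix nonzero. They are nonzero at the generic
    -- point, so they can be cancelled.
    have h1 : aeval (Sum.elim t fun k => algebraMap K L (ξ k)) (incidencePullback f i F *
        (rename Sum.inr (g * X i) * X (Sum.inl (Sum.inl none)))) = 0 := by
      rw [aeval_sumElim_eq_zero_iff hξ ht]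
      intro x hx y
      rw [map_mul, mul_eq_zero, or_iff_not_imp_right, map_mul, eval_X, eval_rename, hev]
      intro hne
      have hne1 := left_ne_zero_of_mul hne
      change eval x (g * X i) ≠ 0 at hne1
      rw [map_mul, eval_X] at hne1
      have hy : y (Sum.inl none) ≠ 0 := right_ne_zero_of_mul hne
      obtain ⟨h1, h2, h3⟩ := hG.regular x hx (left_ne_zero_of_mul hne1)
      have hlin := linearIndependent_rayleighFrame (right_ne_zero_of_mul hne1) h3
        (fun j => gradient_dotProduct_self (hG.homogeneous j) (hG.mem j x hx)) h1
      refine hF _ (hV.mem_cone_criticalPairs_iff.mpr ⟨fun h0 => hy ?_, hx, h2, h3, ?_⟩)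
      · refine Fintype.linearIndependent_iff.mp hlin y ?_ _
        ext z
        have := congrFun h0 z
        simpa using this
      · have h4 : ∑ s, y s • rayleighFrame x (fun j => gradient x (f j)) i s ∈
            rayleighSpace (tangentSpace V x) x := Submodule.sum_mem _ fun s _ =>
          Submodule.smul_mem _ _ (rayleighFrame_gradient_mem hG.mem hG.homogeneous hx i s)
        have h5 : (fun z => ∑ s, y s * algebraMap ℂ ℂ (rayleighFrame x
            (fun j => gradient x (f j)) i s z)) =
            ∑ s, y s • rayleighFrame x (fun j => gradient x (f j)) i s :=
          _root_.funext fun z => by rw [Finset.sum_apply]; rfl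
        rw [h5]
        exact h4
    rw [map_mul, mul_eq_zero] at h1
    refine h1.resolve_right ?_
    rw [map_mul, aeval_rename, aeval_X]
    refine mul_ne_zero ?_ (ht.ne_zero _)
    rw [show (Sum.elim t fun k => algebraMap K L (ξ k)) ∘ Sum.inr =
      fun k => algebraMap K L (ξ k) from rfl]
    have : aeval (fun k => algebraMap K L (ξ k)) (g * X i) = algebraMap K L (aeval ξ (g * X i)) :=
      aeval_algebraMap_apply L ξ _
    rw [this, map_ne_zero]
    exact hgi

/-- The entries of the matrix and the coefficients t are K-linear combinations of each other, and K
is algebraic over the coordinates of ξ. So the rank is that of ξ together with t, and t is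
independent over K. -/
theorem trRank_incidencePoint [Algebra.IsAlgebraic (Algebra.adjoin ℂ (Set.range ξ)) K]
    (hG : GenericFrame V ξ f d g)
    (hξ : ∀ f, aeval ξ f = 0 ↔ f ∈ vanishingIdeal ℂ (affineCone V))
    (hVQ : ¬ V ⊆ isotropicQuadric n) {i : Fin n} (hi : ξ i ≠ 0)
    {t : Option (Fin c) ⊕ Sym2 {j // j ≠ i} → L} (ht : AlgebraicIndependent K t) :
    trRank ℂ (Set.range (incidencePoint f i ξ t)) = trRank ℂ (Set.range ξ) +
      (Fintype.card (Option (Fin c) ⊕ Sym2 {j // j ≠ i}) : ℕ) := by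
  have halg : ∀ (S : Set L), (∀ k, algebraMap K L (ξ k) ∈ S) → ∀ a : K,
      IsAlgebraic (Algebra.adjoin ℂ S) (algebraMap K L a) := by
    intro S hS a
    have hle : Algebra.adjoin ℂ (Set.range ξ) ≤
        (Algebra.adjoin ℂ S).comap (IsScalarTower.toAlgHom ℂ K L) := by
      rw [Algebra.adjoin_le_iff]
      rintro _ ⟨k, rfl⟩
      exact Algebra.subset_adjoin (hS k)
    let φ : Algebra.adjoin ℂ (Set.range ξ) →ₐ[ℂ] Algebra.adjoin ℂ S :=
      ((IsScalarTower.toAlgHom ℂ K L).comp (Subalgebra.val _)).codRestrict _ fun x => hle x.2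
    refine (Algebra.IsAlgebraic.isAlgebraic (R := Algebra.adjoin ℂ (Set.range ξ)) a).ringHom_of_comp_eq
      φ (algebraMap K L) (fun x y h => ?_) rfl
    exact Subtype.ext ((algebraMap K L).injective (congrArg Subtype.val h))
  apply le_antisymm
  · have h1 : trRank ℂ (Set.range fun k => algebraMap K L (ξ k)) ≤ trRank ℂ (Set.range ξ) := by
      refine trRank_le_of_specializes fun p hp => ?_
      have : aeval (fun k => algebraMap K L (ξ k)) p = algebraMap K L (aeval ξ p) :=
        aeval_algebraMap_apply L ξ p
      rw [this, hp, map_zero]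
    have h2 : (Set.range t).encard ≤ (Fintype.card (Option (Fin c) ⊕ Sym2 {j // j ≠ i}) : ℕ) := by
      rw [← Set.image_univ]
      refine (Set.encard_image_le _ _).trans_eq ?_
      rw [Set.encard_univ, ENat.card_eq_coe_fintype_card]
    refine le_trans ?_ ((trRank_union_le (k := ℂ) (Set.range fun k => algebraMap K L (ξ k))
      (Set.range t)).trans (add_le_add h1 h2))
    refine trRank_le_of_isAlgebraic ?_
    rintro _ ⟨k | z, rfl⟩
    · exact halg _ (fun k => Or.inl ⟨k, rfl⟩) _
    · rw [incidencePoint, Sum.elim_inr]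
      refine (Subalgebra.algebraicClosure (Algebra.adjoin ℂ (Set.range (fun k =>
        algebraMap K L (ξ k)) ∪ Set.range t)) L).sum_mem fun s _ => IsAlgebraic.mul ?_ ?_
      · exact isAlgebraic_algebraMap (⟨t s, Algebra.subset_adjoin (Or.inr ⟨s, rfl⟩)⟩ :
          Algebra.adjoin ℂ (Set.range (fun k => algebraMap K L (ξ k)) ∪ Set.range t))
      · exact halg _ (fun k => Or.inl ⟨k, rfl⟩) _
  · obtain ⟨T, hT, hcard, -⟩ := exists_algebraicIndependent_subfamily ℂ ξ
    have hind := hT.sumElim_comp ht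
    have h3 := trRank_range_of_algebraicIndependent hind
    have hlin := hG.linearIndependent hξ hVQ hi
    -- The frame is independent over K, so a K-linear left inverse recovers t from the entries of
    -- the matrix.
    obtain ⟨B, hB⟩ := LinearMap.exists_leftInverse_of_injective
      (Fintype.linearCombination K (rayleighFrame ξ (fun j => gradient ξ (f j)) i))
      (LinearMap.ker_eq_bot.mpr 
        (linearIndependent_iff_injective_fintypeLinearCombination.mp hlin))
    have hts : ∀ s, t s = ∑ z, incidencePoint f i ξ t (Sum.inr z) *
        algebraMap K L (B (Pi.single z 1) s) := by
      intro s
      have h8 : ∀ z, (fun j => if z = j then (1 : K) else 0) =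
          (Pi.single z 1 : Sym2 (Fin n) → K) := fun z =>
        _root_.funext fun j => by simp [Pi.single_apply, eq_comm]
      have h4 : ∀ s', ∑ z, rayleighFrame ξ (fun j => gradient ξ (f j)) i s' z *
          B (Pi.single z 1) s = if s' = s then 1 else 0 := by
        intro s'
        have h5 := congrFun (LinearMap.congr_fun hB (Pi.single s' 1)) s
        rw [LinearMap.comp_apply, Fintype.linearCombination_apply_single, one_smul,
          LinearMap.pi_apply_eq_sum_univ B] at h5
        simp only [h8, Finset.sum_apply, Pi.smul_apply, smul_eq_mul, LinearMap.id_apply,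
          Pi.single_apply, eq_comm (a := s)] at h5
        rw [← h5]
      simp only [incidencePoint, Sum.elim_inr, Finset.sum_mul]
      rw [Finset.sum_comm]
      have h6 : ∀ s', ∑ z, t s' * algebraMap K L (rayleighFrame ξ (fun j => gradient ξ (f j)) i s' z)
          * algebraMap K L (B (Pi.single z 1) s) = if s' = s then t s' else 0 := by
        intro s'
        simp only [mul_assoc, ← map_mul, ← Finset.mul_sum, ← map_sum, h4]
        split_ifs <;> simp
      simp [h6]
    rw [hcard]
    have h7 : (T.encard : ℕ∞) + (Fintype.card (Option (Fin c) ⊕ Sym2 {j // j ≠ i}) : ℕ) =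
        Nat.card ((Option (Fin c) ⊕ Sym2 {j // j ≠ i}) ⊕ T) := by
      rw [Nat.card_sum, add_comm, Nat.cast_add, Nat.card_eq_fintype_card, Set.encard,
        ENat.card_eq_coe_natCard]
    rw [h7, ← h3]
    have hξS : ∀ k, algebraMap K L (ξ k) ∈ Set.range (incidencePoint f i ξ t) :=
      fun k => ⟨Sum.inl k, rfl⟩
    refine trRank_le_of_isAlgebraic ?_
    rintro _ ⟨s | k, rfl⟩
    · rw [Sum.elim_inl, hts]
      refine (Subalgebra.algebraicClosure (Algebra.adjoin ℂ
        (Set.range (incidencePoint f i ξ t))) L).sum_mem fun z _ => IsAlgebraic.mul ?_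
        (halg _ hξS _)
      exact isAlgebraic_algebraMap (⟨_, Algebra.subset_adjoin ⟨Sum.inr z, rfl⟩⟩ :
        Algebra.adjoin ℂ (Set.range (incidencePoint f i ξ t)))
    · exact halg _ hξS _

end GenericFrame

end

/-! ### The correspondence over the regular nonisotropic locus. -/

section

section TangentLift

variable {R σ : Type} [CommRing R] [Fintype σ]

/-- The pairing of a vector with a multiple of the gradient of the Rayleigh quotient. -/
def rayleighPairing (q : σ → R) (H : Sym2 σ → R) (w : σ → R) : R :=
  ((q ⬝ᵥ q) • symMulVec q H - (q ⬝ᵥ symMulVec q H) • q) ⬝ᵥ w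

theorem map_rayleighPairing {S : Type} [CommRing S] (φ : R →+* S) (q : σ → R) (H : Sym2 σ → R)
    (w : σ → R) : φ (rayleighPairing q H w) =
      rayleighPairing (fun k => φ (q k)) (fun z => φ (H z)) fun k => φ (w k) := by
  simp [rayleighPairing, dotProduct, symMulVec_apply]

variable [DecidableEq σ] {c : ℕ}

/-- A multiple of `w` corrected in the columns `e` so as to be orthogonal to the rows of `A`. -/
def tangentLift (A : Matrix (Fin c) σ R) (e : Fin c → σ) (w : σ → R) : σ → R :=
  (A.submatrix id e).det • w - ((1 : Matrix σ σ R).submatrix id e).mulVec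
    ((A.submatrix id e).adjugate.mulVec (A.mulVec w))

/-- A square matrix times its adjugate is its determinant, so the correction cancels the determinant
times A w. No division occurs, which keeps the lift polynomial in A. -/
theorem mulVec_tangentLift (A : Matrix (Fin c) σ R) (e : Fin c → σ) (w : σ → R) :
    A.mulVec (tangentLift A e w) = 0 := by
  have h : A * (1 : Matrix σ σ R).submatrix id e = A.submatrix id e := by
    ext j k
    simp [Matrix.mul_apply, Matrix.one_apply]
  rw [tangentLift, Matrix.mulVec_sub, Matrix.mulVec_smul, Matrix.mulVec_mulVec, h,
    Matrix.mulVec_mulVec, Matrix.mul_adjugate, Matrix.smul_mulVec, Matrix.one_mulVec, sub_self]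

theorem tangentLift_eq_smul {A : Matrix (Fin c) σ R} {w : σ → R} (hw : A.mulVec w = 0)
    (e : Fin c → σ) : tangentLift A e w = (A.submatrix id e).det • w := by
  rw [tangentLift, hw, Matrix.mulVec_zero, Matrix.mulVec_zero, sub_zero]

theorem map_tangentLift {S : Type} [CommRing S] (φ : R →+* S) (A : Matrix (Fin c) σ R)
    (e : Fin c → σ) (w : σ → R) (k : σ) :
    φ (tangentLift A e w k) = tangentLift (A.map φ) e (fun a => φ (w a)) k := by
  have h1 : ∀ {m m' : Type} [Fintype m'] (M : Matrix m m' R) (v : m' → R) (j : m),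
      φ (M.mulVec v j) = (M.map φ).mulVec (fun a => φ (v a)) j := by
    intro m m' _ M v j
    simp [Matrix.mulVec, dotProduct]
  have h2 : ((A.submatrix id e).adjugate.map φ) = ((A.map φ).submatrix id e).adjugate := by
    have := RingHom.map_adjugate φ (A.submatrix id e)
    exact this
  have h3 : ((1 : Matrix σ σ R).submatrix id e).map φ = (1 : Matrix σ σ S).submatrix id e := by
    ext a b
    simp [Matrix.one_apply, apply_ite φ]
  have h4 : φ (A.submatrix id e).det = ((A.map φ).submatrix id e).det := by
    rw [RingHom.map_det]
    rfl
  simp only [tangentLift, Pi.sub_apply, Pi.smul_apply, smul_eq_mul, map_sub, map_mul, h1, h2, h3,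
    h4]

end TangentLift

variable {n c D : ℕ} {V : Set (ProjSpace (Fin n))}

theorem fst_mem_of_mem_closure (hV : IsClosed V) {x : BiProj (Fin n) (Sym2 (Fin n))}
    (hx : x ∈ closure (criticalPairs V)) : x.fst ∈ V := by
  rw [← hV.closure_eq, TorusQuotient.mem_closure_iff (Q := projQuotient (Fin n)), ← affineCone_eq]
  intro f hf
  rw [TorusQuotient.mem_closure_iff (Q := biQuotient _ _)] at hx
  have := hx (rename Sum.inl f) (by
    rintro _ ⟨y, hy, t, ht, rfl⟩
    change eval _ _ = 0
    rw [eval_rename]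
    exact hf _ (smul_mem_affineCone (rep_mem_affineCone hy.1.1) (ht false)))
  rw [eval_rename] at this
  exact this

/-- Over the regular nonisotropic points, the correspondence consists of critical pairs. -/
theorem HasCodim.mem_rayleighSpace_of_mem_closure (hV : HasCodim V c D)
    {p : ProjSpace (Fin n)} (hp : p ∈ regularLocus V \ isotropicQuadric n)
    {h : ProjSpace (Sym2 (Fin n))}
    (hx : (⟨p, h⟩ : BiProj (Fin n) (Sym2 (Fin n))) ∈ closure (criticalPairs V)) :
    h.rep ∈ rayleighSpace (tangentSpace V p.rep) p.rep := by
  obtain ⟨hpV, hpdim⟩ := hV.mem_regularLocus_iff.mp hp.1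
  obtain ⟨r, f, d, hf, hd, hind, hr⟩ := exists_independent_gradients
    (fun f hf d => homogeneousComponent_mem_vanishingIdeal (V := V) hf d) p.rep
  rw [Fintype.card_fin, ← tangentSpace_eq] at hr
  obtain rfl : r = c := by omega
  obtain ⟨e, he⟩ := exists_minor_ne_zero hind
  intro w hw
  let A : Matrix (Fin r) (Fin n) (MvPolynomial (Fin n ⊕ Sym2 (Fin n)) ℂ) :=
    Matrix.of fun j k => rename Sum.inl (pderiv k (f j))
  -- Tangent vectors vary with the point, so w is replaced by its polynomial lift. Where the minor
  -- is nonzero the lift is tangent, hence the minor times F vanishes on all critical pairs and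
  -- therefore on the closure. At p the lift is the minor times w.
  let F : MvPolynomial (Fin n ⊕ Sym2 (Fin n)) ℂ :=
    rayleighPairing (fun k => X (Sum.inl k)) (fun z => X (Sum.inr z))
      (tangentLift A e fun k => C (w k))
  have hA : ∀ x y, A.map (eval (Sum.elim x y)) = Matrix.of fun j => gradient x (f j) := by
    intro x y
    ext j k
    change eval _ (rename _ _) = _
    rw [eval_rename]
    rfl
  have hF : ∀ x y, eval (Sum.elim x y) F = rayleighPairing x y
      (tangentLift (Matrix.of fun j => gradient x (f j)) e w) := by
    intro x y
    rw [map_rayleighPairing]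
    simp only [map_tangentLift, hA, eval_X, eval_C, Sum.elim_inl, Sum.elim_inr]
  have hmem : rename Sum.inl (jacobianMinor f e) * F ∈
      vanishingIdeal ℂ ((biQuotient _ _).cone (criticalPairs V)) := by
    intro v hv
    obtain ⟨x, y, rfl⟩ : ∃ x y, v = Sum.elim x y := ⟨_, _, (Sum.elim_comp_inl_inr v).symm⟩
    obtain ⟨-, -, hdim, -, hy⟩ := hV.mem_cone_criticalPairs_iff.mp hv
    change eval _ _ = 0
    rw [map_mul, mul_eq_zero, or_iff_not_imp_left, eval_rename, hF, Sum.elim_comp_inl]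
    intro hne
    have hind' : LinearIndependent ℂ fun j => gradient x (f j) := by
      refine linearIndependent_of_minor_ne_zero (e := e) ?_
      rw [← aeval_jacobianMinor]
      exact hne
    refine hy _ ((mem_jacobianKernel_iff hf hind' (by rw [Fintype.card_fin]; exact hdim) _).mpr
      fun j => ?_)
    exact congrFun (mulVec_tangentLift (Matrix.of fun j => gradient x (f j)) e w) j
  rw [TorusQuotient.mem_closure_iff (Q := biQuotient _ _)] at hx
  have h1 := hx _ hmem
  change eval (Sum.elim p.rep h.rep) _ = 0 at h1
  have h2 : (Matrix.of fun j => gradient p.rep (f j)).mulVec w = 0 := by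
    ext j
    exact hw (f j) (hf j)
  rw [map_mul, eval_rename, hF, Sum.elim_comp_inl, tangentLift_eq_smul h2] at h1
  have h3 : eval p.rep (jacobianMinor f e) =
      ((Matrix.of fun j => gradient p.rep (f j)).submatrix id e).det :=
    aeval_jacobianMinor f e p.rep
  rw [h3] at h1
  have h4 : ((Matrix.of fun j => gradient p.rep (f j)).submatrix id e).det ≠ 0 := he
  rw [rayleighPairing, dotProduct_smul, smul_eq_mul] at h1
  simpa [h4] using h1

section Homogeneous

theorem isHomogeneous_symProd {σ : Type} {u v : σ → MvPolynomial σ ℂ} {a b : ℕ}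
    (hu : ∀ k, (u k).IsHomogeneous a) (hv : ∀ k, (v k).IsHomogeneous b) (z : Sym2 σ) :
    (symProd u v z).IsHomogeneous (a + b) := by
  induction z using Sym2.ind with
  | h j k =>
    rw [symProd_mk]
    refine ((hu j).mul (hv k)).add ?_
    rw [add_comm a b]
    exact (hv j).mul (hu k)

theorem isHomogeneous_koszulVector {σ : Type} [DecidableEq σ] (i j k : σ) :
    (koszulVector (X : σ → MvPolynomial σ ℂ) i j k).IsHomogeneous 1 := by
  have h : ∀ (l : σ) (P : Prop) [Decidable P],
      ((X l : MvPolynomial σ ℂ) * if P then 1 else 0).IsHomogeneous 1 := by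
    intro l P _
    split_ifs
    · rw [mul_one]; exact isHomogeneous_X ℂ l
    · rw [mul_zero]; exact isHomogeneous_zero σ ℂ 1
  exact (h i _).sub (h j _)

theorem exists_isHomogeneous_rayleighFrame {f : Fin c → MvPolynomial (Fin n) ℂ} {d : Fin c → ℕ}
    (hd : ∀ j, (f j).IsHomogeneous (d j)) (i : Fin n) (s : Option (Fin c) ⊕ Sym2 {j // j ≠ i}) :
    ∃ e, ∀ z, (rayleighFrame (R := MvPolynomial (Fin n) ℂ) X (fun j k => pderiv k (f j)) i s
      z).IsHomogeneous e := by
  rcases s with (_ | j) | w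
  · exact ⟨_, isHomogeneous_symProd (fun k => isHomogeneous_X ℂ k) fun k => isHomogeneous_X ℂ k⟩
  · exact ⟨_, isHomogeneous_symProd (fun k => isHomogeneous_X ℂ k) fun k => (hd j).pderiv⟩
  · induction w using Sym2.ind with
    | h j k =>
      exact ⟨_, isHomogeneous_symProd (isHomogeneous_koszulVector i j)
        (isHomogeneous_koszulVector i k)⟩

end Homogeneous

theorem eval_rayleighFrame (f : Fin c → MvPolynomial (Fin n) ℂ) (i : Fin n)
    (s : Option (Fin c) ⊕ Sym2 {j // j ≠ i}) (z : Sym2 (Fin n)) (x : Fin n → ℂ) :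
    eval x (rayleighFrame (R := MvPolynomial (Fin n) ℂ) X (fun j k => pderiv k (f j)) i s z) =
      rayleighFrame x (fun j => gradient x (f j)) i s z := by
  rw [map_rayleighFrame]
  simp only [eval_X]
  rfl

theorem span_range_smul_of_ne_zero {ι F E : Type} [Field F] [AddCommGroup E] [Module F E]
    {w : ι → F} (hw : ∀ i, w i ≠ 0) (v : ι → E) :
    Submodule.span F (Set.range fun i => w i • v i) = Submodule.span F (Set.range v) := by
  apply le_antisymm
  · rw [Submodule.span_le]
    rintro _ ⟨i, rfl⟩
    exact Submodule.smul_mem _ _ (Submodule.subset_span ⟨i, rfl⟩)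
  · rw [Submodule.span_le]
    rintro _ ⟨i, rfl⟩
    exact (Submodule.smul_mem_iff _ (hw i)).mp (Submodule.subset_span ⟨i, rfl⟩)

/-- The spaces of matrices for which a point is critical form an algebraic vector bundle over the
regular nonisotropic locus. -/
theorem HasCodim.isAlgebraicSubbundle (hV : HasCodim V c D) :
    IsAlgebraicSubbundle (regularLocus V \ isotropicQuadric n)
      (fun p => rayleighSpace (tangentSpace V p.rep) p.rep) ((n + 1).choose 2 - n + c + 1) := by
  intro p hp
  obtain ⟨hpV, hpdim⟩ := hV.mem_regularLocus_iff.mp hp.1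
  obtain ⟨r, f, d, hf, hd, hind, hr⟩ := exists_independent_gradients
    (fun f hf d => homogeneousComponent_mem_vanishingIdeal (V := V) hf d) p.rep
  rw [Fintype.card_fin, ← tangentSpace_eq] at hr
  obtain rfl : r = c := by omega
  obtain ⟨e, he⟩ := exists_minor_ne_zero hind
  rw [← aeval_jacobianMinor] at he
  obtain ⟨i, hi⟩ := Function.ne_iff.mp p.rep_ne_zero
  have hopen := TorusQuotient.isClosed_setOf_forall_eval_eq_zero (Q := projQuotient (Fin n))
    (X i * jacobianMinor f e)
  refine ⟨_, hopen.isOpen_compl, ?_, ?_⟩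
  · intro h
    have h1 := h 1 fun _ => one_ne_zero
    rw [map_mul, eval_X, mul_eq_zero] at h1
    simp only [Pi.one_apply, one_mul] at h1
    exact h1.elim hi he
  choose deg hdeg using exists_isHomogeneous_rayleighFrame hd i
  let M := ∑ s, deg s
  have hM : ∀ s, deg s ≤ M := fun s => Finset.single_le_sum (fun _ _ => Nat.zero_le _)
    (Finset.mem_univ s)
  let ε := (Fintype.equivFinOfCardEq (card_rayleighFrame r i)).symm
  -- The frame members have different degrees; powers of X_i bring them to the common degree M of
  -- the denominator, and X_i is nonzero on the open set.
  refine ⟨M, X i ^ M, fun j z => X i ^ (M - deg (ε j)) *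
    rayleighFrame (R := MvPolynomial (Fin n) ℂ) X (fun j k => pderiv k (f j)) i (ε j) z, ?_, ?_, ?_⟩
  · exact isHomogeneous_X_pow i M
  · intro j z
    have := (isHomogeneous_X_pow (R := ℂ) i (M - deg (ε j))).mul (hdeg (ε j) z)
    rwa [Nat.sub_add_cancel (hM _)] at this
  rintro q ⟨hqU, hq⟩
  obtain ⟨hqV, hqdim⟩ := hV.mem_regularLocus_iff.mp hq.1
  simp only [Set.mem_compl_iff, Set.mem_ofPred_eq, not_forall] at hqU
  obtain ⟨t, ht, hqt⟩ := hqU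
  rw [map_mul, eval_X, mul_eq_zero, not_or] at hqt
  have hqi : q.rep i ≠ 0 := right_ne_zero_of_mul hqt.1
  -- The open set only provides a nonzero minor at some multiple of the representative; homogeneity
  -- brings independence back to it.
  have hqind : LinearIndependent ℂ fun j => gradient q.rep (f j) := by
    have h1 : LinearIndependent ℂ fun j => gradient (t () • q.rep) (f j) := by
      refine linearIndependent_of_minor_ne_zero (e := e) ?_
      rw [← aeval_jacobianMinor]
      exact hqt.2
    simp only [gradient_smul (hd _)] at h1
    have h2 := h1.units_smul fun j => (Units.mk0 _ (pow_ne_zero (d j - 1) (ht ())))⁻¹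
    convert h2 using 1
    ext j : 1
    exact (inv_smul_smul₀ (pow_ne_zero (d j - 1) (ht ())) _).symm
  have hqq : q.rep ⬝ᵥ q.rep ≠ 0 := hq.2
  have hlin := linearIndependent_rayleighFrame hqi hqq (fun j => gradient_dotProduct_self (hd j)
    (hf j _ (rep_mem_affineCone hqV))) hqind
  have hspan := rayleighSpace_tangentSpace_eq_span hf hd (rep_mem_affineCone hqV) hqind hqdim hqq
    hqi
  let lam : Fin ((n + 1).choose 2 - n + r + 1) → ℂˣ := fun j =>
    Units.mk0 (q.rep i ^ (M - deg (ε j)) / q.rep i ^ M)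
      (div_ne_zero (pow_ne_zero _ hqi) (pow_ne_zero _ hqi))
  have hfun : (fun (j : Fin ((n + 1).choose 2 - n + r + 1)) (z : Sym2 (Fin n)) =>
      eval q.rep (X i ^ (M - deg (ε j)) * rayleighFrame (R := MvPolynomial (Fin n) ℂ) X
        (fun j k => pderiv k (f j)) i (ε j) z) / eval q.rep (X i ^ M)) = fun j =>
      (lam j : ℂ) • rayleighFrame q.rep (fun j => gradient q.rep (f j)) i (ε j) := by
    ext j z
    rw [map_mul, eval_rayleighFrame, map_pow, map_pow, eval_X]
    change _ = q.rep i ^ (M - deg (ε j)) / q.rep i ^ M * _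
    ring
  refine ⟨by simpa using pow_ne_zero M hqi, ?_, ?_⟩
  · rw [hfun]
    exact (hlin.comp ε ε.injective).units_smul lam
  · rw [hfun, span_range_smul_of_ne_zero (fun j => (lam j).ne_zero)]
    refine hspan.trans ?_
    congr 1
    exact (ε.surjective.range_comp _).symm

end

/-! ### Generic points of V and of the correspondence, and homogenization in one factor. -/

section

variable {n c D : ℕ} {V : Set (ProjSpace (Fin n))}

/-- An irreducible closed set has a generic point with coordinates in a field that is algebraic
over them. -/
theorem exists_generic_point (hVclosed : IsClosed V) (hVirr : IsIrreducible V)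
    (hV : HasCodim V c D) : ∃ (K : Type) (_ : Field K) (_ : Algebra ℂ K) (ξ : Fin n → K),
      (∀ f, aeval ξ f = 0 ↔ f ∈ vanishingIdeal ℂ (affineCone V)) ∧
      Algebra.IsAlgebraic (Algebra.adjoin ℂ (Set.range ξ)) K ∧
      trRank ℂ (Set.range ξ) = (D + 1 : ℕ) := by
  have hprime := TorusQuotient.isPrime_of_isIrreducible (Q := projQuotient (Fin n)) hVirr
  let ξ := (projQuotient (Fin n)).genericPoint V
  have hξ : ∀ f, aeval ξ f = 0 ↔ f ∈ vanishingIdeal ℂ ((projQuotient (Fin n)).cone V) :=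
    TorusQuotient.aeval_genericPoint_eq_zero_iff _ V
  refine ⟨_, inferInstance, inferInstance, ξ, ?_, ⟨fun a => ?_⟩, ?_⟩
  · rw [affineCone_eq]
    exact hξ
  · obtain ⟨x, y, hy, rfl⟩ := IsFractionRing.div_surjective
      (A := MvPolynomial (Fin n) ℂ ⧸ vanishingIdeal ℂ ((projQuotient (Fin n)).cone V)) a
    have h : ∀ x : MvPolynomial (Fin n) ℂ ⧸ vanishingIdeal ℂ ((projQuotient (Fin n)).cone V),
        IsAlgebraic (Algebra.adjoin ℂ (Set.range ξ)) (algebraMap _ (FractionRing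
          (MvPolynomial (Fin n) ℂ ⧸ vanishingIdeal ℂ ((projQuotient (Fin n)).cone V))) x) := by
      intro x
      obtain ⟨f, rfl⟩ := Ideal.Quotient.mk_surjective x
      rw [← TorusQuotient.aeval_genericPoint]
      exact isAlgebraic_algebraMap (⟨aeval ξ f, by
        rw [Algebra.adjoin_range_eq_range_aeval]; exact ⟨f, rfl⟩⟩ :
        Algebra.adjoin ℂ (Set.range ξ))
    rw [div_eq_mul_inv]
    exact (h x).mul (h y).inv
  · obtain ⟨d, hd, hrank, -⟩ := TorusQuotient.exists_topologicalKrullDim_eq hVclosed hVirr hξ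
    rw [hV.dim_eq] at hd
    have : D = d := by exact_mod_cast hd
    rw [hrank, this]
    simp

/-- The cone over the critical pairs has a generic point, whose coordinates have transcendence
degree one more than the dimension of the space of symmetric matrices. -/
theorem exists_generic_pair (hVclosed : IsClosed V) (hVirr : IsIrreducible V)
    (hV : HasCodim V c D) (hVQ : ¬ V ⊆ isotropicQuadric n) :
    ∃ (L : Type) (_ : Field L) (_ : Algebra ℂ L) (ξ : Fin n → L) (η : Sym2 (Fin n) → L)
      (e : ℕ) (g : MvPolynomial (Fin n) ℂ),
      (∀ F, aeval (Sum.elim ξ η) F = 0 ↔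
        F ∈ vanishingIdeal ℂ ((biQuotient _ _).cone (criticalPairs V))) ∧
      trRank ℂ (Set.range (Sum.elim ξ η)) = ((n + 1).choose 2 + 1 : ℕ) ∧
      g.IsHomogeneous e ∧ aeval ξ g ≠ 0 ∧
      ∀ x ∈ affineCone V, eval x g ≠ 0 →
        c + Module.finrank ℂ (tangentSpace V x) = n ∧ x ⬝ᵥ x ≠ 0 := by
  obtain ⟨K, _, _, ξ, hξ, _, hD⟩ := exists_generic_point hVclosed hVirr hV
  obtain ⟨f, d, g, hG⟩ := exists_genericFrame hV hξ hD hVQ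
  obtain ⟨e, g', hg', hgV, hreg⟩ := hG.exists_homogeneous
  obtain ⟨i, hi⟩ : ∃ i, ξ i ≠ 0 := by
    by_contra! h
    apply dotProduct_self_ne_zero_of_generic hξ hVQ
    simp [dotProduct, h]
  let τ := Option (Fin c) ⊕ Sym2 {j // j ≠ i}
  let L := FractionRing (MvPolynomial τ K)
  have ht : AlgebraicIndependent K fun s : τ => algebraMap (MvPolynomial τ K) L (X s) :=
    (MvPolynomial.algebraicIndependent_X τ K).map' (f := IsScalarTower.toAlgHom K _ L)
      (IsFractionRing.injective _ _)
  refine ⟨L, inferInstance, inferInstance, _, _, e, g',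
    hG.aeval_incidencePoint_eq_zero_iff hV hξ hi ht, ?_, hg', ?_, hreg⟩
  · refine (hG.trRank_incidencePoint hξ hVQ hi ht).trans ?_
    -- With N = (n+1 choose 2), the sum (D + 1) + (N − n + c + 1) is N + 1 because c + (D + 1) = n;
    -- the subtraction is exact as n ≤ N.
    rw [hD, card_rayleighFrame, ← Nat.cast_add]
    congr 1
    have h1 := hV.add_eq
    have h2 : n ≤ (n + 1).choose 2 := by
      rw [Nat.choose_succ_succ' n 1, Nat.choose_one_right]
      exact Nat.le_add_right _ _
    omega
  · have : aeval (fun k => algebraMap K L (ξ k)) g' = algebraMap K L (aeval ξ g') :=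
      aeval_algebraMap_apply L ξ g'
    rw [this, map_ne_zero]
    exact fun h => hgV ((hξ _).mp h)

theorem isPrime_of_generic {σ L : Type} [Field L] [Algebra ℂ L] {ζ : σ → L}
    {I : Ideal (MvPolynomial σ ℂ)} (hζ : ∀ F, aeval ζ F = 0 ↔ F ∈ I) : I.IsPrime := by
  have : I = RingHom.ker (aeval ζ : MvPolynomial σ ℂ →ₐ[ℂ] L) := by
    ext F
    exact (hζ F).symm
  rw [this]
  exact RingHom.ker_isPrime _

/-- An auxiliary coordinate is added to the second group, the homogenization is taken with respect
to it and to i, and the auxiliary coordinate is then set to 1. Thus only the first group gets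
divided. -/
theorem exists_partial_homogenization {σ κ : Type} (i : σ) (f : MvPolynomial (σ ⊕ κ) ℂ) :
    ∃ (N : ℕ) (F : MvPolynomial (σ ⊕ κ) ℂ),
      (∀ (K : Type) [Field K] [Algebra ℂ K] (v : σ → K) (h : κ → K), v i ≠ 0 →
        aeval (Sum.elim v h) F = v i ^ N * aeval (Sum.elim (fun j => v j / v i) h) f) ∧
      (∀ (K : Type) [Field K] [Algebra ℂ K] (v : σ → K) (h : κ → K), v i = 0 →
        aeval (Sum.elim v h) F = 0) := by
  let e : σ ⊕ κ → σ ⊕ Option κ := Sum.map id some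
  obtain ⟨N, F, hF, hF0⟩ := exists_homogenization (biGroup σ (Option κ))
    (fun b => if b then Sum.inr none else Sum.inl i) (rename e f)
  let s : σ ⊕ Option κ → MvPolynomial (σ ⊕ κ) ℂ :=
    Sum.elim (fun j => X (Sum.inl j)) fun o => o.elim 1 fun k => X (Sum.inr k)
  have hs : ∀ (K : Type) [Field K] [Algebra ℂ K] (v : σ → K) (h : κ → K),
      aeval (Sum.elim v h) (aeval s F) = aeval (Sum.elim v fun o => o.elim 1 h) F := by
    intro K _ _ v h
    rw [← AlgHom.comp_apply]
    congr 1
    ext (j | _ | k) <;> simp [s]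
  refine ⟨N, aeval s F, fun K _ _ v h hv => ?_, fun K _ _ v h hv => ?_⟩
  · rw [hs, hF K _ (fun b => by cases b; exacts [hv, one_ne_zero]), aeval_rename]
    simp only [Fintype.prod_bool]
    congr 1
    · simp
    · congr 2
      ext (j | k) <;> simp [e, biGroup]
  · rw [hs]
    exact hF0 K _ ⟨false, hv⟩

end

/-! ### The second projection in an affine chart of the first factor. -/

section Chart

variable {ι κ L : Type} [Field L] [Algebra ℂ L] {Z : Set (BiProj ι κ)} {ξ : ι → L} {η : κ → L}

/-- The specializations of the generic point in an affine chart of the first factor are the points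
of the cone in that chart. -/
theorem forall_chart_iff (hZ : IsClosed Z)
    (hζ : ∀ F, aeval (Sum.elim ξ η) F = 0 ↔ F ∈ vanishingIdeal ℂ ((biQuotient ι κ).cone Z))
    {i : ι} (hi : ξ i ≠ 0) {y : ι → ℂ} {h : κ → ℂ} (hh : h ≠ 0) :
    (∀ F, aeval (Sum.elim (fun j => ξ j / ξ i) η) F = 0 → eval (Sum.elim y h) F = 0) ↔
      y i = 1 ∧ Sum.elim y h ∈ (biQuotient ι κ).cone Z := by
  have hiff : ∀ f F : MvPolynomial (ι ⊕ κ) ℂ, ∀ N : ℕ,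
      (∀ (K : Type) [Field K] [Algebra ℂ K] (v : ι → K) (h : κ → K), v i ≠ 0 →
        aeval (Sum.elim v h) F = v i ^ N * aeval (Sum.elim (fun j => v j / v i) h) f) →
      (aeval (Sum.elim (fun j => ξ j / ξ i) η) f = 0 ↔
        F ∈ vanishingIdeal ℂ ((biQuotient ι κ).cone Z)) := by
    intro f F N hF
    rw [← hζ, hF L ξ η hi, mul_eq_zero, or_iff_right (pow_ne_zero N hi)]
  constructor
  · intro hy
    have hyi : y i = 1 := by
      have := hy (X (Sum.inl i) - 1) (by simp [hi])
      simpa [sub_eq_zero] using this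
    refine ⟨hyi, (TorusQuotient.mem_cone_iff_of_isClosed hZ ?_).mpr fun f hf => hy f ?_⟩
    · rintro (_ | _)
      · exact ⟨Sum.inl i, rfl, by simp [hyi]⟩
      · obtain ⟨k, hk⟩ := Function.ne_iff.mp hh
        exact ⟨Sum.inr k, rfl, hk⟩
    · obtain ⟨N, F, hF, hF0⟩ := exists_partial_homogenization i f
      rw [hiff f F N hF]
      intro v hv
      obtain ⟨x, h', rfl⟩ : ∃ x h', v = Sum.elim x h' := ⟨_, _, (Sum.elim_comp_inl_inr v).symm⟩
      by_cases hx : x i = 0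
      · exact hF0 ℂ x h' hx
      · rw [hF ℂ x h' hx]
        have hmem := TorusQuotient.smul_mem_cone hv (t := fun b => if b then 1 else (x i)⁻¹)
          (fun b => by cases b <;> simp [hx])
        have heq : (fun j => (fun b => if b then 1 else (x i)⁻¹) (biGroup ι κ j) *
            Sum.elim x h' j) = Sum.elim (fun j => x j / x i) h' := by
          ext (j | j)
          · simp [biGroup, div_eq_inv_mul]
          · simp [biGroup]
        rw [heq] at hmem
        rw [hf _ hmem, mul_zero]
  · rintro ⟨hyi, hy⟩ f hf
    obtain ⟨N, F, hF, hF0⟩ := exists_partial_homogenization i f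
    have h1 := (hiff f F N hF).mp hf _ hy
    rw [hF ℂ y h (by rw [hyi]; exact one_ne_zero), hyi] at h1
    simpa using h1

/-- If the second projection is generically finite, the coordinates of the generic point in an
affine chart are algebraic over those of its projection. -/
theorem isAlgebraic_chart [Finite ι] [Finite κ] (hZ : IsClosed Z) (hZirr : IsIrreducible Z)
    (hζ : ∀ F, aeval (Sum.elim ξ η) F = 0 ↔ F ∈ vanishingIdeal ℂ ((biQuotient ι κ).cone Z))
    (hrank : trRank ℂ (Set.range (Sum.elim ξ η)) = (Nat.card κ + 1 : ℕ))
    (hη : AlgebraicIndependent ℂ η) (k₀ : κ) {i : ι} (hi : ξ i ≠ 0) (j : ι) :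
    IsAlgebraic (Algebra.adjoin ℂ (Set.range η)) (ξ j / ξ i) := by
  obtain ⟨d, -, hd, hslice⟩ := TorusQuotient.exists_topologicalKrullDim_eq hZ hZirr hζ
  rw [hrank, Nat.cast_inj, Fintype.card_bool] at hd
  let ε : Bool → ι ⊕ κ := fun b => if b then Sum.inr k₀ else Sum.inl i
  have hs := hslice ε (fun b => by cases b <;> rfl)
    (fun b => by cases b; exacts [hi, hη.ne_zero k₀])
  set S := Set.range (TorusQuotient.slicePoint (biGroup ι κ) (Sum.elim ξ η) ε)
  -- The bihomogeneous slice has rank at most Nat.card κ − 1, the dimension of Z. Adjoining η k₀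
  -- recovers η and the affine coordinates from it, so together they have rank at most Nat.card κ,
  -- which the independent η already exhausts.
  have hT : trRank ℂ (Set.range η ∪ Set.range fun j => ξ j / ξ i) ≤ Nat.card κ := by
    have h1 : trRank ℂ (Set.range η ∪ Set.range fun j => ξ j / ξ i) ≤
        trRank ℂ (S ∪ {η k₀}) := by
      refine trRank_le_of_isAlgebraic ?_
      have hmem : ∀ a, a ∈ Algebra.adjoin ℂ (S ∪ {η k₀}) →
          IsAlgebraic (Algebra.adjoin ℂ (S ∪ {η k₀})) a := fun a ha =>
        isAlgebraic_algebraMap (⟨a, ha⟩ : Algebra.adjoin ℂ (S ∪ {η k₀}))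
      rintro _ (⟨k, rfl⟩ | ⟨j, rfl⟩)
      · apply hmem
        have : η k = η k / η k₀ * η k₀ := (div_mul_cancel₀ _ (hη.ne_zero k₀)).symm
        rw [this]
        exact Subalgebra.mul_mem _ (Algebra.subset_adjoin (Or.inl ⟨Sum.inr k, rfl⟩))
          (Algebra.subset_adjoin (Or.inr rfl))
      · exact hmem _ (Algebra.subset_adjoin (Or.inl ⟨Sum.inl j, rfl⟩))
    refine h1.trans ((trRank_union_le _ _).trans ?_)
    rw [Set.encard_singleton]
    refine (add_le_add_left hs 1).trans ?_
    have : d + 1 = Nat.card κ := by omega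
    rw [← this]
    push_cast
    exact le_rfl
  exact isAlgebraic_of_trRank_le hη Set.subset_union_left hT _ (Or.inr ⟨j, rfl⟩)

/-- A polynomial that does not vanish at the generic point does not vanish at the points over a
general point of the second factor. -/
theorem exists_forall_eval_ne_zero (hZ : IsClosed Z)
    (hζ : ∀ F, aeval (Sum.elim ξ η) F = 0 ↔ F ∈ vanishingIdeal ℂ ((biQuotient ι κ).cone Z))
    {i : ι} (hi : ξ i ≠ 0)
    (halg : ∀ j, IsAlgebraic (Algebra.adjoin ℂ (Set.range η)) (ξ j / ξ i))
    {g : MvPolynomial ι ℂ} {e : ℕ} (hg : g.IsHomogeneous e) (hgξ : aeval ξ g ≠ 0) :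
    ∃ b : MvPolynomial κ ℂ, b ≠ 0 ∧ ∀ y h, y i = 1 →
      Sum.elim y h ∈ (biQuotient ι κ).cone Z → eval h b ≠ 0 → eval y g ≠ 0 := by
  set x : ι → L := fun j => ξ j / ξ i with hx
  have hγ0 : aeval x g ≠ 0 := by
    have : x = (ξ i)⁻¹ • ξ := by
      ext j
      simp [hx, div_eq_inv_mul]
    rw [this, aeval_smul_of_isHomogeneous hg]
    exact mul_ne_zero (pow_ne_zero _ (inv_ne_zero hi)) hgξ
  have hγ : IsAlgebraic (Algebra.adjoin ℂ (Set.range η)) (aeval x g) := by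
    have hle : Algebra.adjoin ℂ (Set.range x) ≤ (Subalgebra.algebraicClosure
        (Algebra.adjoin ℂ (Set.range η)) L).restrictScalars ℂ := by
      rw [Algebra.adjoin_le_iff]
      rintro _ ⟨j, rfl⟩
      exact halg j
    refine hle ?_
    rw [Algebra.adjoin_range_eq_range_aeval]
    exact ⟨g, rfl⟩
  -- The value of g at the generic point satisfies a relation over η with nonzero constant term b.
  -- At a point over h where g vanishes the specialized relation reduces to b(h) = 0.
  obtain ⟨P, hP0, hP⟩ := exists_relation_of_isAlgebraic hγ hγ0
  refine ⟨P.coeff 0, fun h0 => hP0 (by rw [h0, map_zero]), fun y h hyi hy hb hgy => hb ?_⟩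
  have heval : ∀ (K : Type) [Field K] [Algebra ℂ K] (v : ι → K) (w : κ → K),
      aeval (Sum.elim v w) (P.eval₂ (rename Sum.inr : _ →ₐ[ℂ] MvPolynomial (ι ⊕ κ) ℂ).toRingHom
        (rename Sum.inl g)) =
      P.eval₂ (aeval w : MvPolynomial κ ℂ →ₐ[ℂ] K).toRingHom (aeval v g) := by
    intro K _ _ v w
    have h1 := Polynomial.hom_eval₂ P (rename Sum.inr : _ →ₐ[ℂ] MvPolynomial (ι ⊕ κ) ℂ).toRingHom
      (aeval (Sum.elim v w) : MvPolynomial (ι ⊕ κ) ℂ →ₐ[ℂ] K).toRingHom (rename Sum.inl g)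
    have h2 : (aeval (Sum.elim v w) : MvPolynomial (ι ⊕ κ) ℂ →ₐ[ℂ] K).toRingHom.comp
        (rename Sum.inr : _ →ₐ[ℂ] MvPolynomial (ι ⊕ κ) ℂ).toRingHom =
        (aeval w : MvPolynomial κ ℂ →ₐ[ℂ] K).toRingHom := by
      refine RingHom.ext fun p => ?_
      exact aeval_rename _ _ _
    have h3 : aeval (Sum.elim v w) (rename Sum.inl g) = aeval v g := aeval_rename _ _ _
    rw [h2] at h1
    refine h1.trans ?_
    exact congrArg (fun a =>
      P.eval₂ (aeval w : MvPolynomial κ ℂ →ₐ[ℂ] K).toRingHom a) h3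
  have h1 := (forall_chart_iff hZ hζ hi (ne_zero_of_mem_biCone hy).2).mpr ⟨hyi, hy⟩ _
    ((heval L x η).trans hP)
  have h2 := (heval ℂ y h).symm.trans h1
  have h3 : aeval y g = 0 := hgy
  rw [h3, Polynomial.eval₂_at_zero] at h2
  exact h2

end Chart

/-! ### Nonempty open sets of projective space. -/

section OpenSets

variable {κ : Type} [Nonempty κ]

/-- Since b need not be homogeneous, the open set consists of the points on whose orbit b is not
identically zero; a nonvanishing point of b is therefore reached only after rescaling the
representative. -/
theorem exists_isOpen_eval_ne_zero {b : MvPolynomial κ ℂ} (hb : b ≠ 0) :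
    ∃ U : Set (ProjSpace κ), IsOpen U ∧ U.Nonempty ∧
      ∀ h ∈ U, ∃ t : ℂ, t ≠ 0 ∧ eval (t • h.rep) b ≠ 0 := by
  have hcl := TorusQuotient.isClosed_setOf_forall_eval_eq_zero (Q := projQuotient κ) b
  refine ⟨_, hcl.isOpen_compl, ?_, fun h hh => ?_⟩
  · obtain ⟨k⟩ := ‹Nonempty κ›
    obtain ⟨v, hv⟩ : ∃ v, eval v (b * X k) ≠ 0 := by
      by_contra! hcon
      exact mul_ne_zero hb (X_ne_zero k) (MvPolynomial.funext fun v => by rw [hcon, map_zero])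
    rw [map_mul, eval_X] at hv
    have hv0 : v ≠ 0 := fun h => right_ne_zero_of_mul hv (congrFun h k)
    obtain ⟨t, ht, hvt⟩ := ProjSpace.exists_rep_mk v hv0
    refine ⟨ProjSpace.mk v hv0, fun h => left_ne_zero_of_mul hv ?_⟩
    rw [hvt]
    exact h (fun _ => t) fun _ => ht
  · simp only [Set.mem_compl_iff, Set.mem_ofPred_eq, not_forall] at hh
    obtain ⟨t, ht, h1⟩ := hh
    exact ⟨t (), ht (), h1⟩

theorem ProjSpace.isIrreducible_univ : IsIrreducible (Set.univ : Set (ProjSpace κ)) := by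
  have hbot : vanishingIdeal ℂ ((projQuotient κ).cone Set.univ) = ⊥ := by
    rw [eq_bot_iff]
    intro b hb
    by_contra hb0
    obtain ⟨U, -, ⟨h, hU⟩, hh⟩ := exists_isOpen_eval_ne_zero (b := b) hb0
    obtain ⟨t, ht, h1⟩ := hh h hU
    exact h1 (hb _ ⟨h, Set.mem_univ h, fun _ => t, fun _ => ht, rfl⟩)
  refine TorusQuotient.isIrreducible_of_isPrime (Q := projQuotient κ) ?_
  rw [hbot]
  exact Ideal.isPrime_bot

end OpenSets

/-! ### The general fibre of the second projection. -/

section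

variable {n c D : ℕ} {V : Set (ProjSpace (Fin n))}

/-- Over a general matrix the correspondence consists of critical points, of a constant finite
number. -/
theorem exists_general_fiber (hVclosed : IsClosed V) (hVirr : IsIrreducible V)
    (hV : HasCodim V c D) (hVQ : ¬ V ⊆ isotropicQuadric n) :
    ∃ (d : ℕ) (U : Set (ProjSpace (Sym2 (Fin n)))), IsOpen U ∧ U.Nonempty ∧ ∀ h ∈ U,
      {p | (⟨p, h⟩ : BiProj (Fin n) (Sym2 (Fin n))) ∈ closure (criticalPairs V)} =
        {p | IsCriticalPoint V h p} ∧
      {p | IsCriticalPoint V h p}.Finite ∧ {p | IsCriticalPoint V h p}.ncard = d := by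
  classical
  obtain ⟨p₀, hp₀⟩ := hVirr.nonempty
  obtain ⟨i₀, -⟩ := Function.ne_iff.mp p₀.rep_ne_zero
  have hne : Nonempty (Sym2 (Fin n)) := ⟨s(i₀, i₀)⟩
  obtain ⟨L, _, _, ξ, η, e, g, hζ, hrank, hg, hgξ, hreg⟩ := exists_generic_pair hVclosed hVirr hV hVQ
  have hprime := isPrime_of_generic hζ
  rw [← TorusQuotient.vanishingIdeal_cone_closure] at hζ
  have hZ : IsClosed (closure (criticalPairs V)) := isClosed_closure
  have hZirr : IsIrreducible (closure (criticalPairs V)) :=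
    (TorusQuotient.isIrreducible_of_isPrime hprime).closure
  have hsub : ∀ h p, IsCriticalPoint V h p →
      (⟨p, h⟩ : BiProj (Fin n) (Sym2 (Fin n))) ∈ closure (criticalPairs V) := fun h p hp =>
    subset_closure hp
  -- A relation among the H-coordinates means that the second projection is not dominant; general
  -- fibres are then empty and d = 0.
  by_cases hη : AlgebraicIndependent ℂ η
  swap
  · rw [algebraicIndependent_iff] at hη
    push Not at hη
    obtain ⟨b, hb, hb0⟩ := hη
    obtain ⟨U, hU, hUne, hUb⟩ := exists_isOpen_eval_ne_zero hb0
    refine ⟨0, U, hU, hUne, fun h hh => ?_⟩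
    have hempty : ∀ p, (⟨p, h⟩ : BiProj (Fin n) (Sym2 (Fin n))) ∉ closure (criticalPairs V) := by
      intro p hp
      obtain ⟨t, ht, htb⟩ := hUb h hh
      apply htb
      have h1 := (hζ (rename Sum.inr b)).mp (by rw [aeval_rename]; exact hb) _
        ⟨_, hp, fun _ => t, fun _ => ht, rfl⟩
      change eval _ _ = 0 at h1
      rw [eval_rename] at h1
      exact h1
    have h1 : {p | IsCriticalPoint V h p} = ∅ :=
      Set.eq_empty_iff_forall_notMem.mpr fun p hp => hempty p (hsub h p hp)
    rw [h1]
    exact ⟨Set.eq_empty_iff_forall_notMem.mpr hempty, Set.finite_empty, Set.ncard_empty _⟩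
  obtain ⟨i, hi⟩ : ∃ i, ξ i ≠ 0 := by
    by_contra! h0
    have h1 : ∀ k, (X (Sum.inl k) : MvPolynomial (Fin n ⊕ Sym2 (Fin n)) ℂ) ∈
        vanishingIdeal ℂ ((biQuotient _ _).cone (closure (criticalPairs V))) := fun k => by
      rw [← hζ, aeval_X, Sum.elim_inl, h0]
    obtain ⟨x, hx⟩ := hZirr.nonempty
    apply x.fst.rep_ne_zero
    ext k
    have := h1 k _ (TorusQuotient.rep_mem_cone hx)
    rwa [aeval_X] at this
  have hcard : Nat.card (Sym2 (Fin n)) = (n + 1).choose 2 := by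
    rw [Nat.card_eq_fintype_card, Sym2.card, Fintype.card_fin]
  have halg : ∀ i, ξ i ≠ 0 → ∀ j,
      IsAlgebraic (Algebra.adjoin ℂ (Set.range η)) (ξ j / ξ i) := fun i hi j =>
    isAlgebraic_chart hZ hZirr hζ (by rw [hrank, hcard]) hη s(i₀, i₀) hi j
  obtain ⟨d, b₀, hb₀, hfib⟩ := exists_generic_fiber_card (fun j => ξ j / ξ i) η hη (halg i hi)
  -- For every chart j that meets the correspondence, X_i g is nonzero at the points over a general
  -- h. So all points of a general fibre lie in the chart i, where they are counted, and over the
  -- good locus of V. Charts with ξ_j = 0 contain no point and get the dummy value 1.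
  have hbad : ∀ j, ∃ b : MvPolynomial (Sym2 (Fin n)) ℂ, b ≠ 0 ∧ (ξ j ≠ 0 → ∀ y h, y j = 1 →
      Sum.elim y h ∈ (biQuotient _ _).cone (closure (criticalPairs V)) → eval h b ≠ 0 →
        eval y (X i * g) ≠ 0) := by
    intro j
    by_cases hj : ξ j = 0
    · exact ⟨1, one_ne_zero, fun h => absurd hj h⟩
    · obtain ⟨b, hb, h⟩ := exists_forall_eval_ne_zero hZ hζ hj (halg j hj)
        ((isHomogeneous_X ℂ i).mul hg) (by rw [map_mul, aeval_X]; exact mul_ne_zero hi hgξ)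
      exact ⟨b, hb, fun _ => h⟩
  choose b hb hbad using hbad
  obtain ⟨U, hU, hUne, hUb⟩ := exists_isOpen_eval_ne_zero
    (mul_ne_zero hb₀ (Finset.prod_ne_zero_iff.mpr fun j (_ : j ∈ Finset.univ) => hb j))
  refine ⟨d, U, hU, hUne, fun h hh => ?_⟩
  obtain ⟨t, ht, htb⟩ := hUb h hh
  rw [map_mul, map_prod, mul_ne_zero_iff, Finset.prod_ne_zero_iff] at htb
  obtain ⟨hfin, hncard⟩ := hfib _ htb.1
  have hh0 : t • h.rep ≠ 0 := smul_ne_zero ht h.rep_ne_zero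
  simp only [forall_chart_iff hZ hζ hi hh0] at hfin hncard
  have hmk : ∀ (y : Fin n → ℂ) (hy : y ≠ 0),
      Sum.elim y (t • h.rep) ∈ (biQuotient _ _).cone (closure (criticalPairs V)) ↔
      (⟨ProjSpace.mk y hy, h⟩ : BiProj (Fin n) (Sym2 (Fin n))) ∈ closure (criticalPairs V) := by
    intro y hy
    rw [mem_biCone_iff hy hh0, (ProjSpace.mk_eq_iff hh0 h).mpr ⟨t, ht, rfl⟩]
  have hgood : ∀ p, (⟨p, h⟩ : BiProj (Fin n) (Sym2 (Fin n))) ∈ closure (criticalPairs V) →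
      p.rep i ≠ 0 ∧ IsCriticalPoint V h p := by
    intro p hp
    obtain ⟨j, hj⟩ := Function.ne_iff.mp p.rep_ne_zero
    have hξj : ξ j ≠ 0 := by
      intro h0
      have h1 := (hζ (X (Sum.inl j))).mp (by rw [aeval_X, Sum.elim_inl, h0]) _
        (TorusQuotient.rep_mem_cone hp)
      rw [aeval_X] at h1
      exact hj h1
    have hs : (p.rep j)⁻¹ ≠ 0 := inv_ne_zero hj
    have hy0 : (p.rep j)⁻¹ • p.rep ≠ 0 := smul_ne_zero hs p.rep_ne_zero
    have hyp : ProjSpace.mk _ hy0 = p := (ProjSpace.mk_eq_iff hy0 p).mpr ⟨_, hs, rfl⟩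
    have hy := hbad j hξj ((p.rep j)⁻¹ • p.rep) (t • h.rep) (inv_mul_cancel₀ hj)
      ((hmk _ hy0).mpr (by rw [hyp]; exact hp)) (htb.2 j (Finset.mem_univ j))
    rw [map_mul, eval_X, mul_ne_zero_iff] at hy
    have hyV : (p.rep j)⁻¹ • p.rep ∈ affineCone V :=
      smul_mem_affineCone (rep_mem_affineCone (fst_mem_of_mem_closure hVclosed hp)) hs
    obtain ⟨h1, h2⟩ := hreg _ hyV hy.2
    have h3 := (hV.mk_mem_regular_iff hy0).mpr ⟨hyV, h1, h2⟩
    rw [hyp] at h3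
    exact ⟨right_ne_zero_of_mul hy.1, isCriticalPoint_iff.mpr
      ⟨h3, hV.mem_rayleighSpace_of_mem_closure h3 hp⟩⟩
  have heq : {p | (⟨p, h⟩ : BiProj (Fin n) (Sym2 (Fin n))) ∈ closure (criticalPairs V)} =
      {p | IsCriticalPoint V h p} :=
    Set.Subset.antisymm (fun p hp => (hgood p hp).2) fun p hp => hsub h p hp
  -- Normalizing the i-th coordinate to 1 identifies the critical points with the affine fibre whose
  -- cardinality is d.
  let φ : ProjSpace (Fin n) → Fin n → ℂ := fun p => (p.rep i)⁻¹ • p.rep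
  have hinj : Set.InjOn φ {p | IsCriticalPoint V h p} := by
    intro p hp q hq hpq
    have hp' := inv_ne_zero (hgood p (hsub h p hp)).1
    have hq' := inv_ne_zero (hgood q (hsub h q hq)).1
    rw [← (ProjSpace.mk_eq_iff (smul_ne_zero hp' p.rep_ne_zero) p).mpr ⟨_, hp', rfl⟩,
      ← (ProjSpace.mk_eq_iff (smul_ne_zero hq' q.rep_ne_zero) q).mpr ⟨_, hq', rfl⟩]
    change φ p = φ q at hpq
    congr 1
  have himage : φ '' {p | IsCriticalPoint V h p} = {y | y i = 1 ∧
      Sum.elim y (t • h.rep) ∈ (biQuotient _ _).cone (closure (criticalPairs V))} := by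
    ext y
    constructor
    · rintro ⟨p, hp, rfl⟩
      have hpi := (hgood p (hsub h p hp)).1
      have hy0 : φ p ≠ 0 := smul_ne_zero (inv_ne_zero hpi) p.rep_ne_zero
      refine ⟨inv_mul_cancel₀ hpi, (hmk _ hy0).mpr ?_⟩
      rw [(ProjSpace.mk_eq_iff hy0 p).mpr ⟨_, inv_ne_zero hpi, rfl⟩]
      exact hsub h p hp
    · rintro ⟨hyi, hy⟩
      have hy0 := (ne_zero_of_mem_biCone hy).1
      refine ⟨ProjSpace.mk y hy0, (hgood _ ((hmk y hy0).mp hy)).2, ?_⟩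
      obtain ⟨s, hs, hys⟩ := ProjSpace.exists_rep_mk y hy0
      have hyi' : s * (ProjSpace.mk y hy0).rep i = 1 := (congrFun hys i).symm.trans hyi
      have hsi : ((ProjSpace.mk y hy0).rep i)⁻¹ = s := (eq_inv_of_mul_eq_one_left hyi').symm
      change ((ProjSpace.mk y hy0).rep i)⁻¹ • (ProjSpace.mk y hy0).rep = y
      rw [hsi, ← hys]
  refine ⟨heq, Set.Finite.of_finite_image (by rw [himage]; exact hfin) hinj, ?_⟩
  rw [← hinj.ncard_image, himage]
  exact hncard

end

end RayleighRitz

end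

/-! ### The theorem. -/

open RayleighRitz in
theorem theorem5p1 (n c : ℕ) (V : Set (ProjSpace (Fin n)))
    (hVclosed : IsClosed V) (hVirr : IsIrreducible V)
    (hVQ : ¬ V ⊆ isotropicQuadric n)
    (hVcodim : topologicalKrullDim V + (c : WithBot ℕ∞) + 1 = (n : WithBot ℕ∞)) :
    -- an irreducible closed subvariety of dimension `(n+1 choose 2) - 1`
    (IsClosed (rrCorrespondence V) ∧ IsIrreducible (rrCorrespondence V) ∧
      topologicalKrullDim (rrCorrespondence V) =
        (((n + 1).choose 2 - 1 : ℕ) : WithBot ℕ∞)) ∧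
    -- over `V_reg \ Q` it is the projectivization of a vector bundle, with fibres projective
    -- spaces of dimension `(n+1 choose 2) - n + c`
    ((∀ x ∈ rrCorrespondence V, x.fst ∈ V) ∧
      ∃ E : ProjSpace (Fin n) → Submodule ℂ (Sym2 (Fin n) → ℂ),
        IsAlgebraicSubbundle (regularLocus V \ isotropicQuadric n) E
          ((n + 1).choose 2 - n + c + 1) ∧
        ∀ p ∈ regularLocus V \ isotropicQuadric n, ∀ h : ProjSpace (Sym2 (Fin n)),
          (⟨p, h⟩ : BiProj (Fin n) (Sym2 (Fin n))) ∈ rrCorrespondence V ↔ h.rep ∈ E p) ∧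
    -- the general fibre of the second projection is finite, of cardinality the RR degree
    (∃ d : ℕ, IsRRDegree V d ∧ (∀ d' : ℕ, IsRRDegree V d' → d' = d) ∧
      ∃ U : Set (ProjSpace (Sym2 (Fin n))), IsOpen U ∧ U.Nonempty ∧
        ∀ h ∈ U,
          {p | (⟨p, h⟩ : BiProj (Fin n) (Sym2 (Fin n))) ∈ rrCorrespondence V}.Finite ∧
          {p | (⟨p, h⟩ : BiProj (Fin n) (Sym2 (Fin n))) ∈ rrCorrespondence V}.ncard = d) := by
  obtain ⟨p₀, hp₀⟩ := hVirr.nonempty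
  obtain ⟨i₀, -⟩ := Function.ne_iff.mp p₀.rep_ne_zero
  have hne : Nonempty (Sym2 (Fin n)) := ⟨s(i₀, i₀)⟩
  -- The dimension of V is a natural number, so the codimension hypothesis can be read in ℕ.
  obtain ⟨D, hV⟩ : ∃ D, HasCodim V c D := by
    have hprime := TorusQuotient.isPrime_of_isIrreducible (Q := projQuotient (Fin n)) hVirr
    obtain ⟨D, hD, -⟩ := TorusQuotient.exists_topologicalKrullDim_eq hVclosed hVirr
      (TorusQuotient.aeval_genericPoint_eq_zero_iff (projQuotient (Fin n)) V)
    refine ⟨D, hD, ?_⟩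
    rw [hD] at hVcodim
    have : D + c + 1 = n := by exact_mod_cast hVcodim
    omega
  have hR : rrCorrespondence V = closure (criticalPairs V) := rfl
  refine ⟨?_, ⟨fun x hx => fst_mem_of_mem_closure hVclosed hx, _, hV.isAlgebraicSubbundle,
    fun p hp h => ⟨fun hx => hV.mem_rayleighSpace_of_mem_closure hp hx,
      fun hh => subset_closure (isCriticalPoint_iff.mpr ⟨hp, hh⟩)⟩⟩, ?_⟩
  · obtain ⟨L, _, _, ξ, η, e, g, hζ, hrank, -⟩ := exists_generic_pair hVclosed hVirr hV hVQ
    have hirr : IsIrreducible (rrCorrespondence V) :=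
      (TorusQuotient.isIrreducible_of_isPrime (isPrime_of_generic hζ)).closure
    rw [← TorusQuotient.vanishingIdeal_cone_closure, ← hR] at hζ
    obtain ⟨d, hd, hd', -⟩ := TorusQuotient.exists_topologicalKrullDim_eq isClosed_closure hirr hζ
    refine ⟨isClosed_closure, hirr, ?_⟩
    -- The torus has dimension 2, so (n+1 choose 2) + 1 = d + 2.
    rw [hrank, Nat.cast_inj, Fintype.card_bool] at hd'
    rw [show (n + 1).choose 2 - 1 = d by omega]
    exact hd
  · obtain ⟨d, U, hU, hUne, hUd⟩ := exists_general_fiber hVclosed hVirr hV hVQ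
    refine ⟨d, ⟨U, hU, hUne, fun h hh => (hUd h hh).2⟩, ?_, U, hU, hUne, fun h hh => ?_⟩
    · rintro d' ⟨U', hU', hUne', hUd'⟩
      -- Two nonempty open sets of an irreducible space meet, and a common matrix forces both counts
      -- to agree.
      obtain ⟨h, -, hh, hh'⟩ := ProjSpace.isIrreducible_univ.2 U U' hU hU'
        (by simpa using hUne) (by simpa using hUne')
      rw [← (hUd h hh).2.2, (hUd' h hh').2]
    · rw [hR, (hUd h hh).1]
      exact (hUd h hh).2
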